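/- Let $h_k$ ($k=0,1,2,\dots$) be the $L^2$-normalized Hermite functions on $\mathbb{R}$, and let $V$ be the space of complex-valued $b\in L^2_{\mathrm{loc}}(\mathbb{R})$ with $\|bh_k\|_2<\infty$ for all $k$ and $\|bh_k\|_2\to0$ as $k\to\infty$; put $\|b\|=\sup_k\|bh_k\|_2$ for $b\in V$. Let $b\in V$ and let $L=-d^2/dx^2+x^2+b(x)$ in $L^2(\mathbb{R})$, the sum of the self-adjoint harmonic oscillator and of the operator of multiplication by $b$, with resolvent $R(z)=(z-L)^{-1}$. Put $\lambda^0_k=2k+1$, $Y=8(\|b\|+2\pi\|b\|^2)$, $D(p,r)=\{z\in\mathbb{C}:|z-p|<r\}$, $\Pi(a,y)=\{z\in\mathbb{C}:|\mathrm{Re}\,z|<a,\ |\mathrm{Im}\,z|<y\}$ and $S(n)=\Pi(2n,Y)\cup\bigcup_{k\ge n}D(\lambda^0_k,1/16)$. Say that an integer $N\ge0$ is admissible if $\mathrm{Sp}(L)\subset S(N)$ and if for each $n\ge N$ the disk $D(\lambda^0_n,1/16)$ contains exactly one eigenvalue of $L$. For an admissible $N$ put $$S_N=\frac1{2\pi i}\int_{\partial\Pi(2N,Y)}R(z)\,dz,\qquad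 P_k=\frac1{2\pi i}\int_{\partial D(\lambda^0_k,1)}R(z)\,dz\quad(k\ge N).$$ 1. There is an admissible $N_*$ with $\dim S_{N_*}=N_*$ and $\dim P_k=1$ for all $k\ge N_*$, where $\dim$ denotes the rank. 2. For every admissible $N$, the operators $S_N$, $P_k$ ($k\ge N$) are projections whose pairwise products vanish, and for every $f\in L^2(\mathbb{R})$ $$f=S_Nf+\sum_{k\ge N}P_kf,$$ where the series converges unconditionally. 3. $L$ has a system of eigen- and associated functions $(\varphi_k)_{k\ge0}$ (a sequence composed of bases of the root subspaces of all eigenvalues of $L$), and every such system is an unconditional Schauder basis of $L^2(\mathbb{R})$. -/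

import Mathlib

open MeasureTheory Filter Topology
open scoped ENNReal SchwartzMap

noncomputable section

namespace HermitePerturbation

/-- The Hilbert space `L²(ℝ)` of complex-valued functions. -/
abbrev H : Type := Lp ℂ 2 (volume : Measure ℝ)

/-- The normalized Hermite functions `h_k(x) = (2^k k! √π)^{-1/2} H_k(x) e^{-x²/2}`, written with
the polynomials `He_k = Polynomial.hermite k`, where `H_k(x) = 2^{k/2} He_k(√2 x)`. -/
def hermiteFun (k : ℕ) (x : ℝ) : ℝ :=
  (√((k.factorial : ℝ) * √Real.pi))⁻¹
    * (Polynomial.aeval (√2 * x) (Polynomial.hermite k) : ℝ) * Real.exp (-x ^ 2 / 2)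

/-- `‖b h_k‖₂` in `[0, ∞]`. -/
def hermiteENorm (b : ℝ → ℂ) (k : ℕ) : ℝ≥0∞ :=
  eLpNorm (fun x => b x * (hermiteFun k x : ℂ)) 2 volume

/-- Membership in the space `V`. -/
structure MemV (b : ℝ → ℂ) : Prop where
  aestronglyMeasurable : AEStronglyMeasurable b volume
  locallyL2 : ∀ K : Set ℝ, IsCompact K → MemLp b 2 (volume.restrict K)
  finite : ∀ k, hermiteENorm b k < ∞
  tendsto_zero : Tendsto (hermiteENorm b) atTop (𝓝 0)

/-- The norm of `V`: `‖b‖ = sup_k ‖b h_k‖₂`. -/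
def normV (b : ℝ → ℂ) : ℝ := ⨆ k, (hermiteENorm b k).toReal

/-! ### The operators `L⁰`, `B` and `L` -/

/-- The formal harmonic oscillator `-φ'' + x² φ`. -/
def oscillator (φ : ℝ → ℂ) (x : ℝ) : ℂ := -(deriv (deriv φ) x) + (x : ℂ) ^ 2 * φ x

theorem exists_schwartz_oscillator (φ : 𝓢(ℝ, ℂ)) :
    ∃ ψ : 𝓢(ℝ, ℂ), ∀ x, ψ x = oscillator φ x := by
  refine ⟨-(SchwartzMap.derivCLM ℂ ℂ (SchwartzMap.derivCLM ℂ ℂ φ))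
    + SchwartzMap.smulLeftCLM ℂ (fun x : ℝ => (x : ℂ) ^ 2) φ, fun x => ?_⟩
  have hg : Function.HasTemperateGrowth (fun x : ℝ => (x : ℂ) ^ 2) := by fun_prop
  have h2 : (⇑(SchwartzMap.derivCLM ℂ ℂ φ) : ℝ → ℂ) = deriv φ := by
    ext y; simp
  simp [oscillator, SchwartzMap.smulLeftCLM_apply_apply hg, h2]

theorem integrable_mul_schwartz (f : H) (φ : 𝓢(ℝ, ℂ)) :
    Integrable (fun x => f x * φ x) volume :=
  (Lp.memLp f).integrable_mul (φ.memLp 2 volume)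

theorem integrable_mul_oscillator (f : H) (φ : 𝓢(ℝ, ℂ)) :
    Integrable (fun x => f x * oscillator φ x) volume := by
  obtain ⟨ψ, hψ⟩ := exists_schwartz_oscillator φ
  simpa only [hψ] using integrable_mul_schwartz f ψ

/-- The pairs `(f, g)` in `L² × L²` with `-f'' + x² f = g` in the sense of tempered distributions.
This is the graph of the self-adjoint operator `-d²/dx² + x²` on its maximal domain. -/
def oscillatorGraph : Submodule ℂ (H × H) where
  carrier := {p | ∀ φ : 𝓢(ℝ, ℂ), ∫ x, p.1 x * oscillator φ x = ∫ x, p.2 x * φ x}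
  zero_mem' := by
    intro φ
    have h0 : ((0 : H) : ℝ → ℂ) =ᵐ[volume] 0 := Lp.coeFn_zero ..
    have e1 : ∫ x, (0 : H) x * oscillator φ x = ∫ _, (0 : ℂ) :=
      integral_congr_ae (by filter_upwards [h0] with x hx; rw [hx, Pi.zero_apply, zero_mul])
    have e2 : ∫ x, (0 : H) x * φ x = ∫ _, (0 : ℂ) :=
      integral_congr_ae (by filter_upwards [h0] with x hx; rw [hx, Pi.zero_apply, zero_mul])
    exact e1.trans e2.symm
  add_mem' := by
    intro p q hp hq φ
    have e1 : ∫ x, (p.1 + q.1) x * oscillator φ x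
        = ∫ x, (p.1 x * oscillator φ x + q.1 x * oscillator φ x) :=
      integral_congr_ae (by
        filter_upwards [Lp.coeFn_add p.1 q.1] with x hx
        rw [hx, Pi.add_apply, add_mul])
    have e2 : ∫ x, (p.2 + q.2) x * φ x = ∫ x, (p.2 x * φ x + q.2 x * φ x) :=
      integral_congr_ae (by
        filter_upwards [Lp.coeFn_add p.2 q.2] with x hx
        rw [hx, Pi.add_apply, add_mul])
    change ∫ x, (p.1 + q.1) x * oscillator φ x = ∫ x, (p.2 + q.2) x * φ x
    rw [e1, e2, integral_add (integrable_mul_oscillator _ _) (integrable_mul_oscillator _ _),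
      integral_add (integrable_mul_schwartz _ _) (integrable_mul_schwartz _ _), hp φ, hq φ]
  smul_mem' := by
    intro c p hp φ
    have e1 : ∫ x, (c • p.1) x * oscillator φ x = ∫ x, c * (p.1 x * oscillator φ x) :=
      integral_congr_ae (by
        filter_upwards [Lp.coeFn_smul c p.1] with x hx
        rw [hx, Pi.smul_apply, smul_eq_mul, mul_assoc])
    have e2 : ∫ x, (c • p.2) x * φ x = ∫ x, c * (p.2 x * φ x) :=
      integral_congr_ae (by
        filter_upwards [Lp.coeFn_smul c p.2] with x hx
        rw [hx, Pi.smul_apply, smul_eq_mul, mul_assoc])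
    change ∫ x, (c • p.1) x * oscillator φ x = ∫ x, (c • p.2) x * φ x
    rw [e1, e2, integral_const_mul, integral_const_mul, hp φ]

theorem oscillatorGraph_snd_eq_zero (p : H × H) (hp : p ∈ oscillatorGraph) (h1 : p.1 = 0) :
    p.2 = 0 := by
  have key : ∀ φ : 𝓢(ℝ, ℂ), ∫ x, p.2 x * φ x = 0 := by
    intro φ
    rw [← hp φ, h1]
    have h0 : ((0 : H) : ℝ → ℂ) =ᵐ[volume] 0 := Lp.coeFn_zero ..
    have e1 : ∫ x, (0 : H) x * oscillator φ x = ∫ _, (0 : ℂ) :=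
      integral_congr_ae (by filter_upwards [h0] with x hx; rw [hx, Pi.zero_apply, zero_mul])
    rw [e1, integral_zero]
  rw [Lp.eq_zero_iff_ae_eq_zero]
  refine ae_eq_zero_of_integral_contDiff_smul_eq_zero
    ((Lp.memLp p.2).locallyIntegrable (by norm_num)) ?_
  intro g hg hgc
  have hgc' : HasCompactSupport (fun x => (g x : ℂ)) :=
    hgc.comp_left (g := fun t : ℝ => (t : ℂ)) (by simp)
  have hg' : ContDiff ℝ ((⊤ : ℕ∞) : WithTop ℕ∞) (fun x => (g x : ℂ)) :=
    Complex.ofRealCLM.contDiff.comp hg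
  rw [← key (hgc'.toSchwartzMap hg')]
  refine integral_congr_ae (Eventually.of_forall fun x => ?_)
  simp [mul_comm]

/-- `L⁰ = -d²/dx² + x²` as an unbounded operator in `L²(ℝ)`. -/
def L0 : H →ₗ.[ℂ] H := oscillatorGraph.toLinearPMap

theorem L0_graph : L0.graph = oscillatorGraph :=
  Submodule.toLinearPMap_graph_eq _ oscillatorGraph_snd_eq_zero

theorem memLp_mul_add {b : ℝ → ℂ} {f g : H} (hf : MemLp (fun x => b x * f x) 2 volume)
    (hg : MemLp (fun x => b x * g x) 2 volume) :
    MemLp (fun x => b x * (f + g : H) x) 2 volume := by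
  refine (hf.add hg).ae_eq ?_
  filter_upwards [Lp.coeFn_add f g] with x hx
  rw [hx]
  simp only [Pi.add_apply, mul_add]

theorem memLp_mul_smul {b : ℝ → ℂ} (c : ℂ) {f : H} (hf : MemLp (fun x => b x * f x) 2 volume) :
    MemLp (fun x => b x * (c • f : H) x) 2 volume := by
  refine (hf.const_smul c).ae_eq ?_
  filter_upwards [Lp.coeFn_smul c f] with x hx
  simp only [hx, Pi.smul_apply, smul_eq_mul]
  ring

/-- Multiplication by `b`, as an unbounded operator in `L²(ℝ)` on its maximal domain. -/
def mulOp (b : ℝ → ℂ) : H →ₗ.[ℂ] H where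
  domain :=
    { carrier := {f | MemLp (fun x => b x * f x) 2 volume}
      zero_mem' := by
        refine (MemLp.zero' : MemLp (fun _ : ℝ => (0 : ℂ)) 2 volume).ae_eq ?_
        have h0 : ((0 : H) : ℝ → ℂ) =ᵐ[volume] 0 := Lp.coeFn_zero ..
        filter_upwards [h0] with x hx
        rw [hx, Pi.zero_apply, mul_zero]
      add_mem' := fun hf hg => memLp_mul_add hf hg
      smul_mem' := fun c _ hf => memLp_mul_smul c hf }
  toFun :=
    { toFun := fun f => MemLp.toLp (fun x => b x * (f : H) x) f.2
      map_add' := by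
        intro f g
        rw [← MemLp.toLp_add]
        refine (MemLp.toLp_eq_toLp_iff _ _).2 ?_
        filter_upwards [Lp.coeFn_add (f : H) (g : H)] with x hx
        change b x * ((f : H) + (g : H) : H) x = _
        rw [hx]
        simp only [Pi.add_apply, mul_add]
      map_smul' := by
        intro c f
        rw [RingHom.id_apply, ← MemLp.toLp_const_smul]
        refine (MemLp.toLp_eq_toLp_iff _ _).2 ?_
        filter_upwards [Lp.coeFn_smul c (f : H)] with x hx
        simp only [SetLike.val_smul, hx, Pi.smul_apply, smul_eq_mul]
        ring }

/-- `L = L⁰ + B`; the domain of the sum is the intersection of the two domains. -/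
def L (b : ℝ → ℂ) : H →ₗ.[ℂ] H := L0 + mulOp b

/-! ### Resolvent, spectrum, root subspaces -/

/-- `R` is a bounded two-sided inverse of `z - A`. -/
def IsResolventAt (A : H →ₗ.[ℂ] H) (z : ℂ) (R : H →L[ℂ] H) : Prop :=
  (∀ f : H, ∃ hf : R f ∈ A.domain, z • R f - A ⟨R f, hf⟩ = f) ∧
    ∀ u : A.domain, R (z • (u : H) - A u) = u

/-- The spectrum of an unbounded operator. -/
def Sp (A : H →ₗ.[ℂ] H) : Set ℂ := {z | ¬ ∃ R, IsResolventAt A z R}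

open Classical in
/-- The resolvent `R(z) = (z - A)⁻¹` for `z ∉ Sp A` (and `0` on `Sp A`). -/
def resolv (A : H →ₗ.[ℂ] H) (z : ℂ) : H →L[ℂ] H :=
  if h : ∃ R, IsResolventAt A z R then h.choose else 0

/-- `μ` is an eigenvalue of `A`. -/
def IsEigenvalue (A : H →ₗ.[ℂ] H) (μ : ℂ) : Prop :=
  ∃ u : A.domain, (u : H) ≠ 0 ∧ A u = μ • (u : H)

/-- `ker (A - μ)^n`, with the natural domain of the power. -/
def rootKer (A : H →ₗ.[ℂ] H) (μ : ℂ) : ℕ → Submodule ℂ H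
  | 0 => ⊥
  | n + 1 => ((rootKer A μ n).comap (A.toFun - μ • A.domain.subtype)).map A.domain.subtype

/-- The root subspace of `A` at `μ`: all eigenvectors and associated vectors, and `0`. -/
def rootSpace (A : H →ₗ.[ℂ] H) (μ : ℂ) : Submodule ℂ H := ⨆ n, rootKer A μ n

/-- `φ` is a system of eigen- and associated functions of `A`: a sequence composed of bases of the
root subspaces of all eigenvalues of `A`. -/
def IsSEAF (A : H →ₗ.[ℂ] H) (φ : ℕ → H) : Prop :=
  ∃ ev : ℕ → ℂ, ∀ μ : ℂ,
    LinearIndepOn ℂ φ {k | ev k = μ} ∧ Submodule.span ℂ (φ '' {k | ev k = μ}) = rootSpace A μ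

/-! ### Localization of the spectrum and Riesz projections -/

/-- `Y = 8 (‖b‖ + 2π ‖b‖²)`. -/
def Y (b : ℝ → ℂ) : ℝ := 8 * (normV b + 2 * Real.pi * normV b ^ 2)

/-- `Π(a, y) = {x + iy' : |x| < a, |y'| < y}`. -/
def box (a y : ℝ) : Set ℂ := {z | |z.re| < a ∧ |z.im| < y}

/-- The unperturbed eigenvalue `λ⁰_k = 2k + 1`. -/
def ev0 (k : ℕ) : ℂ := 2 * k + 1

/-- `S(n) = Π(2n, Y) ∪ ⋃_{k ≥ n} D(λ⁰_k, 1/16)`. -/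
def S (b : ℝ → ℂ) (n : ℕ) : Set ℂ :=
  box (2 * n) (Y b) ∪ ⋃ k ∈ Set.Ici n, Metric.ball (ev0 k) (1 / 16)

/-- The spectrum of `L` lies in `S(N)`, and each disk `D(λ⁰_n, 1/16)`, `n ≥ N`, contains exactly
one eigenvalue of `L`. -/
def Localizes (b : ℝ → ℂ) (N : ℕ) : Prop :=
  Sp (L b) ⊆ S b N ∧
    ∀ n ≥ N, ∃! μ : ℂ, μ ∈ Metric.ball (ev0 n) (1 / 16) ∧ IsEigenvalue (L b) μ

/-- The integral over the positively oriented boundary of `Π(a, y)`. -/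
def boxIntegral (F : ℂ → (H →L[ℂ] H)) (a y : ℝ) : H →L[ℂ] H :=
  (∫ s in (-a)..a, F (s - y * Complex.I))
    + Complex.I • (∫ t in (-y)..y, F (a + t * Complex.I))
    - (∫ s in (-a)..a, F (s + y * Complex.I))
    - Complex.I • (∫ t in (-y)..y, F (-a + t * Complex.I))

/-- `S_* = (2πi)⁻¹ ∫_{∂Π(2N, Y)} R(z) dz`. -/
def projS (b : ℝ → ℂ) (N : ℕ) : H →L[ℂ] H :=
  (2 * Real.pi * Complex.I : ℂ)⁻¹ • boxIntegral (resolv (L b)) (2 * N) (Y b)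

/-- `P_k = (2πi)⁻¹ ∫_{|z - λ⁰_k| = 1} R(z) dz`. -/
def projP (b : ℝ → ℂ) (k : ℕ) : H →L[ℂ] H :=
  (2 * Real.pi * Complex.I : ℂ)⁻¹ • ∮ z in C(ev0 k, 1), resolv (L b) z

/-- The rank of a bounded operator, as a cardinal. -/
def dimRange (T : H →L[ℂ] H) : Cardinal := LinearMap.rank (T : H →ₗ[ℂ] H)

end HermitePerturbation

end

open HermitePerturbation

/-! In the Hermite basis the oscillator is diagonal with eigenvalues `ev0 k`, and `b` enters only
through the vectors `w k = b h_k`, which are bounded and tend to `0` in norm. `IsDiagPerturbation`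
records this, and the construction of root vectors uses nothing else about `b`.

Localization. Off the points `ev0 k` one has `z - L = (1 - K)(z - L⁰)` with `K e_k = (z - ev0 k)⁻¹
w_k`. The squared Hilbert–Schmidt norm of `K` is dominated by a convolution of `‖w_k‖²` with a
summable weight on the integers. It is at most `1/4` when `|Im z| ≥ Y` and `Im z ≠ 0`, and it
becomes small as `|Re z|` grows, away from the disks. A Neumann series then gives the resolvent
(`IsDiagPerturbation.exists_resolvent`).

Eigenvectors. For large `k` a contraction argument for `g = B u` yields an eigenvector `u = e_k +
x_k` with eigenvalue near `ev0 k`. The norms `‖w_k‖` need not be square summable, so the `x_k` need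
not be quadratically small. The basis property comes instead from off-diagonal decay, `|⟪e_j, x_k⟫|
≤ |⟪e_j, g_k⟫| / |j - k|`, together with `‖g_k‖ → 0`: this is a Bessel bound for the tail of `(x_k)`
with a small constant, so `e_k ↦ e_k + x_k` extends to a boundedly invertible `U`
(`IsDiagPerturbation.exists_riesz`).

The finite remainder. Multiplicities are counted by algebra, without comparing perturbed and
unperturbed Riesz projections. The conjugated resolvent `T = U⁻¹ R U` is diagonal on the tail `e_k`,
`k ≥ M`. Modulo the tail it is a finite matrix, invertible because `T` has dense range. Hence there
is a polynomial `q` such that `q(T)` maps into the tail `k ≥ N` and is invertible there. Then `ker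
q(T)` is a complement of that tail, so it has dimension exactly `N`, and it has a basis of root
vectors. Altogether `L` has a Riesz basis `V e_k` of root vectors (`MemV.exists_rootSystem`).

Conclusions. On a root vector `f` for `μ`, the resolvent is `(z - μ)⁻¹ f` plus poles of order at
least two, which have primitives. So each contour integral, divided by `2πi`, returns `f` or `0`
according to whether the contour encloses `μ`. The projections are thereby known on a Riesz basis,
and the expansion of `f` is its basis expansion grouped by disks. Any other system of eigen- and
associated functions differs from `V e_k` by a permutation, nonzero scalars and a change of basis in
`N` dimensions. -/

noncomputable section

namespace HermitePerturbation

/-! ### Hermite functions: eigenvalue equation and orthonormality. -/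

section

open Polynomial in
/-- `p ↦ p' - X p`, the action of `d/dx` on `p(x) e^{-x²/2}`. -/
def gaussDeriv (p : ℂ[X]) : ℂ[X] := derivative p - X * p

open Polynomial in
theorem hasDerivAt_eval_mul_exp (p : ℂ[X]) (x : ℝ) :
    HasDerivAt (fun y : ℝ => p.eval (y : ℂ) * Complex.exp (-(y : ℂ) ^ 2 / 2))
      ((gaussDeriv p).eval (x : ℂ) * Complex.exp (-(x : ℂ) ^ 2 / 2)) x := by
  have h1 := p.hasDerivAt (x : ℂ)
  have h2 : HasDerivAt (fun z : ℂ => Complex.exp (-z ^ 2 / 2))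
      (Complex.exp (-(x : ℂ) ^ 2 / 2) * (-(x : ℂ))) (x : ℂ) := by
    have := (((hasDerivAt_id (x : ℂ)).pow 2).neg.div_const 2).cexp
    refine this.congr_deriv ?_
    simp
    ring
  refine (h1.mul h2).comp_ofReal.congr_deriv ?_
  simp only [gaussDeriv, eval_sub, eval_mul, eval_X]
  ring

open Polynomial in
theorem iteratedDeriv_eval_mul_exp (n : ℕ) (p : ℂ[X]) :
    iteratedDeriv n (fun y : ℝ => p.eval (y : ℂ) * Complex.exp (-(y : ℂ) ^ 2 / 2))
      = fun y : ℝ => (gaussDeriv^[n] p).eval (y : ℂ) * Complex.exp (-(y : ℂ) ^ 2 / 2) := by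
  induction n with
  | zero => simp
  | succ n ih =>
    rw [iteratedDeriv_succ, ih, Function.iterate_succ_apply']
    funext x
    exact (hasDerivAt_eval_mul_exp _ x).deriv

theorem norm_exp_neg_sq (x : ℝ) :
    ‖Complex.exp (-(x : ℂ) ^ 2 / 2)‖ = Real.exp (-x ^ 2 / 2) := by
  rw [Complex.norm_exp]
  congr 1
  have : (-(x : ℂ) ^ 2 / 2) = ((-x ^ 2 / 2 : ℝ) : ℂ) := by push_cast; ring
  rw [this, Complex.ofReal_re]

theorem abs_pow_mul_exp_le (n : ℕ) (x : ℝ) :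
    |x| ^ n * Real.exp (-x ^ 2 / 2) ≤ n.factorial * Real.exp (1 / 2) := by
  have h1 : |x| ^ n ≤ n.factorial * Real.exp |x| := by
    have := Real.pow_div_factorial_le_exp |x| (abs_nonneg x) n
    rw [div_le_iff₀ (by positivity)] at this
    linarith
  calc |x| ^ n * Real.exp (-x ^ 2 / 2)
      ≤ n.factorial * Real.exp |x| * Real.exp (-x ^ 2 / 2) := by gcongr
    _ = n.factorial * Real.exp (|x| + -x ^ 2 / 2) := by rw [Real.exp_add]; ring
    _ ≤ _ := by
      gcongr
      nlinarith [sq_nonneg (|x| - 1), sq_abs x]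

open Polynomial in
theorem exists_norm_eval_mul_exp_le (p : ℂ[X]) :
    ∃ C : ℝ, ∀ x : ℝ, ‖p.eval (x : ℂ)‖ * Real.exp (-x ^ 2 / 2) ≤ C := by
  induction p using Polynomial.induction_on' with
  | add p q hp hq =>
    obtain ⟨C, hC⟩ := hp
    obtain ⟨D, hD⟩ := hq
    refine ⟨C + D, fun x => ?_⟩
    rw [eval_add]
    calc _ ≤ (‖p.eval (x : ℂ)‖ + ‖q.eval (x : ℂ)‖) * Real.exp (-x ^ 2 / 2) := by
          gcongr; exact norm_add_le _ _
      _ ≤ _ := by rw [add_mul]; exact add_le_add (hC x) (hD x)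
  | monomial n a =>
    refine ⟨‖a‖ * (n.factorial * Real.exp (1 / 2)), fun x => ?_⟩
    rw [eval_monomial, norm_mul, norm_pow, Complex.norm_real, Real.norm_eq_abs, mul_assoc]
    exact mul_le_mul_of_nonneg_left (abs_pow_mul_exp_le n x) (norm_nonneg _)

open Polynomial in
/-- The Schwartz function `p(x) e^{-x²/2}`. -/
def polyGauss (p : ℂ[X]) : 𝓢(ℝ, ℂ) where
  toFun x := p.eval (x : ℂ) * Complex.exp (-(x : ℂ) ^ 2 / 2)
  smooth' := by
    have h1 : ContDiff ℝ ((⊤ : ℕ∞) : WithTop ℕ∞) (fun z : ℂ => p.eval z) :=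
      (show ContDiff ℂ ((⊤ : ℕ∞) : WithTop ℕ∞) (fun z : ℂ => p.eval z) by
        simpa using p.contDiff_aeval (𝕜 := ℂ) _).restrict_scalars ℝ
    have h2 : ContDiff ℝ ((⊤ : ℕ∞) : WithTop ℕ∞) (fun z : ℂ => Complex.exp (-z ^ 2 / 2)) :=
      (show ContDiff ℂ ((⊤ : ℕ∞) : WithTop ℕ∞) (fun z : ℂ => Complex.exp (-z ^ 2 / 2)) by
        fun_prop).restrict_scalars ℝ
    exact (h1.mul h2).comp Complex.ofRealCLM.contDiff
  decay' := by
    intro k n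
    obtain ⟨C, hC⟩ := exists_norm_eval_mul_exp_le (X ^ k * gaussDeriv^[n] p)
    refine ⟨C, fun x => ?_⟩
    rw [norm_iteratedFDeriv_eq_norm_iteratedDeriv, iteratedDeriv_eval_mul_exp]
    refine le_trans (le_of_eq ?_) (hC x)
    simp only [norm_mul, norm_exp_neg_sq, eval_mul, eval_pow, eval_X, norm_pow, Complex.norm_real]
    ring


open Polynomial

theorem polyGauss_apply (p : ℂ[X]) (x : ℝ) :
    polyGauss p x = p.eval (x : ℂ) * Complex.exp (-(x : ℂ) ^ 2 / 2) := rfl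

theorem deriv_polyGauss (p : ℂ[X]) : deriv (polyGauss p) = polyGauss (gaussDeriv p) :=
  funext fun x => (hasDerivAt_eval_mul_exp p x).deriv

theorem integral_polyGauss_mul_gaussDeriv (p q : ℂ[X]) :
    ∫ x, polyGauss p x * polyGauss (gaussDeriv q) x
      = -∫ x, polyGauss (gaussDeriv p) x * polyGauss q x := by
  have := SchwartzMap.integral_mul_deriv_eq_neg_deriv_mul (polyGauss p) (polyGauss q)
  simpa only [deriv_polyGauss] using this

theorem oscillator_polyGauss (p : ℂ[X]) (x : ℝ) :
    oscillator (polyGauss p) x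
      = polyGauss (p + 2 * X * derivative p - derivative (derivative p)) x := by
  rw [oscillator, deriv_polyGauss, deriv_polyGauss]
  simp only [polyGauss_apply, gaussDeriv, derivative_sub, derivative_mul, derivative_X, eval_sub,
    eval_mul, eval_add, eval_X, eval_one, eval_ofNat]
  ring

theorem derivative_hermite (n : ℕ) :
    derivative (hermite (n + 1)) = ((n : ℤ[X]) + 1) * hermite n := by
  induction n with
  | zero => simp
  | succ n ih =>
    rw [hermite_succ (n + 1), derivative_sub, derivative_mul, derivative_X, ih, hermite_succ n]
    simp only [derivative_mul, derivative_add, derivative_natCast, derivative_one]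
    push_cast
    ring

/-- `He_k(√2 X)`. -/
def hermiteScaled (k : ℕ) : ℂ[X] :=
  ((hermite k).map (Int.castRingHom ℂ)).comp (C ((√2 : ℝ) : ℂ) * X)

theorem sqrt_two_mul_self : ((√2 : ℝ) : ℂ) * ((√2 : ℝ) : ℂ) = 2 := by
  rw [← Complex.ofReal_mul, Real.mul_self_sqrt (by norm_num)]; simp

theorem derivative_hermiteScaled_zero : derivative (hermiteScaled 0) = 0 := by
  simp [hermiteScaled]

theorem derivative_hermiteScaled_succ (k : ℕ) : derivative (hermiteScaled (k + 1))
    = C (((√2 : ℝ) : ℂ) * (k + 1)) * hermiteScaled k := by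
  rw [hermiteScaled, derivative_comp, derivative_map, derivative_hermite, hermiteScaled]
  simp
  ring

theorem sqrt_two_mul_hermiteScaled_succ (k : ℕ) : C ((√2 : ℝ) : ℂ) * hermiteScaled (k + 1)
    = 2 * X * hermiteScaled k - derivative (hermiteScaled k) := by
  have h2 : (C ((√2 : ℝ) : ℂ) * C ((√2 : ℝ) : ℂ) : ℂ[X]) = 2 := by
    rw [← C_mul, sqrt_two_mul_self]; rfl
  simp only [hermiteScaled, hermite_succ, derivative_comp, derivative_map, Polynomial.map_sub,
    Polynomial.map_mul, map_X, sub_comp, mul_comp, X_comp, derivative_mul, derivative_C,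
    derivative_X]
  linear_combination (X * ((hermite k).map (Int.castRingHom ℂ)).comp (C ((√2 : ℝ) : ℂ) * X)) * h2

theorem sqrt_two_mul_hermiteScaled_succ' (k : ℕ) : C ((√2 : ℝ) : ℂ) * hermiteScaled (k + 1)
    = X * hermiteScaled k - gaussDeriv (hermiteScaled k) := by
  rw [sqrt_two_mul_hermiteScaled_succ, gaussDeriv]; ring

theorem hermiteScaled_ode (k : ℕ) :
    hermiteScaled k + 2 * X * derivative (hermiteScaled k)
      - derivative (derivative (hermiteScaled k)) = C (2 * (k : ℂ) + 1) * hermiteScaled k := by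
  cases k with
  | zero => simp [derivative_hermiteScaled_zero]
  | succ k =>
    have h2 : (C ((√2 : ℝ) : ℂ) * C ((√2 : ℝ) : ℂ) : ℂ[X]) = 2 := by
      rw [← C_mul, sqrt_two_mul_self]; rfl
    have h := sqrt_two_mul_hermiteScaled_succ k
    rw [derivative_hermiteScaled_succ, derivative_mul, derivative_C]
    simp only [C_mul, C_add, map_natCast, map_one, map_ofNat]
    push_cast
    linear_combination (-C ((√2 : ℝ) : ℂ) * ((k : ℂ[X]) + 1)) * h
      + ((k : ℂ[X]) + 1) * hermiteScaled (k + 1) * h2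


/-- The raising operator `x - d/dx`, which produces `√2` times the next Hermite function, has
transpose `x + d/dx`, and the latter acts on `r e^{-x²/2}` by differentiating `r`. Iteration lowers
both indices together, which gives orthogonality and the norms. -/
theorem integral_polyGauss_hermiteScaled_succ (k : ℕ) (r : ℂ[X]) :
    ((√2 : ℝ) : ℂ) * ∫ x, polyGauss (hermiteScaled (k + 1)) x * polyGauss r x
      = ∫ x, polyGauss (hermiteScaled k) x * polyGauss (derivative r) x := by
  have hi : ∀ p q : ℂ[X], Integrable (fun x => polyGauss p x * polyGauss q x) volume :=
    fun p q => ((polyGauss p).memLp 2 volume).integrable_mul ((polyGauss q).memLp 2 volume)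
  have h1 := integral_polyGauss_mul_gaussDeriv (hermiteScaled k) r
  have h2 : ∀ x, ((√2 : ℝ) : ℂ) * (polyGauss (hermiteScaled (k + 1)) x * polyGauss r x)
      = polyGauss (hermiteScaled k) x * polyGauss (X * r) x
        - polyGauss (gaussDeriv (hermiteScaled k)) x * polyGauss r x := by
    intro x
    have := congrArg (eval (x : ℂ)) (sqrt_two_mul_hermiteScaled_succ' k)
    simp only [eval_mul, eval_C, eval_sub, eval_X] at this
    simp only [polyGauss_apply, eval_mul, eval_X]
    linear_combination (Complex.exp (-(x : ℂ) ^ 2 / 2) * (eval (x : ℂ) r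
      * Complex.exp (-(x : ℂ) ^ 2 / 2))) * this
  rw [← integral_const_mul]
  simp_rw [h2]
  rw [integral_sub (hi _ _) (hi _ _), sub_eq_add_neg, ← h1, ← integral_add (hi _ _) (hi _ _)]
  refine integral_congr_ae (Eventually.of_forall fun x => ?_)
  simp only [polyGauss_apply, gaussDeriv, eval_mul, eval_X, eval_sub]
  ring

theorem integral_polyGauss_one_mul_self :
    ∫ x, polyGauss (hermiteScaled 0) x * polyGauss (hermiteScaled 0) x = (√Real.pi : ℝ) := by
  have h := integral_gaussian 1
  rw [div_one] at h
  rw [← h, ← integral_complex_ofReal]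
  refine integral_congr_ae (Eventually.of_forall fun x => ?_)
  simp only [polyGauss_apply, hermiteScaled, hermite_zero, C_1, Polynomial.map_one, one_comp,
    eval_one, one_mul, ← Complex.exp_add, Complex.ofReal_exp]
  congr 1
  push_cast
  ring

theorem integral_hermiteScaled (k l : ℕ) :
    ∫ x, polyGauss (hermiteScaled k) x * polyGauss (hermiteScaled l) x
      = if k = l then ((k.factorial * √Real.pi : ℝ) : ℂ) else 0 := by
  have h2 : ((√2 : ℝ) : ℂ) ≠ 0 := by simp
  have hz : ∀ x, polyGauss 0 x = 0 := fun x => by simp [polyGauss_apply]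
  have step0 : ∀ k, ∫ x, polyGauss (hermiteScaled (k + 1)) x * polyGauss (hermiteScaled 0) x = 0 := by
    intro k
    have := integral_polyGauss_hermiteScaled_succ k (hermiteScaled 0)
    rw [derivative_hermiteScaled_zero] at this
    simpa [hz, h2] using this
  induction k generalizing l with
  | zero =>
    cases l with
    | zero => simpa using integral_polyGauss_one_mul_self
    | succ l => simpa [mul_comm] using step0 l
  | succ k ih =>
    cases l with
    | zero => simpa using step0 k
    | succ l =>
      have := integral_polyGauss_hermiteScaled_succ k (hermiteScaled (l + 1))
      rw [derivative_hermiteScaled_succ] at this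
      have e : ∀ x, polyGauss (hermiteScaled k) x
          * polyGauss (C (((√2 : ℝ) : ℂ) * (l + 1)) * hermiteScaled l) x
          = ((√2 : ℝ) : ℂ) * ((l + 1) * (polyGauss (hermiteScaled k) x
            * polyGauss (hermiteScaled l) x)) := by
        intro x
        simp only [polyGauss_apply, eval_mul, eval_C]
        ring
      simp_rw [e] at this
      rw [integral_const_mul, integral_const_mul, ih] at this
      rw [mul_left_cancel₀ h2 this]
      by_cases hkl : k = l
      · subst hkl
        simp [Nat.factorial_succ]
        ring
      · simp [hkl]

/-- The constant `(k! √π)^{-1/2}`. -/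
def hermiteConst (k : ℕ) : ℝ := (√((k.factorial : ℝ) * √Real.pi))⁻¹

theorem hermiteConst_pos (k : ℕ) : 0 < hermiteConst k := by
  unfold hermiteConst; positivity

/-- The Hermite function `h_k` as a Schwartz function. -/
def hermiteSchwartz (k : ℕ) : 𝓢(ℝ, ℂ) := polyGauss (C (hermiteConst k : ℂ) * hermiteScaled k)

theorem hermiteSchwartz_eq (k : ℕ) (x : ℝ) :
    hermiteSchwartz k x = (hermiteConst k : ℂ) * polyGauss (hermiteScaled k) x := by
  simp only [hermiteSchwartz, polyGauss_apply, eval_mul, eval_C, mul_assoc]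

theorem hermiteSchwartz_apply (k : ℕ) (x : ℝ) : hermiteSchwartz k x = (hermiteFun k x : ℂ) := by
  rw [hermiteSchwartz_eq, hermiteFun, polyGauss_apply, hermiteScaled, hermiteConst]
  have h1 : (((hermite k).map (Int.castRingHom ℂ)).comp (C ((√2 : ℝ) : ℂ) * X)).eval (x : ℂ)
      = ((aeval (√2 * x) (hermite k) : ℝ) : ℂ) := by
    rw [eval_comp, eval_mul, eval_C, eval_X, eval_map, ← Complex.ofReal_mul, aeval_def,
      ← Complex.ofRealHom_eq_coe, ← Complex.ofRealHom_eq_coe, hom_eval₂]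
    congr 1
  rw [h1]
  push_cast
  ring

theorem integral_hermiteSchwartz (k l : ℕ) :
    ∫ x, hermiteSchwartz k x * hermiteSchwartz l x = if k = l then 1 else 0 := by
  have e : ∀ x, hermiteSchwartz k x * hermiteSchwartz l x
      = ((hermiteConst k : ℂ) * hermiteConst l)
        * (polyGauss (hermiteScaled k) x * polyGauss (hermiteScaled l) x) := by
    intro x
    rw [hermiteSchwartz_eq, hermiteSchwartz_eq]
    ring
  simp_rw [e]
  rw [integral_const_mul, integral_hermiteScaled]
  split_ifs with h
  · subst h
    rw [← Complex.ofReal_mul, ← Complex.ofReal_mul, hermiteConst, ← mul_inv,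
      Real.mul_self_sqrt (by positivity), inv_mul_cancel₀ (by positivity), Complex.ofReal_one]
  · simp

theorem oscillator_hermiteSchwartz (k : ℕ) (x : ℝ) :
    oscillator (hermiteSchwartz k) x = (2 * k + 1) * hermiteSchwartz k x := by
  rw [hermiteSchwartz, oscillator_polyGauss]
  have := congrArg (eval (x : ℂ)) (hermiteScaled_ode k)
  simp only [eval_mul, eval_C, eval_sub, eval_X, eval_add, eval_ofNat] at this
  simp only [polyGauss_apply, derivative_mul, derivative_C, eval_mul, eval_C, eval_sub, eval_X,
    eval_add, eval_ofNat, zero_mul, zero_add]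
  linear_combination ((hermiteConst k : ℂ) * Complex.exp (-(x : ℂ) ^ 2 / 2)) * this

/-- The Hermite function `h_k` in `L²(ℝ)`. -/
def hermiteL2 (k : ℕ) : H := (hermiteSchwartz k).toLp 2 volume

theorem coeFn_hermiteL2 (k : ℕ) : hermiteL2 k =ᵐ[volume] hermiteSchwartz k :=
  (hermiteSchwartz k).coeFn_toLp 2 volume

theorem inner_hermiteL2 (k : ℕ) (f : H) :
    inner ℂ (hermiteL2 k) f = ∫ x, f x * hermiteSchwartz k x := by
  rw [L2.inner_def]
  refine integral_congr_ae ?_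
  filter_upwards [coeFn_hermiteL2 k] with x hx
  rw [hx, hermiteSchwartz_apply, RCLike.inner_apply, Complex.conj_ofReal]

theorem orthonormal_hermiteL2 : Orthonormal ℂ hermiteL2 := by
  rw [orthonormal_iff_ite]
  intro i j
  rw [inner_hermiteL2, ← integral_hermiteSchwartz i j]
  refine integral_congr_ae ?_
  filter_upwards [coeFn_hermiteL2 j] with x hx
  rw [hx, mul_comm]

end

/-! ### Completeness of the Hermite functions and the diagonal form of `L0`. -/

section

open Polynomial

theorem hermiteScaled_zero : hermiteScaled 0 = 1 := by simp [hermiteScaled]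

/-- The three-term recursion makes the span stable under multiplication by `X`, and it contains `1`.
-/
theorem mem_span_hermiteScaled (p : ℂ[X]) : p ∈ Submodule.span ℂ (Set.range hermiteScaled) := by
  set S := Submodule.span ℂ (Set.range hermiteScaled)
  have hmem : ∀ k, hermiteScaled k ∈ S := fun k => Submodule.subset_span ⟨k, rfl⟩
  have hX : ∀ k, X * hermiteScaled k ∈ S := by
    intro k
    have hd : derivative (hermiteScaled k) ∈ S := by
      cases k with
      | zero => rw [derivative_hermiteScaled_zero]; exact zero_mem _
      | succ k =>
        rw [derivative_hermiteScaled_succ, ← smul_eq_C_mul]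
        exact S.smul_mem _ (hmem k)
    have h := sqrt_two_mul_hermiteScaled_succ k
    have : X * hermiteScaled k = (1 / 2 : ℂ) • (((√2 : ℝ) : ℂ) • hermiteScaled (k + 1)
        + derivative (hermiteScaled k)) := by
      have h2 : (C (1 / 2 : ℂ) * 2 : ℂ[X]) = 1 := by
        rw [show (2 : ℂ[X]) = C 2 from rfl, ← C_mul]; norm_num
      rw [smul_eq_C_mul, smul_eq_C_mul, h]
      linear_combination (-X * hermiteScaled k) * h2
    rw [this]
    exact S.smul_mem _ (S.add_mem (S.smul_mem _ (hmem _)) hd)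
  have hXS : ∀ p ∈ S, X * p ∈ S := by
    intro p hp
    induction hp using Submodule.span_induction with
    | mem q hq => obtain ⟨k, rfl⟩ := hq; exact hX k
    | zero => simp
    | add q r _ _ hq hr => rw [mul_add]; exact S.add_mem hq hr
    | smul c q _ hq => rw [mul_smul_comm]; exact S.smul_mem _ hq
  have hpow : ∀ n : ℕ, (X ^ n : ℂ[X]) ∈ S := by
    intro n
    induction n with
    | zero => rw [pow_zero, ← hermiteScaled_zero]; exact hmem 0
    | succ n ih => rw [pow_succ']; exact hXS _ ih
  rw [p.as_sum_support_C_mul_X_pow]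
  refine Submodule.sum_mem _ fun i _ => ?_
  rw [← smul_eq_C_mul]
  exact S.smul_mem _ (hpow i)

theorem integral_mul_polyGauss_eq_zero {f : H} (hf : ∀ k, inner ℂ (hermiteL2 k) f = 0)
    (p : ℂ[X]) : ∫ x, f x * polyGauss p x = 0 := by
  have hp := mem_span_hermiteScaled p
  induction hp using Submodule.span_induction with
  | mem q hq =>
    obtain ⟨k, rfl⟩ := hq
    have := hf k
    rw [inner_hermiteL2] at this
    simp_rw [hermiteSchwartz_eq, mul_left_comm] at this
    rw [integral_const_mul] at this
    exact (mul_eq_zero.1 this).resolve_left (by exact_mod_cast (hermiteConst_pos k).ne')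
  | zero => simp [polyGauss_apply]
  | add q r _ _ hq hr =>
    have : ∀ x, f x * polyGauss (q + r) x = f x * polyGauss q x + f x * polyGauss r x := by
      intro x; simp only [polyGauss_apply, eval_add]; ring
    simp_rw [this]
    rw [integral_add (integrable_mul_schwartz _ _) (integrable_mul_schwartz _ _), hq, hr, add_zero]
  | smul c q _ hq =>
    have : ∀ x, f x * polyGauss (c • q) x = c * (f x * polyGauss q x) := by
      intro x; simp only [polyGauss_apply, eval_smul, smul_eq_mul]; ring
    simp_rw [this]
    rw [integral_const_mul, hq, mul_zero]

theorem memLp_exp_neg_sq : MemLp (fun x : ℝ => Real.exp (-x ^ 2 / 4)) 2 volume := by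
  rw [memLp_two_iff_integrable_sq (by fun_prop)]
  refine (integrable_exp_neg_mul_sq (b := 1 / 2) (by norm_num)).congr
    (Eventually.of_forall fun x => ?_)
  simp only [← Real.exp_nat_mul]
  congr 1
  push_cast
  ring

/-- Expanding the exponential turns the Fourier transform of `f e^{-x²/2}` into a series of moments,
all of which vanish. Dominated convergence justifies the exchange. -/
theorem integral_mul_cexp_eq_zero {f : H} (hf : ∀ k, inner ℂ (hermiteL2 k) f = 0) (t : ℝ) :
    ∫ x : ℝ, Complex.exp (t * x * Complex.I) * (f x * polyGauss 1 x) = 0 := by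
  have hterm : ∀ (n : ℕ) (x : ℝ),
      (t * x * Complex.I) ^ n / (n.factorial : ℂ) * (f x * polyGauss 1 x)
      = (t * Complex.I) ^ n / (n.factorial : ℂ) * (f x * polyGauss (X ^ n) x) := by
    intro n x
    simp only [polyGauss_apply, eval_one, eval_pow, eval_X, mul_pow]
    ring
  have hnorm : ∀ x : ℝ, ‖f x * polyGauss 1 x‖ = ‖f x‖ * Real.exp (-x ^ 2 / 2) := by
    intro x
    rw [norm_mul, polyGauss_apply, eval_one, one_mul, norm_exp_neg_sq]
  have hsum : ∀ x : ℝ, HasSum (fun n : ℕ => |t * x| ^ n / n.factorial) (Real.exp |t * x|) := by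
    intro x
    rw [Real.exp_eq_exp_ℝ]
    exact NormedSpace.expSeries_div_hasSum_exp (𝔸 := ℝ) |t * x|
  have hmeas : AEStronglyMeasurable (fun x => f x * polyGauss 1 x) volume :=
    (integrable_mul_schwartz f _).aestronglyMeasurable
  have key := hasSum_integral_of_dominated_convergence (μ := (volume : Measure ℝ))
    (F := fun (n : ℕ) (x : ℝ) => (t * x * Complex.I) ^ n / (n.factorial : ℂ)
      * (f x * polyGauss 1 x))
    (f := fun x => Complex.exp (t * x * Complex.I) * (f x * polyGauss 1 x))
    (fun n x => |t * x| ^ n / n.factorial * (‖f x‖ * Real.exp (-x ^ 2 / 2))) ?_ ?_ ?_ ?_ ?_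
  · refine key.unique ?_
    have : ∀ n : ℕ, ∫ x, (t * x * Complex.I) ^ n / (n.factorial : ℂ)
        * (f x * polyGauss 1 x) = 0 := by
      intro n
      simp_rw [hterm]
      rw [integral_const_mul, integral_mul_polyGauss_eq_zero hf, mul_zero]
    simp_rw [this]
    exact hasSum_zero
  · intro n
    simp_rw [hterm]
    exact ((integrable_mul_schwartz f _).const_mul _).aestronglyMeasurable
  · intro n
    refine Eventually.of_forall fun x => le_of_eq ?_
    rw [norm_mul, hnorm]
    congr 1
    simp [abs_mul]
  · exact Eventually.of_forall fun x => (hsum x).summable.mul_right _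
  · simp_rw [fun x => ((hsum x).mul_right (‖f x‖ * Real.exp (-x ^ 2 / 2))).tsum_eq]
    have hi : Integrable (fun x => Real.exp (t ^ 2) * (‖f x‖ * Real.exp (-x ^ 2 / 4))) volume :=
      ((Lp.memLp f).norm.integrable_mul memLp_exp_neg_sq).const_mul _
    refine hi.mono' ?_ (Eventually.of_forall fun x => ?_)
    · have : AEStronglyMeasurable (fun x => ‖f x‖) volume := (Lp.aestronglyMeasurable f).norm
      have h2 : Continuous fun x : ℝ => Real.exp |t * x| := by fun_prop
      have h3 : Continuous fun x : ℝ => Real.exp (-x ^ 2 / 2) := by fun_prop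
      exact h2.aestronglyMeasurable.mul (this.mul h3.aestronglyMeasurable)
    · rw [Real.norm_of_nonneg (by positivity)]
      -- From `|t||x| ≤ t² + x²/4`: half of the Gaussian exponent absorbs the exponential growth,
      -- and the other half is still in `L²`.
      have h4 : Real.exp |t * x| * Real.exp (-x ^ 2 / 2)
          ≤ Real.exp (t ^ 2) * Real.exp (-x ^ 2 / 4) := by
        rw [← Real.exp_add, ← Real.exp_add]
        refine Real.exp_le_exp.2 ?_
        rw [abs_mul]
        nlinarith [sq_nonneg (|t| - |x| / 2), sq_abs x, sq_abs t]
      calc _ = ‖f x‖ * (Real.exp |t * x| * Real.exp (-x ^ 2 / 2)) := by ring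
        _ ≤ ‖f x‖ * (Real.exp (t ^ 2) * Real.exp (-x ^ 2 / 4)) := by gcongr
        _ = _ := by ring
  · refine Eventually.of_forall fun x => HasSum.mul_right _ ?_
    rw [Complex.exp_eq_exp_ℂ]
    exact NormedSpace.expSeries_div_hasSum_exp (𝔸 := ℂ) _


-- The integrable function `f e^{-x²/2}` has zero Fourier transform. Moving the transform across the
-- pairing shows that it annihilates every Schwartz function, and the Gaussian factor has no zeros.
open scoped FourierTransform in
theorem eq_zero_of_inner_hermiteL2 {f : H} (hf : ∀ k, inner ℂ (hermiteL2 k) f = 0) : f = 0 := by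
  have hg : Integrable (fun x => f x * polyGauss 1 x) volume := integrable_mul_schwartz f _
  have hF : VectorFourier.fourierIntegral Real.fourierChar volume (innerₗ ℝ)
      (fun x => f x * polyGauss 1 x) = 0 := by
    funext w
    change 𝓕 (fun x => f x * polyGauss 1 x) w = 0
    rw [Real.fourier_real_eq_integral_exp_smul, ← integral_mul_cexp_eq_zero hf (-2 * Real.pi * w)]
    refine integral_congr_ae (Eventually.of_forall fun x => ?_)
    simp only [smul_eq_mul]
    congr 3
    push_cast
    ring
  have key : ∀ φ : 𝓢(ℝ, ℂ), ∫ x, (f x * polyGauss 1 x) * φ x = 0 := by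
    intro φ
    have h := VectorFourier.integral_fourierIntegral_smul_eq_flip (L := innerₗ ℝ)
      (μ := volume) (ν := volume) Real.continuous_fourierChar continuous_inner hg
      (𝓕⁻ φ : 𝓢(ℝ, ℂ)).integrable
    rw [hF] at h
    have h2 : ∀ x, VectorFourier.fourierIntegral Real.fourierChar volume (innerₗ ℝ).flip
        ((𝓕⁻ φ : 𝓢(ℝ, ℂ)) : ℝ → ℂ) x = φ x := by
      intro x
      rw [flip_innerₗ]
      change (𝓕 ((𝓕⁻ φ : 𝓢(ℝ, ℂ)) : ℝ → ℂ)) x = φ x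
      rw [← SchwartzMap.fourier_coe, FourierTransform.fourier_fourierInv_eq]
    simp_rw [h2] at h
    simpa using h.symm
  have hzero : ∀ᵐ x, f x * polyGauss 1 x = 0 := by
    refine ae_eq_zero_of_integral_contDiff_smul_eq_zero hg.locallyIntegrable ?_
    intro g hg hgc
    have hgc' : HasCompactSupport (fun x => (g x : ℂ)) :=
      hgc.comp_left (g := fun t : ℝ => (t : ℂ)) (by simp)
    have hg' : ContDiff ℝ ((⊤ : ℕ∞) : WithTop ℕ∞) (fun x => (g x : ℂ)) :=
      Complex.ofRealCLM.contDiff.comp hg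
    rw [← key (hgc'.toSchwartzMap hg')]
    refine integral_congr_ae (Eventually.of_forall fun x => ?_)
    simp [mul_comm]
  rw [Lp.eq_zero_iff_ae_eq_zero]
  filter_upwards [hzero] with x hx
  simpa [polyGauss_apply] using hx

/-- The Hermite functions as a Hilbert basis of `L²(ℝ)`. -/
def hermiteBasis : HilbertBasis ℕ ℂ H :=
  HilbertBasis.mkOfOrthogonalEqBot orthonormal_hermiteL2 (by
    rw [Submodule.eq_bot_iff]
    intro f hf
    refine eq_zero_of_inner_hermiteL2 fun k => ?_
    exact (Submodule.mem_orthogonal _ f).1 hf _ (Submodule.subset_span ⟨k, rfl⟩))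

theorem hermiteBasis_apply (k : ℕ) : hermiteBasis k = hermiteL2 k := by
  rw [hermiteBasis, HilbertBasis.coe_mkOfOrthogonalEqBot]

theorem inner_hermiteBasis (k : ℕ) (f : H) :
    inner ℂ (hermiteBasis k) f = ∫ x, f x * hermiteSchwartz k x := by
  rw [hermiteBasis_apply, inner_hermiteL2]

/-- The oscillator on Schwartz functions. -/
def schwartzOscillator (φ : 𝓢(ℝ, ℂ)) : 𝓢(ℝ, ℂ) := (exists_schwartz_oscillator φ).choose

theorem schwartzOscillator_apply (φ : 𝓢(ℝ, ℂ)) (x : ℝ) :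
    schwartzOscillator φ x = oscillator φ x := (exists_schwartz_oscillator φ).choose_spec x

theorem integral_oscillator_mul (φ ψ : 𝓢(ℝ, ℂ)) :
    ∫ x, oscillator φ x * ψ x = ∫ x, φ x * oscillator ψ x := by
  have hi : ∀ p q : 𝓢(ℝ, ℂ), Integrable (fun x => p x * q x) volume :=
    fun p q => (p.memLp 2 volume).integrable_mul (q.memLp 2 volume)
  have hd : ∀ p : 𝓢(ℝ, ℂ), (⇑(SchwartzMap.derivCLM ℂ ℂ p) : ℝ → ℂ) = deriv p := by
    intro p; ext y; simp
  have hdd : ∀ p q : 𝓢(ℝ, ℂ), ∫ x, deriv (deriv p) x * q x = -∫ x, deriv p x * deriv q x := by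
    intro p q
    have := SchwartzMap.integral_mul_deriv_eq_neg_deriv_mul q (SchwartzMap.derivCLM ℂ ℂ p)
    rw [hd] at this
    simpa only [mul_comm] using this
  have hII : ∀ p q : 𝓢(ℝ, ℂ), Integrable (fun x => deriv (deriv p) x * q x) volume := by
    intro p q
    have := hi (SchwartzMap.derivCLM ℂ ℂ (SchwartzMap.derivCLM ℂ ℂ p)) q
    rwa [hd, hd] at this
  have h1 : ∀ p q : 𝓢(ℝ, ℂ), Integrable (fun x : ℝ => (x : ℂ) ^ 2 * p x * q x) volume := by
    intro p q
    have := (hi (schwartzOscillator p) q).add (hII p q)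
    refine this.congr (Eventually.of_forall fun x => ?_)
    simp only [Pi.add_apply, schwartzOscillator_apply, oscillator]
    ring
  have e : ∀ p q : 𝓢(ℝ, ℂ), ∫ x, oscillator p x * q x
      = (∫ x : ℝ, (x : ℂ) ^ 2 * p x * q x) + ∫ x, deriv p x * deriv q x := by
    intro p q
    have : ∀ x, oscillator p x * q x = (x : ℂ) ^ 2 * p x * q x - deriv (deriv p) x * q x := by
      intro x; rw [oscillator]; ring
    simp_rw [this]
    rw [integral_sub (h1 p q) (hII p q), hdd, sub_neg_eq_add]
  rw [e]
  simp_rw [mul_comm (φ _) (oscillator _ _)]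
  rw [e]
  congr 1
  · congr 1; funext x; ring
  · congr 1; funext x; ring

theorem hermiteL2_mem_oscillatorGraph (k : ℕ) :
    (hermiteBasis k, (2 * k + 1 : ℂ) • hermiteBasis k) ∈ oscillatorGraph := by
  intro φ
  have e1 : ∫ x, (hermiteBasis k) x * oscillator φ x = ∫ x, hermiteSchwartz k x * oscillator φ x := by
    rw [hermiteBasis_apply]
    refine integral_congr_ae ?_
    filter_upwards [coeFn_hermiteL2 k] with x hx
    rw [hx]
  have e2 : ∫ x, ((2 * k + 1 : ℂ) • hermiteBasis k : H) x * φ x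
      = ∫ x, oscillator (hermiteSchwartz k) x * φ x := by
    rw [hermiteBasis_apply]
    refine integral_congr_ae ?_
    filter_upwards [coeFn_hermiteL2 k, Lp.coeFn_smul (2 * k + 1 : ℂ) (hermiteL2 k)] with x hx hx2
    rw [hx2, Pi.smul_apply, hx, oscillator_hermiteSchwartz, smul_eq_mul]
  change ∫ x, (hermiteBasis k) x * oscillator φ x
    = ∫ x, ((2 * k + 1 : ℂ) • hermiteBasis k : H) x * φ x
  rw [e1, e2, integral_oscillator_mul]

theorem integral_mul_schwartz_eq_inner (φ : 𝓢(ℝ, ℂ)) :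
    ∃ g : H, ∀ f : H, ∫ x, f x * φ x = inner ℂ g f := by
  let ψ := SchwartzMap.postcompCLM (𝕜 := ℝ) (Complex.conjCLE : ℂ →L[ℝ] ℂ) φ
  refine ⟨ψ.toLp 2 volume, fun f => ?_⟩
  rw [L2.inner_def]
  refine integral_congr_ae ?_
  filter_upwards [ψ.coeFn_toLp 2 volume] with x hx
  rw [hx, RCLike.inner_apply]
  simp [ψ]

theorem isClosed_oscillatorGraph : IsClosed (oscillatorGraph : Set (H × H)) := by
  have : (oscillatorGraph : Set (H × H))
      = ⋂ φ : 𝓢(ℝ, ℂ), {p | ∫ x, p.1 x * oscillator φ x = ∫ x, p.2 x * φ x} := by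
    ext p; simp only [Set.mem_iInter]; rfl
  rw [this]
  refine isClosed_iInter fun φ => ?_
  obtain ⟨g, hg⟩ := integral_mul_schwartz_eq_inner φ
  obtain ⟨g', hg'⟩ := integral_mul_schwartz_eq_inner (schwartzOscillator φ)
  simp_rw [schwartzOscillator_apply] at hg'
  simp_rw [hg, hg']
  exact isClosed_eq (by fun_prop) (by fun_prop)

/-- Testing against `h_k` gives the coordinate equations. Conversely, the partial Hermite sums of
`(f, g)` lie in the graph, which is closed. So the maximal distributional operator is no larger than
the diagonal one. -/
theorem mem_oscillatorGraph_iff (f g : H) : (f, g) ∈ oscillatorGraph ↔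
    ∀ k : ℕ, inner ℂ (hermiteBasis k) g = (2 * k + 1) * inner ℂ (hermiteBasis k) f := by
  constructor
  · intro h k
    have := h (hermiteSchwartz k)
    rw [inner_hermiteBasis, inner_hermiteBasis, ← this, ← integral_const_mul]
    refine integral_congr_ae (Eventually.of_forall fun x => ?_)
    simp only [oscillator_hermiteSchwartz]
    ring
  · intro h
    have h1 := hermiteBasis.hasSum_repr f
    have h2 := hermiteBasis.hasSum_repr g
    refine isClosed_oscillatorGraph.mem_of_tendsto (h1.prodMk h2)
      (Eventually.of_forall fun s => ?_)
    refine Submodule.sum_mem _ fun k _ => ?_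
    have := oscillatorGraph.smul_mem (inner ℂ (hermiteBasis k) f) (hermiteL2_mem_oscillatorGraph k)
    rw [HilbertBasis.repr_apply_apply, HilbertBasis.repr_apply_apply, h k]
    convert! this using 1
    ext1
    · rfl
    · simp only [Prod.smul_snd, smul_smul]
      rw [mul_comm]

theorem mem_L0_domain_iff (u : H) : u ∈ L0.domain ↔ ∃ g : H,
    ∀ k : ℕ, inner ℂ (hermiteBasis k) g = (2 * k + 1) * inner ℂ (hermiteBasis k) u := by
  rw [LinearPMap.mem_domain_iff, L0_graph]
  simp_rw [mem_oscillatorGraph_iff]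

theorem L0_apply_eq (u : L0.domain) (g : H)
    (hg : ∀ k : ℕ, inner ℂ (hermiteBasis k) g = (2 * k + 1) * inner ℂ (hermiteBasis k) (u : H)) :
    L0 u = g := by
  have h : ((u : H), g) ∈ L0.graph := by rw [L0_graph, mem_oscillatorGraph_iff]; exact hg
  exact ((LinearPMap.image_iff u.2).2 h).symm

end

/-! ### The perturbed operator in Hermite coordinates. -/

section

variable {b : ℝ → ℂ}

theorem MemV.memLp (hb : MemV b) (k : ℕ) :
    MemLp (fun x => b x * (hermiteFun k x : ℂ)) 2 volume := by
  refine ⟨hb.aestronglyMeasurable.mul ?_, hb.finite k⟩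
  have : Continuous fun x => (hermiteFun k x : ℂ) := by
    simp_rw [← hermiteSchwartz_apply]
    exact (hermiteSchwartz k).continuous
  exact this.aestronglyMeasurable

/-- The vectors `b h_k`. -/
def MemV.image (hb : MemV b) (k : ℕ) : H := (hb.memLp k).toLp _

theorem MemV.norm_image (hb : MemV b) (k : ℕ) : ‖hb.image k‖ = (hermiteENorm b k).toReal :=
  Lp.norm_toLp _ _

theorem MemV.tendsto_norm_image (hb : MemV b) : Tendsto (fun k => ‖hb.image k‖) atTop (𝓝 0) := by
  simp_rw [hb.norm_image]
  exact (ENNReal.tendsto_toReal ENNReal.zero_ne_top).comp hb.tendsto_zero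

theorem MemV.norm_image_le (hb : MemV b) (k : ℕ) : ‖hb.image k‖ ≤ normV b := by
  have h := hb.tendsto_norm_image.bddAbove_range
  simp_rw [hb.norm_image] at h
  rw [hb.norm_image]
  exact le_ciSup h k

/-- Multiplication by any function is a closed operation, because `L²` convergence of both sequences
gives almost everywhere convergence along a common subsequence. -/
theorem mul_ae_eq_of_tendsto {s t : ℕ → H} {u v : H} (hs : Tendsto s atTop (𝓝 u))
    (ht : Tendsto t atTop (𝓝 v)) (hst : ∀ n, ∀ᵐ x, b x * s n x = t n x) :
    ∀ᵐ x, b x * u x = v x := by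
  obtain ⟨n1, hn1, h1⟩ := (tendstoInMeasure_of_tendsto_Lp hs).exists_seq_tendsto_ae
  obtain ⟨n2, hn2, h2⟩ :=
    (tendstoInMeasure_of_tendsto_Lp (ht.comp hn1.tendsto_atTop)).exists_seq_tendsto_ae
  filter_upwards [h1, h2, ae_all_iff.2 hst] with x hx1 hx2 hx
  refine tendsto_nhds_unique ?_ hx2
  have := (hx1.comp hn2.tendsto_atTop).const_mul (b x)
  refine this.congr fun n => ?_
  exact hx _

theorem MemV.image_ae (hb : MemV b) (k : ℕ) : ∀ᵐ x, b x * hermiteBasis k x = hb.image k x := by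
  filter_upwards [(hb.memLp k).coeFn_toLp, coeFn_hermiteL2 k] with x h1 h2
  rw [hermiteBasis_apply, h2, hermiteSchwartz_apply]
  exact h1.symm

theorem MemV.mul_ae_eq_of_hasSum (hb : MemV b) {u v : H}
    (h : HasSum (fun k => inner ℂ (hermiteBasis k) u • hb.image k) v) :
    ∀ᵐ x, b x * u x = v x := by
  have h0 := hermiteBasis.hasSum_repr u
  simp_rw [HilbertBasis.repr_apply_apply] at h0
  refine mul_ae_eq_of_tendsto h0.tendsto_sum_nat h.tendsto_sum_nat fun n => ?_
  induction n with
  | zero =>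
    simp only [Finset.range_zero, Finset.sum_empty]
    filter_upwards [Lp.coeFn_zero ℂ 2 (volume : Measure ℝ)] with x hx
    rw [hx]; simp
  | succ n ih =>
    simp only [Finset.sum_range_succ]
    filter_upwards [ih, hb.image_ae n, Lp.coeFn_add
      (∑ k ∈ Finset.range n, inner ℂ (hermiteBasis k) u • hermiteBasis k)
      (inner ℂ (hermiteBasis n) u • hermiteBasis n), Lp.coeFn_add
      (∑ k ∈ Finset.range n, inner ℂ (hermiteBasis k) u • hb.image k)
      (inner ℂ (hermiteBasis n) u • hb.image n),
      Lp.coeFn_smul (inner ℂ (hermiteBasis n) u) (hermiteBasis n),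
      Lp.coeFn_smul (inner ℂ (hermiteBasis n) u) (hb.image n)] with x h1 h2 h3 h4 h5 h6
    rw [h3, h4, Pi.add_apply, Pi.add_apply, h5, h6, Pi.smul_apply, Pi.smul_apply, ← h1, ← h2]
    simp only [smul_eq_mul]
    ring

/-- `A` acts as `∑ u_k e_k ↦ ∑ (2k+1) u_k e_k + ∑ u_k w_k` on the maximal domain of the diagonal
part. -/
structure IsDiagPerturbation (e : HilbertBasis ℕ ℂ H) (w : ℕ → H) (A : H →ₗ.[ℂ] H) : Prop where
  mem_domain : ∀ u : H, u ∈ A.domain ↔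
    ∃ g : H, ∀ k : ℕ, inner ℂ (e k) g = (2 * k + 1) * inner ℂ (e k) u
  hasSum_apply : ∀ (u : A.domain) (g : H),
    (∀ k : ℕ, inner ℂ (e k) g = (2 * k + 1) * inner ℂ (e k) (u : H)) →
      HasSum (fun k => inner ℂ (e k) (u : H) • w k) (A u - g)

theorem summable_one_div_odd_sq : Summable fun k : ℕ => 1 / (2 * (k : ℝ) + 1) ^ 2 := by
  have h : Summable fun k : ℕ => 1 / ((k : ℝ) + 1) ^ 2 := by
    have := (summable_nat_add_iff 1).2 (Real.summable_one_div_nat_pow.2 one_lt_two)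
    simpa using this
  refine Summable.of_nonneg_of_le (fun k => by positivity) (fun k => ?_) h
  gcongr
  linarith [(Nat.cast_nonneg k : (0 : ℝ) ≤ k)]

theorem HilbertBasis.summable_sq_norm_inner (e : HilbertBasis ℕ ℂ H) (f : H) :
    Summable fun k => ‖inner ℂ (e k) f‖ ^ 2 :=
  e.orthonormal.inner_products_summable f

/-- The coordinates of `u` are products of the square-summable sequences `⟪e k, g⟫` and `1/(2k+1)`.
Their absolute summability is what lets `∑ u_k w_k` converge for `w` merely bounded. -/
theorem summable_norm_inner_of_diag (e : HilbertBasis ℕ ℂ H) {u g : H}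
    (hg : ∀ k : ℕ, inner ℂ (e k) g = (2 * k + 1) * inner ℂ (e k) u) :
    Summable fun k => ‖inner ℂ (e k) u‖ := by
  refine Summable.of_nonneg_of_le (fun k => norm_nonneg _) (fun k => ?_)
    ((HilbertBasis.summable_sq_norm_inner e g).add summable_one_div_odd_sq)
  have h1 : ‖(inner ℂ (e k) g : ℂ)‖ = (2 * k + 1) * ‖inner ℂ (e k) u‖ := by
    rw [hg, norm_mul]
    congr 1
    have : (2 * (k : ℂ) + 1) = ((2 * k + 1 : ℝ) : ℂ) := by push_cast; ring
    rw [this, Complex.norm_real, Real.norm_of_nonneg (by positivity)]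
  rw [h1]
  set a := ‖(inner ℂ (e k) u : ℂ)‖
  have hk : (0 : ℝ) < 2 * k + 1 := by positivity
  have h2 : a = ((2 * k + 1) * a) * (1 / (2 * k + 1)) := by field_simp
  have h3 : 1 / (2 * (k : ℝ) + 1) ^ 2 = (1 / (2 * k + 1)) ^ 2 := by field_simp
  rw [h3]
  nlinarith [sq_nonneg ((2 * k + 1) * a - 1 / (2 * k + 1)), sq_nonneg ((2 * k + 1) * a),
    sq_nonneg (1 / (2 * (k : ℝ) + 1)), norm_nonneg (inner ℂ (e k) u : ℂ)]

theorem MemV.summable_smul_image (hb : MemV b) {u g : H}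
    (hg : ∀ k : ℕ, inner ℂ (hermiteBasis k) g = (2 * k + 1) * inner ℂ (hermiteBasis k) u) :
    Summable fun k => inner ℂ (hermiteBasis k) u • hb.image k := by
  refine Summable.of_norm_bounded ((summable_norm_inner_of_diag _ hg).mul_right (normV b))
    fun k => ?_
  rw [norm_smul]
  gcongr
  exact hb.norm_image_le k

/-- The intersection of domains is all of `L0.domain`: there `∑ u_k b h_k` converges absolutely, and
its sum is `b u` almost everywhere. -/
theorem MemV.isDiagPerturbation (hb : MemV b) :
    IsDiagPerturbation hermiteBasis hb.image (L b) where
  mem_domain u := by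
    rw [← mem_L0_domain_iff, L, LinearPMap.add_domain, Submodule.mem_inf]
    refine ⟨fun h => h.1, fun h => ⟨h, ?_⟩⟩
    obtain ⟨g, hg⟩ := (mem_L0_domain_iff u).1 h
    have := hb.mul_ae_eq_of_hasSum (hb.summable_smul_image hg).hasSum
    exact (Lp.memLp _).ae_eq (this.mono fun x hx => hx.symm)
  hasSum_apply u g hg := by
    have hs := (hb.summable_smul_image hg).hasSum
    have h1 : (L b) u = L0 ⟨u, u.2.1⟩ + mulOp b ⟨u, u.2.2⟩ := LinearPMap.add_apply _ _ _
    have h2 : mulOp b ⟨u, u.2.2⟩ = ∑' k, inner ℂ (hermiteBasis k) (u : H) • hb.image k := by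
      refine Lp.ext ?_
      have h3 : mulOp b ⟨u, u.2.2⟩ =ᵐ[volume] fun x => b x * (u : H) x :=
        MemLp.coeFn_toLp (p := 2) u.2.2
      filter_upwards [h3, hb.mul_ae_eq_of_hasSum hs] with x hx1 hx2
      rw [hx1, hx2]
    rw [h1, L0_apply_eq _ g hg, add_sub_cancel_left, h2]
    exact hs

end

/-! ### Operators prescribed on a Hilbert basis, and sums over the integer lattice. -/

section

section Hilbert

variable {E : Type*} [NormedAddCommGroup E] [InnerProductSpace ℂ E]

theorem hasSum_sq_norm_inner (e : HilbertBasis ℕ ℂ E) (f : E) :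
    HasSum (fun k => ‖inner ℂ (e k) f‖ ^ 2) (‖f‖ ^ 2) := by
  have h := e.hasSum_inner_mul_inner f f
  have h2 := Complex.reCLM.hasSum h
  convert! h2 using 1
  · funext k
    rw [← inner_conj_symm f (e k)]
    simp only [Complex.reCLM_apply]
    rw [← Complex.normSq_eq_conj_mul_self, Complex.ofReal_re, Complex.normSq_eq_norm_sq]
  · rw [Complex.reCLM_apply]
    exact (inner_self_eq_norm_sq (𝕜 := ℂ) f).symm

theorem hasSum_clm_apply (e : HilbertBasis ℕ ℂ E) {F : Type*} [NormedAddCommGroup F]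
    [NormedSpace ℂ F] (T : E →L[ℂ] F) (f : E) :
    HasSum (fun k => inner ℂ (e k) f • T (e k)) (T f) := by
  have := T.hasSum (e.hasSum_repr f)
  simpa only [Function.comp_def, map_smul, HilbertBasis.repr_apply_apply] using this

theorem clm_ext_basis (e : HilbertBasis ℕ ℂ E) {F : Type*} [NormedAddCommGroup F]
    [NormedSpace ℂ F] {S T : E →L[ℂ] F} (h : ∀ k, S (e k) = T (e k)) : S = T := by
  ext f
  have h1 := hasSum_clm_apply e S f
  simp_rw [h] at h1
  exact h1.unique (hasSum_clm_apply e T f)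

theorem ext_inner_basis (e : HilbertBasis ℕ ℂ E) {f g : E}
    (h : ∀ k, inner ℂ (e k) f = inner ℂ (e k) g) : f = g := by
  have h1 := e.hasSum_repr f
  have h2 := e.hasSum_repr g
  simp_rw [HilbertBasis.repr_apply_apply] at h1 h2
  simp_rw [h] at h1
  exact h1.unique h2

theorem inner_basis_basis (e : HilbertBasis ℕ ℂ E) (i j : ℕ) :
    inner ℂ (e i) (e j) = if i = j then (1 : ℂ) else 0 :=
  orthonormal_iff_ite.1 e.orthonormal i j

theorem inner_diag_apply (e : HilbertBasis ℕ ℂ E) {T : E →L[ℂ] E} {c : ℕ → ℂ}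
    (hT : ∀ k, T (e k) = c k • e k) (f : E) (k : ℕ) :
    inner ℂ (e k) (T f) = c k * inner ℂ (e k) f := by
  have h := (innerSL ℂ (e k)).hasSum (hasSum_clm_apply e T f)
  refine h.unique ?_
  convert! hasSum_ite_eq k (c k * inner ℂ (e k) f) using 1
  funext j
  rw [hT, innerSL_apply_apply, inner_smul_right, inner_smul_right, inner_basis_basis]
  by_cases hjk : j = k
  · subst hjk; simp [mul_comm]
  · simp [hjk, Ne.symm hjk]

open Classical in
/-- The bounded operator mapping `e k` to `x k`, if there is one. -/
def synth (e : HilbertBasis ℕ ℂ E) (x : ℕ → E) : E →L[ℂ] E :=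
  if h : ∃ T : E →L[ℂ] E, ∀ k, T (e k) = x k then h.choose else 0

theorem synth_basis_of_exists (e : HilbertBasis ℕ ℂ E) {x : ℕ → E}
    (h : ∃ T : E →L[ℂ] E, ∀ k, T (e k) = x k) (k : ℕ) : synth e x (e k) = x k := by
  rw [synth, dif_pos h]
  exact h.choose_spec k

variable [CompleteSpace E]

/-- A Bessel-type bound for `x` yields a bounded operator mapping `e k` to `x k`. -/
theorem exists_clm_of_bessel (e : HilbertBasis ℕ ℂ E) (x : ℕ → E) {C : ℝ} (hC : 0 ≤ C)
    (hs : ∀ f, Summable fun k => ‖inner ℂ (x k) f‖ ^ 2)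
    (hle : ∀ f, ∑' k, ‖inner ℂ (x k) f‖ ^ 2 ≤ C ^ 2 * ‖f‖ ^ 2) :
    ∃ T : E →L[ℂ] E, (∀ k, T (e k) = x k) ∧ ‖T‖ ≤ C := by
  have hmem : ∀ f, Memℓp (fun k => inner ℂ (x k) f) 2 := fun f =>
    memℓp_gen (by simpa using hs f)
  let S₀ : E →ₗ[ℂ] lp (fun _ : ℕ => ℂ) 2 :=
    { toFun := fun f => ⟨fun k => inner ℂ (x k) f, hmem f⟩
      map_add' := fun f g => Subtype.ext (funext fun k => inner_add_right _ _ _)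
      map_smul' := fun c f => Subtype.ext (funext fun k => inner_smul_right _ _ _) }
  have hS₀ : ∀ f, ‖S₀ f‖ ≤ C * ‖f‖ := by
    intro f
    have h1 : ‖S₀ f‖ ^ 2 = ∑' k, ‖inner ℂ (x k) f‖ ^ 2 := by
      have := lp.norm_rpow_eq_tsum (p := 2) (by simp) (S₀ f)
      simpa [S₀] using this
    refine abs_le_of_sq_le_sq' ?_ (by positivity) |>.2
    rw [h1, mul_pow]
    exact hle f
  let S := S₀.mkContinuous C hS₀
  let T' : E →L[ℂ] E := (e.repr.symm.toContinuousLinearEquiv : _ →L[ℂ] E) ∘L S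
  -- The synthesis operator is the adjoint of the analysis operator `f ↦ (⟪x k, f⟫)_k`, and the
  -- Bessel bound controls the latter.
  refine ⟨ContinuousLinearMap.adjoint T', fun k => ?_, ?_⟩
  · refine ext_inner_right ℂ fun f => ?_
    rw [ContinuousLinearMap.adjoint_inner_left, ← HilbertBasis.repr_apply_apply]
    simp [T', S, S₀]
  · rw [LinearIsometryEquiv.norm_map]
    refine ContinuousLinearMap.opNorm_le_bound _ hC fun f => ?_
    have : ‖T' f‖ = ‖S₀ f‖ := by simp [T', S]
    rw [this]
    exact hS₀ f

theorem exists_clm_of_summable_sq (e : HilbertBasis ℕ ℂ E) (x : ℕ → E) {C : ℝ} (hC : 0 ≤ C)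
    (hs : Summable fun k => ‖x k‖ ^ 2) (hle : ∑' k, ‖x k‖ ^ 2 ≤ C ^ 2) :
    ∃ T : E →L[ℂ] E, (∀ k, T (e k) = x k) ∧ ‖T‖ ≤ C := by
  have hb : ∀ f k, ‖(inner ℂ (x k) f : ℂ)‖ ^ 2 ≤ ‖x k‖ ^ 2 * ‖f‖ ^ 2 := by
    intro f k
    rw [← mul_pow]
    gcongr
    exact norm_inner_le_norm _ _
  have hs' : ∀ f, Summable fun k => ‖(inner ℂ (x k) f : ℂ)‖ ^ 2 := fun f =>
    Summable.of_nonneg_of_le (fun k => by positivity) (hb f) (hs.mul_right _)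
  refine exists_clm_of_bessel e x hC hs' fun f => ?_
  refine ((hs' f).tsum_le_tsum (hb f) (hs.mul_right _)).trans ?_
  rw [tsum_mul_right]
  gcongr

theorem synth_basis (e : HilbertBasis ℕ ℂ E) {x : ℕ → E}
    (hs : Summable fun k => ‖x k‖ ^ 2) (k : ℕ) : synth e x (e k) = x k := by
  obtain ⟨T, hT, -⟩ := exists_clm_of_summable_sq e x (Real.sqrt_nonneg (∑' k, ‖x k‖ ^ 2)) hs
    (Real.sq_sqrt (tsum_nonneg fun k => by positivity)).ge
  exact synth_basis_of_exists e ⟨T, hT⟩ k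

theorem norm_synth_le (e : HilbertBasis ℕ ℂ E) {x : ℕ → E} {C : ℝ} (hC : 0 ≤ C)
    (hs : Summable fun k => ‖x k‖ ^ 2) (hle : ∑' k, ‖x k‖ ^ 2 ≤ C ^ 2) : ‖synth e x‖ ≤ C := by
  obtain ⟨T, hT, hTC⟩ := exists_clm_of_summable_sq e x hC hs hle
  have : synth e x = T := clm_ext_basis e fun k => by rw [synth_basis e hs, hT]
  rwa [this]

end Hilbert

/-! ### Lattice sums -/

/-- `1/m²`, with the value `256` at `m = 0`. -/
def latticeWeight (m : ℤ) : ℝ := if m = 0 then 256 else 1 / (m : ℝ) ^ 2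

theorem latticeWeight_nonneg (m : ℤ) : 0 ≤ latticeWeight m := by
  unfold latticeWeight; split_ifs <;> positivity

theorem latticeWeight_neg (m : ℤ) : latticeWeight (-m) = latticeWeight m := by
  simp [latticeWeight]

theorem summable_latticeWeight : Summable latticeWeight := by
  have h := Real.summable_one_div_int_pow.2 one_lt_two
  refine (summable_congr_cofinite ?_).1 h
  filter_upwards [(Set.finite_singleton (0 : ℤ)).compl_mem_cofinite] with m hm
  rw [latticeWeight, if_neg (by simpa using hm)]

theorem summable_and_tsum_le_of_le_shift {F : ℕ → ℝ} {G : ℤ → ℝ} (k : ℤ) (hF : ∀ j, 0 ≤ F j)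
    (hG : ∀ m, 0 ≤ G m) (hGs : Summable G) (h : ∀ j : ℕ, F j ≤ G (j - k)) :
    Summable F ∧ ∑' j, F j ≤ ∑' m, G m := by
  have hinj : Function.Injective fun j : ℕ => (j : ℤ) - k := by
    intro i j hij
    simpa using hij
  have h1 : Summable fun j : ℕ => G (j - k) := hGs.comp_injective hinj
  have hs := Summable.of_nonneg_of_le hF h h1
  refine ⟨hs, (hs.tsum_le_tsum h h1).trans ?_⟩
  exact tsum_comp_le_tsum_of_inj hGs hG hinj

/-- Extension by zero of a sequence to the integers. -/
def extendInt (a : ℕ → ℝ) (m : ℤ) : ℝ := if 0 ≤ m then a m.toNat else 0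

theorem extendInt_natCast (a : ℕ → ℝ) (j : ℕ) : extendInt a j = a j := by simp [extendInt]

theorem extendInt_nonneg {a : ℕ → ℝ} (ha : ∀ j, 0 ≤ a j) (m : ℤ) : 0 ≤ extendInt a m := by
  unfold extendInt; split_ifs; exacts [ha _, le_rfl]

theorem extendInt_le {a : ℕ → ℝ} {B : ℝ} (hB : 0 ≤ B) (ha : ∀ j, a j ≤ B) (m : ℤ) :
    extendInt a m ≤ B := by
  unfold extendInt; split_ifs; exacts [ha _, hB]

theorem tendsto_extendInt {a : ℕ → ℝ} (ha : Tendsto a atTop (𝓝 0)) :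
    Tendsto (extendInt a) cofinite (𝓝 0) := by
  rw [Int.cofinite_eq, tendsto_sup]
  constructor
  · refine tendsto_const_nhds.congr' ?_
    filter_upwards [Iio_mem_atBot (0 : ℤ)] with m hm
    rw [extendInt, if_neg (not_le.2 hm)]
  · have h : Tendsto (fun m : ℤ => m.toNat) atTop atTop := by
      refine tendsto_atTop.2 fun n => ?_
      filter_upwards [eventually_ge_atTop (n : ℤ)] with m hm
      omega
    refine (ha.comp h).congr' ?_
    filter_upwards [eventually_ge_atTop (0 : ℤ)] with m hm
    simp [extendInt, hm]

/-- `∑_m a_{k+m} c_m` for the lattice weight `c`. -/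
def latticeConv (a : ℕ → ℝ) (k : ℤ) : ℝ := ∑' m, extendInt a (k + m) * latticeWeight m

theorem summable_latticeConv {a : ℕ → ℝ} {B : ℝ} (hB : 0 ≤ B) (ha0 : ∀ j, 0 ≤ a j)
    (ha : ∀ j, a j ≤ B) (k : ℤ) : Summable fun m => extendInt a (k + m) * latticeWeight m :=
  Summable.of_nonneg_of_le (fun m => mul_nonneg (extendInt_nonneg ha0 _) (latticeWeight_nonneg m))
    (fun m => mul_le_mul_of_nonneg_right (extendInt_le hB ha _) (latticeWeight_nonneg m))
    (summable_latticeWeight.mul_left B)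

/-- A null sequence convolved with a summable one is null, by dominated convergence. The cofinite
filter on `ℤ` contains both ends; the negative end serves the left half plane. -/
theorem tendsto_latticeConv {a : ℕ → ℝ} {B : ℝ} (hB : 0 ≤ B) (ha0 : ∀ j, 0 ≤ a j)
    (ha : ∀ j, a j ≤ B) (hlim : Tendsto a atTop (𝓝 0)) :
    Tendsto (latticeConv a) cofinite (𝓝 0) := by
  have h := tendsto_tsum_of_dominated_convergence (𝓕 := (cofinite : Filter ℤ))
    (f := fun k m => extendInt a (k + m) * latticeWeight m) (g := fun _ => (0 : ℝ))
    (summable_latticeWeight.mul_left B) ?_ ?_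
  · rw [tsum_zero] at h
    exact h
  · intro m
    have : Tendsto (fun k : ℤ => k + m) cofinite cofinite :=
      (add_left_injective m).tendsto_cofinite
    simpa using ((tendsto_extendInt hlim).comp this).mul_const (latticeWeight m)
  · refine Eventually.of_forall fun k m => ?_
    rw [Real.norm_of_nonneg (mul_nonneg (extendInt_nonneg ha0 _) (latticeWeight_nonneg m))]
    exact mul_le_mul_of_nonneg_right (extendInt_le hB ha _) (latticeWeight_nonneg m)

/-- The bound telescopes, since `(m + y)(m + 1 + y) ≤ (m + 1 + y)² ≤ 2((m + 1)² + y²)`. -/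
theorem sum_range_one_div_add_sq_le {y : ℝ} (hy : 0 < y) (n : ℕ) :
    ∑ m ∈ Finset.range n, 1 / (((m : ℝ) + 1) ^ 2 + y ^ 2) ≤ 2 / y - 2 / (n + y) := by
  induction n with
  | zero => simp
  | succ n ih =>
    rw [Finset.sum_range_succ]
    have h0 : (0 : ℝ) ≤ n := Nat.cast_nonneg n
    have h : 1 / (((n : ℝ) + 1) ^ 2 + y ^ 2) ≤ 2 / (n + y) - 2 / ((n + 1 : ℕ) + y) := by
      push_cast
      rw [div_sub_div _ _ (by positivity) (by positivity), div_le_div_iff₀ (by positivity)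
        (by positivity)]
      nlinarith [sq_nonneg ((n : ℝ) + 1 - y)]
    linarith

theorem summable_and_tsum_one_div_add_sq_le {y : ℝ} (hy : 0 < y) :
    (Summable fun m : ℤ => 1 / ((m : ℝ) ^ 2 + y ^ 2)) ∧
      ∑' m : ℤ, 1 / ((m : ℝ) ^ 2 + y ^ 2) ≤ 1 / y ^ 2 + 4 / y := by
  have hbd : ∀ n, ∑ m ∈ Finset.range n, 1 / (((m : ℝ) + 1) ^ 2 + y ^ 2) ≤ 2 / y := by
    intro n
    refine (sum_range_one_div_add_sq_le hy n).trans ?_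
    have : 0 ≤ 2 / ((n : ℝ) + y) := by positivity
    linarith
  have hs : Summable fun m : ℕ => 1 / (((m : ℝ) + 1) ^ 2 + y ^ 2) :=
    summable_of_sum_range_le (fun m => by positivity) hbd
  have hle : ∑' m : ℕ, 1 / (((m : ℝ) + 1) ^ 2 + y ^ 2) ≤ 2 / y :=
    Real.tsum_le_of_sum_range_le (fun m => by positivity) hbd
  have hs1 : Summable fun m : ℕ => 1 / ((m : ℝ) ^ 2 + y ^ 2) := by
    rw [← summable_nat_add_iff 1]
    simpa using hs
  have h1 := hs1.hasSum
  rw [hs1.tsum_eq_zero_add] at h1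
  have h := HasSum.of_nat_of_neg_add_one (f := fun m : ℤ => 1 / ((m : ℝ) ^ 2 + y ^ 2))
    (by simpa using h1) (by
      have := hs.hasSum
      refine this.congr_fun fun m => ?_
      push_cast
      congr 2
      ring)
  refine ⟨h.summable, ?_⟩
  rw [h.tsum_eq]
  have : 4 / y = 2 / y + 2 / y := by ring
  simp only [one_div] at hle ⊢
  linarith

end

/-! ### Neumann series and localization of the spectrum. -/

section

theorem ev0_eq_ofReal (k : ℕ) : ev0 k = ((2 * k + 1 : ℝ) : ℂ) := by
  simp [ev0]

/-- With `k = ⌊x/2⌋`, the point `x` lies in `[2k, 2k+2)`, whose midpoint is `2k+1`. For `j ≠ k` its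
distance to `2j+1` is therefore at least `2|j - k| - 1 ≥ |j - k|`. -/
theorem sq_sub_floor_le (x : ℝ) (j : ℕ) :
    (((j : ℤ) - ⌊x / 2⌋ : ℤ) : ℝ) ^ 2 ≤ (x - (2 * j + 1)) ^ 2 := by
  have h1 := Int.floor_le (x / 2)
  have h2 := Int.lt_floor_add_one (x / 2)
  set k := ⌊x / 2⌋
  push_cast
  rcases lt_trichotomy (j : ℤ) k with h | h | h
  · have h3 : (j : ℝ) + 1 ≤ k := by exact_mod_cast h
    nlinarith
  · have h3 : (j : ℝ) = k := by exact_mod_cast h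
    rw [h3]; nlinarith [sq_nonneg (x - (2 * (k : ℝ) + 1))]
  · have h3 : (k : ℝ) + 1 ≤ j := by exact_mod_cast h
    nlinarith

theorem sq_norm_sub_ev0 (z : ℂ) (j : ℕ) :
    ‖z - ev0 j‖ ^ 2 = (z.re - (2 * j + 1)) ^ 2 + z.im ^ 2 := by
  rw [← Complex.normSq_eq_norm_sq, Complex.normSq_apply, ev0_eq_ofReal]
  simp only [Complex.sub_re, Complex.sub_im, Complex.ofReal_re, Complex.ofReal_im]
  ring

/-- Only the centre with index `⌊Re z / 2⌋` can be closer to `z` than `1`, so only that one needs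
the disk excluded. The weight `256 = 16²` at `0` is the price of the radius `1/16`. -/
theorem sq_norm_inv_sub_ev0_le (z : ℂ) (j : ℕ)
    (h : (j : ℤ) = ⌊z.re / 2⌋ → 1 / 16 ≤ ‖z - ev0 j‖) :
    ‖(z - ev0 j)⁻¹‖ ^ 2 ≤ latticeWeight (j - ⌊z.re / 2⌋) := by
  rw [norm_inv, inv_pow, latticeWeight]
  split_ifs with h0
  · have h1 := h (by omega)
    have h2 : (1 / 16 : ℝ) ^ 2 ≤ ‖z - ev0 j‖ ^ 2 := by gcongr
    calc (‖z - ev0 j‖ ^ 2)⁻¹ ≤ ((1 / 16 : ℝ) ^ 2)⁻¹ := by gcongr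
      _ = 256 := by norm_num
  · have h1 : 0 < (((j : ℤ) - ⌊z.re / 2⌋ : ℤ) : ℝ) ^ 2 := by
      have : (((j : ℤ) - ⌊z.re / 2⌋ : ℤ) : ℝ) ≠ 0 := by exact_mod_cast h0
      positivity
    rw [one_div]
    refine inv_anti₀ h1 ?_
    rw [sq_norm_sub_ev0]
    nlinarith [sq_sub_floor_le z.re j, sq_nonneg z.im]

theorem summable_sq_norm_inv_sub_ev0 (z : ℂ) :
    Summable fun k => ‖(z - ev0 k)⁻¹‖ ^ 2 := by
  have h : Summable fun j : ℕ => latticeWeight (j - ⌊z.re / 2⌋) :=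
    summable_latticeWeight.comp_injective (i := fun j : ℕ => (j : ℤ) - ⌊z.re / 2⌋)
      (fun i j hij => by simpa using hij)
  have h2 : Summable fun j : ℕ => if (j : ℤ) = ⌊z.re / 2⌋ then ‖(z - ev0 j)⁻¹‖ ^ 2 else 0 := by
    refine summable_of_hasFiniteSupport ?_
    refine ((Set.finite_singleton ⌊z.re / 2⌋).preimage
      (f := fun j : ℕ => (j : ℤ)) (Nat.cast_injective.injOn)).subset ?_
    intro j hj
    by_contra hne
    exact hj (if_neg hne)
  refine Summable.of_nonneg_of_le (fun j => by positivity) (fun j => ?_) (h.add h2)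
  split_ifs with hj
  · linarith [latticeWeight_nonneg (j - ⌊z.re / 2⌋)]
  · linarith [sq_norm_inv_sub_ev0_le z j (fun h => absurd h hj)]

section

variable {e : HilbertBasis ℕ ℂ H} {w : ℕ → H} {A : H →ₗ.[ℂ] H}

/-- If `∑ ‖w_k‖²/|z - λ_k|² < 1` then `z` is in the resolvent set, by a Neumann series. -/
theorem IsDiagPerturbation.exists_resolvent (hA : IsDiagPerturbation e w A) {z : ℂ}
    (hz : ∀ k, z ≠ ev0 k) {C : ℝ} (hC0 : 0 ≤ C) (hC : C < 1)
    (hs : Summable fun k => ‖(z - ev0 k)⁻¹ • w k‖ ^ 2)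
    (hle : ∑' k, ‖(z - ev0 k)⁻¹ • w k‖ ^ 2 ≤ C ^ 2) : ∃ R, IsResolventAt A z R := by
  have hsub : ∀ k, z - ev0 k ≠ 0 := fun k => sub_ne_zero.2 (hz k)
  set R₀ := synth e fun k => (z - ev0 k)⁻¹ • e k
  set K := synth e fun k => (z - ev0 k)⁻¹ • w k
  have hR₀ : ∀ k, R₀ (e k) = (z - ev0 k)⁻¹ • e k := by
    refine synth_basis e ?_
    simpa [norm_smul, e.orthonormal.1] using summable_sq_norm_inv_sub_ev0 z
  have hK : ∀ k, K (e k) = (z - ev0 k)⁻¹ • w k := synth_basis e hs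
  have hKn : ‖K‖ < 1 := (norm_synth_le e hC0 hs hle).trans_lt hC
  -- Since `(z - A) R₀ = 1 - K`, the resolvent is `R₀ (1 - K)⁻¹`.
  let U := Units.oneSub K hKn
  have hU : (U : H →L[ℂ] H) = 1 - K := rfl
  have hU1 : ∀ f, (↑U⁻¹ : H →L[ℂ] H) f - K ((↑U⁻¹ : H →L[ℂ] H) f) = f := by
    intro f
    have := congrArg (fun T : H →L[ℂ] H => T f) U.mul_inv
    simpa [hU] using this
  have hU2 : ∀ f, (↑U⁻¹ : H →L[ℂ] H) (f - K f) = f := by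
    intro f
    have := congrArg (fun T : H →L[ℂ] H => T f) U.inv_mul
    simpa [hU] using this
  have hin : ∀ g k, inner ℂ (e k) (R₀ g) = (z - ev0 k)⁻¹ * inner ℂ (e k) g :=
    fun g k => inner_diag_apply e hR₀ g k
  have hKg : ∀ g : H, HasSum (fun k => inner ℂ (e k) (R₀ g) • w k) (K g) := by
    intro g
    have := hasSum_clm_apply e K g
    refine this.congr_fun fun k => ?_
    rw [hin, hK, smul_smul, mul_comm]
  refine ⟨R₀ * (↑U⁻¹ : H →L[ℂ] H), fun f => ?_, fun u => ?_⟩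
  · set g := (↑U⁻¹ : H →L[ℂ] H) f
    have hd : ∀ k : ℕ, inner ℂ (e k) (z • R₀ g - g) = (2 * k + 1) * inner ℂ (e k) (R₀ g) := by
      intro k
      rw [inner_sub_right, inner_smul_right, hin]
      have := hsub k
      simp only [ev0] at this ⊢
      field_simp
      ring
    have hmem : R₀ g ∈ A.domain := (hA.mem_domain _).2 ⟨_, hd⟩
    refine ⟨hmem, ?_⟩
    have h1 := (hA.hasSum_apply ⟨R₀ g, hmem⟩ _ hd).unique (hKg g)
    have h2 := hU1 f
    change z • R₀ g - A ⟨R₀ g, hmem⟩ = f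
    rw [sub_eq_iff_eq_add.1 h1]
    rw [← h2]
    abel
  · obtain ⟨h, hh⟩ := (hA.mem_domain _).1 u.2
    have hu : R₀ (z • (u : H) - h) = u := by
      refine ext_inner_basis e fun k => ?_
      rw [hin, inner_sub_right, inner_smul_right, hh]
      have := hsub k
      simp only [ev0] at this ⊢
      field_simp
    have h1 := hKg (z • (u : H) - h)
    rw [hu] at h1
    have h2 := (hA.hasSum_apply u h hh).unique h1
    have h3 : z • (u : H) - A u = (z • (u : H) - h) - K (z • (u : H) - h) := by
      rw [← h2]; abel
    change R₀ ((↑U⁻¹ : H →L[ℂ] H) (z • (u : H) - A u)) = u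
    rw [h3, hU2, hu]

theorem summable_and_tsum_le_latticeConv {B : ℝ} (hw : ∀ k, ‖w k‖ ≤ B) (k : ℤ)
    {c : ℕ → ℂ} (hc : ∀ j : ℕ, ‖c j‖ ^ 2 ≤ latticeWeight (j - k)) :
    (Summable fun j => ‖c j • w j‖ ^ 2) ∧
      ∑' j, ‖c j • w j‖ ^ 2 ≤ latticeConv (fun j => ‖w j‖ ^ 2) k := by
  refine summable_and_tsum_le_of_le_shift
    (G := fun m => extendInt (fun j => ‖w j‖ ^ 2) (k + m) * latticeWeight m)
    k (fun j => by positivity)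
    (fun m => mul_nonneg (extendInt_nonneg (fun j => by positivity) _) (latticeWeight_nonneg m))
    (summable_latticeConv (B := B ^ 2) (by positivity) (fun j => by positivity)
      (fun j => by gcongr; exact hw j) k) fun j => ?_
  have : k + ((j : ℤ) - k) = j := by ring
  rw [this, extendInt_natCast, norm_smul, mul_pow, mul_comm]
  gcongr
  exact hc j

theorem IsDiagPerturbation.exists_resolvent_of_im (hA : IsDiagPerturbation e w A) {B : ℝ}
    (hB : 0 ≤ B) (hw : ∀ k, ‖w k‖ ≤ B) {z : ℂ} (hz0 : z.im ≠ 0)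
    (hz : 8 * (B + 2 * Real.pi * B ^ 2) ≤ |z.im|) : ∃ R, IsResolventAt A z R := by
  have hy : 0 < |z.im| := abs_pos.2 hz0
  set y := |z.im| with hydef
  have hne : ∀ k, z ≠ ev0 k := by
    intro k hk
    rw [hk, ev0_eq_ofReal, Complex.ofReal_im] at hz0
    exact hz0 rfl
  obtain ⟨hs, hle⟩ := summable_and_tsum_one_div_add_sq_le hy
  have hF := summable_and_tsum_le_of_le_shift (F := fun k => ‖(z - ev0 k)⁻¹ • w k‖ ^ 2)
    (G := fun m => B ^ 2 * (1 / ((m : ℝ) ^ 2 + y ^ 2))) ⌊z.re / 2⌋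
    (fun j => by positivity) (fun m => by positivity) (hs.mul_left _) (fun j => by
      rw [norm_smul, mul_pow, norm_inv, inv_pow, mul_comm, one_div, sq_norm_sub_ev0]
      refine mul_le_mul (pow_le_pow_left₀ (norm_nonneg _) (hw j) 2)
        (inv_anti₀ (by positivity) (add_le_add (sq_sub_floor_le z.re j) ?_))
        (by positivity) (by positivity)
      rw [hydef, sq_abs])
  refine hA.exists_resolvent hne (C := 1 / 2) (by norm_num) (by norm_num) hF.1
    (hF.2.trans ?_)
  rw [tsum_mul_left]
  -- Here `y ≥ 8B` and `y ≥ 16πB² ≥ 48B²`, so the sum is at most `1/64 + 1/12 < 1/4`, uniformly in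
  -- `Re z`.
  have hpi := Real.pi_gt_three
  have h1 : 8 * B ≤ y := by nlinarith [sq_nonneg B]
  have h2 : 48 * B ^ 2 ≤ y := by nlinarith [sq_nonneg B]
  calc _ ≤ B ^ 2 * (1 / y ^ 2 + 4 / y) := by gcongr
    _ = B ^ 2 / y ^ 2 + 4 * B ^ 2 / y := by ring
    _ ≤ 1 / 64 + 4 / 48 := by
      refine add_le_add ?_ ?_
      · rw [div_le_iff₀ (by positivity)]
        nlinarith
      · rw [div_le_iff₀ hy]
        nlinarith
    _ ≤ (1 / 2) ^ 2 := by norm_num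

theorem tendsto_latticeConv_sq_norm {B : ℝ} (hw : ∀ k, ‖w k‖ ≤ B)
    (hlim : Tendsto (fun k => ‖w k‖) atTop (𝓝 0)) :
    Tendsto (latticeConv fun j => ‖w j‖ ^ 2) cofinite (𝓝 0) :=
  tendsto_latticeConv (B := B ^ 2) (by positivity) (fun j => by positivity)
    (fun j => by gcongr; exact hw j) (by simpa using hlim.pow 2)

/-- Away from the disks `D(λ_k, 1/16)`, `k ≥ n`, the half planes `|Re z| ≥ 2n` lie in the resolvent
set once `n` is large. -/
theorem IsDiagPerturbation.exists_resolvent_of_re (hA : IsDiagPerturbation e w A) {B : ℝ}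
    (hw : ∀ k, ‖w k‖ ≤ B) (hlim : Tendsto (fun k => ‖w k‖) atTop (𝓝 0)) :
    ∃ n₀ : ℕ, ∀ n ≥ n₀, ∀ z : ℂ, 2 * (n : ℝ) ≤ |z.re| →
      (∀ k ≥ n, 1 / 16 ≤ ‖z - ev0 k‖) → ∃ R, IsResolventAt A z R := by
  have ht := tendsto_latticeConv_sq_norm hw hlim
  have hev := ht.eventually_lt_const (show (0 : ℝ) < (1 / 2) ^ 2 by norm_num)
  rw [Int.cofinite_eq, eventually_sup, eventually_atBot, eventually_atTop] at hev
  obtain ⟨⟨a, ha⟩, ⟨c, hc⟩⟩ := hev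
  refine ⟨max (-a).toNat (max c.toNat 1), fun n hn z hz hd => ?_⟩
  have hna : -a ≤ n := by omega
  have hnc : c ≤ n := by omega
  have hn1 : 1 ≤ n := by omega
  -- To the left the index `⌊Re z / 2⌋` is negative, so it belongs to no `ev0 j`. To the right it is
  -- at least `n`, so only the disks with index `≥ n` have to be avoided.
  have hk : latticeConv (fun j => ‖w j‖ ^ 2) ⌊z.re / 2⌋ < (1 / 2) ^ 2 ∧
      ∀ j : ℕ, (j : ℤ) = ⌊z.re / 2⌋ → n ≤ j := by
    rcases le_abs'.1 hz with h | h
    · have h1 : ⌊z.re / 2⌋ ≤ -(n : ℤ) := by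
        have : z.re / 2 ≤ ((-(n : ℤ) : ℤ) : ℝ) := by push_cast; linarith
        have := Int.floor_mono this
        rwa [Int.floor_intCast] at this
      exact ⟨ha _ (by omega), fun j hj => by omega⟩
    · have h1 : (n : ℤ) ≤ ⌊z.re / 2⌋ := by
        rw [Int.le_floor]; push_cast; linarith
      exact ⟨hc _ (by omega), fun j hj => by omega⟩
  have hweight : ∀ j : ℕ, ‖(z - ev0 j)⁻¹‖ ^ 2 ≤ latticeWeight (j - ⌊z.re / 2⌋) :=
    fun j => sq_norm_inv_sub_ev0_le z j fun hj => hd j (hk.2 j hj)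
  have hne : ∀ k, z ≠ ev0 k := by
    intro k hzk
    by_cases hkn : n ≤ k
    · have := hd k hkn
      rw [hzk, sub_self, norm_zero] at this
      norm_num at this
    · rw [hzk, ev0_eq_ofReal, Complex.ofReal_re, abs_of_pos (by positivity)] at hz
      have : (k : ℝ) + 1 ≤ n := by exact_mod_cast Nat.lt_of_not_le hkn
      linarith
  obtain ⟨h1, h2⟩ := summable_and_tsum_le_latticeConv hw ⌊z.re / 2⌋ hweight
  exact hA.exists_resolvent hne (C := 1 / 2) (by norm_num) (by norm_num) h1
    (h2.trans hk.1.le)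

end

end

/-! ### Eigenvectors close to the Hermite functions. -/

section

/-- The coefficients `(μ - λ_j)⁻¹`, with index `k` omitted. -/
def reducedCoeff (k : ℕ) (μ : ℂ) (j : ℕ) : ℂ := if j = k then 0 else (μ - ev0 j)⁻¹

theorem one_le_sq_dist {k j : ℕ} (hjk : j ≠ k) : (1 : ℝ) ≤ ((j : ℝ) - k) ^ 2 := by
  have h : (1 : ℤ) ≤ ((j : ℤ) - k) ^ 2 := by
    have : (j : ℤ) - k ≠ 0 := sub_ne_zero.2 (by exact_mod_cast hjk)
    have := sq_pos_of_ne_zero this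
    omega
  exact_mod_cast h

theorem sq_dist_le_sq_norm {k j : ℕ} {μ : ℂ} (hμ : ‖μ - ev0 k‖ ≤ 1 / 16) :
    ((j : ℝ) - k) ^ 2 ≤ ‖μ - ev0 j‖ ^ 2 := by
  by_cases hjk : j = k
  · subst hjk; simp
  have h1 : 1 ≤ |(j : ℝ) - k| := by
    rw [← one_le_sq_iff_one_le_abs]; exact one_le_sq_dist hjk
  have h2 : ‖ev0 k - ev0 j‖ = 2 * |(j : ℝ) - k| := by
    rw [ev0_eq_ofReal, ev0_eq_ofReal, ← Complex.ofReal_sub, Complex.norm_real, Real.norm_eq_abs,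
      ← abs_neg]
    rw [show -((2 * (k : ℝ) + 1) - (2 * j + 1)) = 2 * ((j : ℝ) - k) by ring, abs_mul]
    simp
  have h3 : ‖ev0 k - ev0 j‖ ≤ ‖μ - ev0 j‖ + ‖μ - ev0 k‖ := by
    have := norm_sub_le (μ - ev0 j) (μ - ev0 k)
    rwa [show μ - ev0 j - (μ - ev0 k) = ev0 k - ev0 j by ring] at this
  rw [← sq_abs]
  gcongr
  linarith

theorem sq_norm_reducedCoeff_le {k : ℕ} {μ : ℂ} (hμ : ‖μ - ev0 k‖ ≤ 1 / 16) (j : ℕ) :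
    ‖reducedCoeff k μ j‖ ^ 2 ≤ latticeWeight (j - k) := by
  rw [reducedCoeff]
  split_ifs with hjk
  · simpa using latticeWeight_nonneg _
  · have h0 : (j : ℤ) - k ≠ 0 := sub_ne_zero.2 (by exact_mod_cast hjk)
    have h1 := one_le_sq_dist hjk
    rw [latticeWeight, if_neg h0, norm_inv, inv_pow, one_div]
    push_cast
    exact inv_anti₀ (by linarith) (sq_dist_le_sq_norm hμ)

theorem norm_reducedCoeff_le_one {k : ℕ} {μ : ℂ} (hμ : ‖μ - ev0 k‖ ≤ 1 / 16) (j : ℕ) :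
    ‖reducedCoeff k μ j‖ ^ 2 ≤ 1 := by
  rw [reducedCoeff]
  split_ifs with hjk
  · simp
  · rw [norm_inv, inv_pow]
    exact inv_le_one_of_one_le₀ ((one_le_sq_dist hjk).trans (sq_dist_le_sq_norm hμ))

theorem reducedCoeff_sub {k : ℕ} {μ ν : ℂ} (hμ : ‖μ - ev0 k‖ ≤ 1 / 16)
    (hν : ‖ν - ev0 k‖ ≤ 1 / 16) (j : ℕ) :
    reducedCoeff k μ j - reducedCoeff k ν j
      = (ν - μ) * (reducedCoeff k μ j * reducedCoeff k ν j) := by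
  rw [reducedCoeff, reducedCoeff]
  split_ifs with hjk
  · simp
  · have h : ∀ z : ℂ, ‖z - ev0 k‖ ≤ 1 / 16 → z - ev0 j ≠ 0 := by
      intro z hz h0
      have := (one_le_sq_dist hjk).trans (sq_dist_le_sq_norm hz)
      rw [h0] at this
      norm_num at this
    have h1 := h μ hμ
    have h2 := h ν hν
    field_simp
    ring

section

variable {e : HilbertBasis ℕ ℂ H} {w : ℕ → H} {A : H →ₗ.[ℂ] H}

theorem norm_synth_smul_le {B : ℝ} (hw : ∀ k, ‖w k‖ ≤ B) (k : ℤ) {c : ℕ → ℂ}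
    (hc : ∀ j : ℕ, ‖c j‖ ^ 2 ≤ latticeWeight (j - k)) {δ : ℝ} (hδ : 0 ≤ δ)
    (hle : latticeConv (fun j => ‖w j‖ ^ 2) k ≤ δ ^ 2) :
    (∀ j, synth e (fun j => c j • w j) (e j) = c j • w j) ∧
      ‖synth e fun j => c j • w j‖ ≤ δ := by
  obtain ⟨h1, h2⟩ := summable_and_tsum_le_latticeConv hw k hc
  exact ⟨synth_basis e h1, norm_synth_le e hδ h1 (h2.trans hle)⟩

/-- The nonlinear equation for `B u`, where `u` is the eigenvector near `e k`. -/
theorem exists_eigen_fixedPoint (e : HilbertBasis ℕ ℂ H) {B : ℝ} (hw : ∀ k, ‖w k‖ ≤ B) {k : ℕ}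
    (hconv : latticeConv (fun j => ‖w j‖ ^ 2) k ≤ (1 / 4) ^ 2) (hwk : ‖w k‖ ≤ 1 / 64) :
    ∃ g : H, ‖g‖ ≤ 2 * ‖w k‖ ∧
      g = w k + synth e (fun j => reducedCoeff k (ev0 k + inner ℂ (e k) g) j • w j) g := by
  -- Put `u = e k + x` with `x ⟂ e k` and `g = B u`. The `e k` coordinate of `A u = μ u` says `μ =
  -- ev0 k + ⟪e k, g⟫`; the others say that `x` is the reduced resolvent at `μ` applied to `g`.
  -- Applying `B` to `u` closes the equation for `g`. As `‖w k‖ ≤ 1/64`, the ball has radius at most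
  -- `1/32`, and `μ` stays within `1/16` of `ev0 k`.
  set r := 2 * ‖w k‖ with hr
  have hr0 : 0 ≤ r := by positivity
  let m : H → ℂ := fun g => ev0 k + inner ℂ (e k) g
  let T : ℂ → H →L[ℂ] H := fun μ => synth e fun j => reducedCoeff k μ j • w j
  let Φ : H → H := fun g => w k + T (m g) g
  have hm : ∀ g ∈ Metric.closedBall (0 : H) r, ‖m g - ev0 k‖ ≤ 1 / 16 := by
    intro g hg
    rw [mem_closedBall_zero_iff] at hg
    have h1 := norm_inner_le_norm (𝕜 := ℂ) (e k) g
    rw [e.orthonormal.1, one_mul] at h1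
    simp only [m, add_sub_cancel_left]
    linarith
  have hT : ∀ μ : ℂ, ‖μ - ev0 k‖ ≤ 1 / 16 →
      (∀ j, T μ (e j) = reducedCoeff k μ j • w j) ∧ ‖T μ‖ ≤ 1 / 4 := fun μ hμ =>
    norm_synth_smul_le hw k (sq_norm_reducedCoeff_le hμ) (by norm_num) hconv
  have hTT : ∀ μ ν : ℂ, ‖μ - ev0 k‖ ≤ 1 / 16 → ‖ν - ev0 k‖ ≤ 1 / 16 →
      ‖T μ - T ν‖ ≤ ‖μ - ν‖ * (1 / 4) := by
    intro μ ν hμ hν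
    obtain ⟨h1, h2⟩ := norm_synth_smul_le (e := e) hw k
      (c := fun j => reducedCoeff k μ j * reducedCoeff k ν j) (fun j => by
        rw [norm_mul, mul_pow]
        calc _ ≤ latticeWeight (j - k) * 1 :=
              mul_le_mul (sq_norm_reducedCoeff_le hμ j) (norm_reducedCoeff_le_one hν j)
                (by positivity) (latticeWeight_nonneg _)
          _ = _ := mul_one _) (by norm_num) hconv
    have h3 : T μ - T ν = (ν - μ) •
        synth e (fun j => (reducedCoeff k μ j * reducedCoeff k ν j) • w j) := by
      refine clm_ext_basis e fun j => ?_
      rw [_root_.sub_apply, (hT μ hμ).1, (hT ν hν).1, ← sub_smul, reducedCoeff_sub hμ hν,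
        _root_.smul_apply, h1, smul_smul]
    rw [h3, norm_smul, norm_sub_rev]
    gcongr
  have hmaps : Set.MapsTo Φ (Metric.closedBall 0 r) (Metric.closedBall 0 r) := by
    intro g hg
    have h1 := (hT _ (hm g hg)).2
    rw [mem_closedBall_zero_iff] at hg ⊢
    calc ‖Φ g‖ ≤ ‖w k‖ + ‖T (m g) g‖ := norm_add_le _ _
      _ ≤ ‖w k‖ + 1 / 4 * r := by
        gcongr
        exact ((T (m g)).le_opNorm g).trans (by gcongr)
      _ ≤ r := by linarith
  -- One `1/4` is the norm of `T (m g)`; the other is the Lipschitz constant of `T` in `μ`, using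
  -- that the ball lies in the unit ball.
  have hlip : ContractingWith (1 / 2) (hmaps.restrict Φ _ _) := by
    refine ⟨by norm_num, LipschitzWith.of_dist_le_mul ?_⟩
    rintro ⟨g, hg⟩ ⟨h, hh⟩
    rw [Subtype.dist_eq, Subtype.dist_eq]
    simp only [Set.MapsTo.val_restrict_apply, dist_eq_norm, Φ]
    have h1 : w k + T (m g) g - (w k + T (m h) h)
        = T (m g) (g - h) + (T (m g) - T (m h)) h := by
      rw [map_sub, _root_.sub_apply]; abel
    have h2 : ‖m g - m h‖ ≤ ‖g - h‖ := by
      simp only [m, add_sub_add_left_eq_sub, ← inner_sub_right]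
      have := norm_inner_le_norm (𝕜 := ℂ) (e k) (g - h)
      rwa [e.orthonormal.1, one_mul] at this
    rw [h1]
    have h3 := (T (m g)).le_opNorm (g - h)
    have h4 := (T (m g) - T (m h)).le_opNorm h
    have h5 := (hT _ (hm g hg)).2
    have h6 := hTT _ _ (hm g hg) (hm h hh)
    rw [mem_closedBall_zero_iff] at hh
    calc _ ≤ ‖T (m g) (g - h)‖ + ‖(T (m g) - T (m h)) h‖ := norm_add_le _ _
      _ ≤ 1 / 4 * ‖g - h‖ + (‖g - h‖ * (1 / 4)) * 1 := by
        refine add_le_add (h3.trans (by gcongr)) (h4.trans ?_)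
        refine mul_le_mul (h6.trans (by gcongr)) ?_ (norm_nonneg _) (by positivity)
        linarith
      _ = _ := by push_cast; ring
  obtain ⟨g, hg, hfix, -⟩ := hlip.exists_fixedPoint' Metric.isClosed_closedBall.isComplete hmaps
    (x := 0) (Metric.mem_closedBall_self hr0) (edist_ne_top _ _)
  exact ⟨g, by simpa using hg, hfix.symm⟩

theorem IsDiagPerturbation.exists_eigenvector (hA : IsDiagPerturbation e w A) {B : ℝ}
    (hw : ∀ k, ‖w k‖ ≤ B) {k : ℕ}
    (hconv : latticeConv (fun j => ‖w j‖ ^ 2) k ≤ (1 / 4) ^ 2) (hwk : ‖w k‖ < 1 / 64) :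
    ∃ (μ : ℂ) (g x : H), ‖μ - ev0 k‖ < 1 / 16 ∧ ‖g‖ ≤ 2 * ‖w k‖ ∧
      (∀ j, inner ℂ (e j) x = reducedCoeff k μ j * inner ℂ (e j) g) ∧
      ∃ h : e k + x ∈ A.domain, A ⟨e k + x, h⟩ = μ • (e k + x) := by
  obtain ⟨g, hg, hfix⟩ := exists_eigen_fixedPoint e hw hconv hwk.le
  set μ := ev0 k + inner ℂ (e k) g with hμdef
  have hμ : ‖μ - ev0 k‖ < 1 / 16 := by
    have h1 := norm_inner_le_norm (𝕜 := ℂ) (e k) g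
    rw [e.orthonormal.1, one_mul] at h1
    rw [hμdef, add_sub_cancel_left]
    linarith
  have hT := (norm_synth_smul_le (e := e) hw k (sq_norm_reducedCoeff_le hμ.le)
    (by norm_num) hconv).1
  set T := synth e fun j => reducedCoeff k μ j • w j
  have hsumm : Summable fun j : ℕ => ‖reducedCoeff k μ j • e j‖ ^ 2 := by
    simp_rw [norm_smul, e.orthonormal.1, mul_one]
    exact (summable_and_tsum_le_of_le_shift k (fun j => by positivity) latticeWeight_nonneg
      summable_latticeWeight (sq_norm_reducedCoeff_le hμ.le)).1
  have hQ := synth_basis e hsumm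
  set x := synth e (fun j => reducedCoeff k μ j • e j) g
  have hx : ∀ j, inner ℂ (e j) x = reducedCoeff k μ j * inner ℂ (e j) g :=
    fun j => inner_diag_apply e hQ g j
  -- The diagonal part of `A` must send `u = e k + x` to `μ u - g`, so that adding `B u = g` gives
  -- `μ u`.
  have hd : ∀ j : ℕ, inner ℂ (e j) (μ • (e k + x) - g)
      = (2 * j + 1) * inner ℂ (e j) (e k + x) := by
    intro j
    rw [inner_sub_right, inner_smul_right, inner_add_right, hx, inner_basis_basis, reducedCoeff]
    by_cases hjk : j = k
    · subst hjk
      simp only [if_true, zero_mul, add_zero, mul_one, hμdef, ev0]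
      ring
    · have h0 : μ - ev0 j ≠ 0 := by
        intro h0
        have := (one_le_sq_dist hjk).trans (sq_dist_le_sq_norm hμ.le)
        rw [h0] at this
        norm_num at this
      simp only [if_neg hjk, zero_add]
      simp only [ev0] at h0 ⊢
      field_simp
      ring
  have hmem : e k + x ∈ A.domain := (hA.mem_domain _).2 ⟨_, hd⟩
  refine ⟨μ, g, x, hμ, hg, hx, hmem, ?_⟩
  have h1 := hA.hasSum_apply ⟨_, hmem⟩ _ hd
  have h2 : HasSum (fun j => inner ℂ (e j) (e k + x) • w j) g := by
    rw [hfix]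
    refine ((hasSum_ite_eq k (w k)).add (hasSum_clm_apply e T g)).congr_fun fun j => ?_
    rw [inner_add_right, hx, inner_basis_basis, hT, add_smul, smul_smul, mul_comm]
    congr 1
    by_cases hjk : j = k
    · subst hjk; simp
    · simp [hjk]
  have h3 := h1.unique h2
  rw [sub_eq_iff_eq_add] at h3
  rw [h3]
  abel

/-- Write `x = Q g` with `Q` diagonal, so `⟪x, f⟫ = ⟪g, Q* f⟫`. The norm of `g` factors out and the
weight falls on the coordinates of `f`. Unlike `‖x‖ ‖f‖`, this bound can be summed over `k` when
`‖g‖` is only bounded. -/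
theorem sq_norm_inner_le_of_reducedCoeff (e : HilbertBasis ℕ ℂ H) {k : ℕ} {μ : ℂ}
    (hμ : ‖μ - ev0 k‖ ≤ 1 / 16) {x g : H}
    (hx : ∀ j, inner ℂ (e j) x = reducedCoeff k μ j * inner ℂ (e j) g) (f : H) :
    ‖(inner ℂ x f : ℂ)‖ ^ 2
      ≤ ‖g‖ ^ 2 * ∑' j : ℕ, ‖inner ℂ (e j) f‖ ^ 2 * latticeWeight (j - k) := by
  have hsumm : Summable fun j : ℕ => ‖reducedCoeff k μ j • e j‖ ^ 2 := by
    simp_rw [norm_smul, e.orthonormal.1, mul_one]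
    exact (summable_and_tsum_le_of_le_shift k (fun j => by positivity) latticeWeight_nonneg
      summable_latticeWeight (sq_norm_reducedCoeff_le hμ)).1
  have hQ := synth_basis e hsumm
  set Q := synth e fun j => reducedCoeff k μ j • e j
  have hxQ : x = Q g := ext_inner_basis e fun j => by
    rw [hx, inner_diag_apply e hQ]
  rw [hxQ, ← ContinuousLinearMap.adjoint_inner_right]
  have h1 := norm_inner_le_norm (𝕜 := ℂ) g (ContinuousLinearMap.adjoint Q f)
  have h2 : ‖ContinuousLinearMap.adjoint Q f‖ ^ 2
      ≤ ∑' j : ℕ, ‖inner ℂ (e j) f‖ ^ 2 * latticeWeight (j - k) := by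
    have h3 := hasSum_sq_norm_inner e (ContinuousLinearMap.adjoint Q f)
    rw [← h3.tsum_eq]
    have hsw : Summable fun j : ℕ => ‖(inner ℂ (e j) f : ℂ)‖ ^ 2 * latticeWeight (j - k) := by
      have h256 : ∀ m, latticeWeight m ≤ 256 := by
        intro m
        unfold latticeWeight
        split_ifs with hm
        · exact le_rfl
        · have : (1 : ℝ) ≤ (m : ℝ) ^ 2 := by
            have := sq_pos_of_ne_zero hm
            exact_mod_cast this
          rw [div_le_iff₀ (by linarith)]
          linarith
      refine Summable.of_nonneg_of_le (fun j => mul_nonneg (by positivity) (latticeWeight_nonneg _))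
        (fun j => ?_) ((hasSum_sq_norm_inner e f).summable.mul_right 256)
      gcongr
      exact h256 _
    refine h3.summable.tsum_le_tsum (fun j => ?_) hsw
    rw [ContinuousLinearMap.adjoint_inner_right, hQ, inner_smul_left, norm_mul, mul_pow,
      RCLike.norm_conj, mul_comm]
    gcongr
    exact sq_norm_reducedCoeff_le hμ j
  calc _ ≤ (‖g‖ * ‖ContinuousLinearMap.adjoint Q f‖) ^ 2 := by gcongr
    _ = ‖g‖ ^ 2 * ‖ContinuousLinearMap.adjoint Q f‖ ^ 2 := by ring
    _ ≤ _ := by gcongr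

end

end

/-! ### A Riesz basis that consists of eigenvectors from some index on. -/

section

theorem tsum_latticeWeight_pos : 0 < ∑' m, latticeWeight m := by
  have h := summable_latticeWeight.le_tsum (0 : ℤ) fun m _ => latticeWeight_nonneg m
  have : latticeWeight 0 = 256 := by simp [latticeWeight]
  linarith

theorem sum_latticeWeight_le (s : Finset ℕ) (j : ℕ) :
    ∑ k ∈ s, latticeWeight (j - k) ≤ ∑' m, latticeWeight m := by
  obtain ⟨h1, h2⟩ := summable_and_tsum_le_of_le_shift (F := fun k : ℕ => latticeWeight (j - k))
    (j : ℤ) (fun k => latticeWeight_nonneg _) latticeWeight_nonneg summable_latticeWeight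
    (fun k => by rw [← latticeWeight_neg, neg_sub])
  exact (h1.sum_le_tsum s fun k _ => latticeWeight_nonneg _).trans h2

theorem latticeWeight_le (m : ℤ) : latticeWeight m ≤ 256 := by
  unfold latticeWeight
  split_ifs with hm
  · exact le_rfl
  · have : (1 : ℝ) ≤ (m : ℝ) ^ 2 := by
      have := sq_pos_of_ne_zero hm
      exact_mod_cast this
    rw [div_le_iff₀ (by linarith)]
    linarith

section

variable {e : HilbertBasis ℕ ℂ H} {w : ℕ → H} {A : H →ₗ.[ℂ] H}

/-- For large `k`, `A` has eigenvectors `U e_k` close to `e_k`, with `U` boundedly invertible. -/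
theorem IsDiagPerturbation.exists_riesz (hA : IsDiagPerturbation e w A) {B : ℝ}
    (hw : ∀ k, ‖w k‖ ≤ B) (hlim : Tendsto (fun k => ‖w k‖) atTop (𝓝 0)) :
    ∃ (M : ℕ) (U : H ≃L[ℂ] H) (μ : ℕ → ℂ), ∀ k ≥ M, ‖μ k - ev0 k‖ < 1 / 16 ∧
      ∃ h : U (e k) ∈ A.domain, A ⟨U (e k), h⟩ = μ k • U (e k) := by
  set C := ∑' m, latticeWeight m with hCdef
  have hC : 0 < C := tsum_latticeWeight_pos
  have hconv : ∀ᶠ k : ℕ in atTop, latticeConv (fun j => ‖w j‖ ^ 2) k ≤ (1 / 4) ^ 2 := by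
    have h1 := tendsto_latticeConv_sq_norm hw hlim
    have h2 : Tendsto (fun k : ℕ => (k : ℤ)) atTop cofinite := by
      rw [← Nat.cofinite_eq_atTop]
      exact Nat.cast_injective.tendsto_cofinite
    exact ((h1.comp h2).eventually_lt_const (by norm_num)).mono fun k hk => le_of_lt hk
  have hw64 : ∀ᶠ k : ℕ in atTop, ‖w k‖ < 1 / 64 := hlim.eventually_lt_const (by norm_num)
  -- For fixed `j` the weights of `j - k` sum over `k` to at most `C`. The threshold `1/(4C)`
  -- therefore leaves the Bessel constant `(1/2)²`.
  have hwD : ∀ᶠ k : ℕ in atTop, (2 * ‖w k‖) ^ 2 < 1 / (4 * C) := by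
    have := (hlim.const_mul 2).pow 2
    simp only [mul_zero, ne_eq, OfNat.ofNat_ne_zero, not_false_eq_true, zero_pow] at this
    exact this.eventually_lt_const (by positivity)
  obtain ⟨M, hM⟩ := eventually_atTop.1 ((hconv.and hw64).and hwD)
  have hex : ∀ k, ∃ (μ : ℂ) (g x : H), M ≤ k → ‖μ - ev0 k‖ < 1 / 16 ∧ ‖g‖ ≤ 2 * ‖w k‖ ∧
      (∀ j, inner ℂ (e j) x = reducedCoeff k μ j * inner ℂ (e j) g) ∧
      ∃ h : e k + x ∈ A.domain, A ⟨e k + x, h⟩ = μ • (e k + x) := by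
    intro k
    by_cases hk : M ≤ k
    · obtain ⟨μ, g, x, h⟩ := hA.exists_eigenvector hw (hM k hk).1.1 (hM k hk).1.2
      exact ⟨μ, g, x, fun _ => h⟩
    · exact ⟨0, 0, 0, fun h => absurd h hk⟩
  choose μ g x hx using hex
  let x' : ℕ → H := fun k => if M ≤ k then x k else 0
  have hbound : ∀ f k, ‖(inner ℂ (x' k) f : ℂ)‖ ^ 2
      ≤ 1 / (4 * C) * ∑' j : ℕ, ‖inner ℂ (e j) f‖ ^ 2 * latticeWeight (j - k) := by
    intro f k
    have hnn : 0 ≤ ∑' j : ℕ, ‖(inner ℂ (e j) f : ℂ)‖ ^ 2 * latticeWeight (j - k) :=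
      tsum_nonneg fun j => mul_nonneg (by positivity) (latticeWeight_nonneg _)
    by_cases hk : M ≤ k
    · obtain ⟨h1, h2, h3, -⟩ := hx k hk
      simp only [x', if_pos hk]
      refine (sq_norm_inner_le_of_reducedCoeff e h1.le h3 f).trans ?_
      exact mul_le_mul_of_nonneg_right
        ((pow_le_pow_left₀ (norm_nonneg _) h2 2).trans (hM k hk).2.le) hnn
    · simp only [x', if_neg hk, inner_zero_left, norm_zero]
      have h0 : 0 ≤ 1 / (4 * C) := by positivity
      simpa using mul_nonneg h0 hnn
  have hfin : ∀ f (s : Finset ℕ), ∑ k ∈ s, ‖(inner ℂ (x' k) f : ℂ)‖ ^ 2 ≤ (1 / 2) ^ 2 * ‖f‖ ^ 2 := by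
    intro f s
    have hf := hasSum_sq_norm_inner e f
    have hsw : ∀ k : ℕ,
        Summable fun j : ℕ => ‖(inner ℂ (e j) f : ℂ)‖ ^ 2 * latticeWeight (j - k) := fun k =>
      Summable.of_nonneg_of_le (fun j => mul_nonneg (by positivity) (latticeWeight_nonneg _))
        (fun j => mul_le_mul_of_nonneg_left (latticeWeight_le _) (by positivity))
        (hf.summable.mul_right 256)
    calc _ ≤ ∑ k ∈ s, 1 / (4 * C) *
            ∑' j : ℕ, ‖(inner ℂ (e j) f : ℂ)‖ ^ 2 * latticeWeight (j - k) :=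
          Finset.sum_le_sum fun k _ => hbound f k
      _ = 1 / (4 * C) * ∑' j : ℕ, ‖(inner ℂ (e j) f : ℂ)‖ ^ 2
            * ∑ k ∈ s, latticeWeight (j - k) := by
          rw [← Finset.mul_sum, ← Summable.tsum_finsetSum fun k _ => hsw k]
          simp_rw [Finset.mul_sum]
      _ ≤ 1 / (4 * C) * ∑' j : ℕ, ‖(inner ℂ (e j) f : ℂ)‖ ^ 2 * C := by
          gcongr
          · simp_rw [Finset.mul_sum]
            exact summable_sum fun k _ => hsw k
          · exact hf.summable.mul_right C
          · exact sum_latticeWeight_le s _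
      _ = (1 / 2) ^ 2 * ‖f‖ ^ 2 := by
          rw [tsum_mul_right, hf.tsum_eq]
          field_simp
          ring
  obtain ⟨X, hX, hXn⟩ := exists_clm_of_bessel e x' (C := 1 / 2) (by norm_num)
    (fun f => summable_of_sum_le (fun k => by positivity) (hfin f))
    (fun f => Real.tsum_le_of_sum_le (fun k => by positivity) (hfin f))
  have hXn' : ‖-X‖ < 1 := by rw [norm_neg]; linarith
  let U := ContinuousLinearEquiv.unitsEquiv ℂ H (Units.oneSub (-X) hXn')
  have hU : ∀ k ≥ M, U (e k) = e k + x k := by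
    intro k hk
    have : U (e k) = (1 - -X) (e k) := rfl
    rw [this, sub_neg_eq_add, _root_.add_apply, hX]
    simp [x', hk]
  refine ⟨M, U, μ, fun k hk => ?_⟩
  obtain ⟨h1, -, -, h4⟩ := hx k hk
  rw [hU k hk]
  exact ⟨h1, h4⟩

end

/-! ### Polynomials in an operator that is diagonal on a tail of the basis. -/

section Completion

variable {E : Type*} [NormedAddCommGroup E] [InnerProductSpace ℂ E]

open Polynomial

theorem aeval_monomial_apply (T : E →L[ℂ] E) (n : ℕ) (c : ℂ) (x : E) :
    aeval T (monomial n c) x = c • (T ^ n) x := by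
  rw [← C_mul_X_pow_eq_monomial, map_mul, aeval_C, map_pow, aeval_X,
    Algebra.algebraMap_eq_smul_one, smul_mul_assoc, one_mul, _root_.smul_apply]

theorem aeval_apply_of_eq_smul {T : E →L[ℂ] E} {x : E} {μ : ℂ} (h : T x = μ • x) (q : ℂ[X]) :
    aeval T q x = q.eval μ • x := by
  induction q using Polynomial.induction_on' with
  | add p q hp hq => rw [map_add, _root_.add_apply, hp, hq, eval_add, add_smul]
  | monomial n c =>
    have : (T ^ n) x = μ ^ n • x := by
      induction n with
      | zero => simp
      | succ n ih =>
        rw [pow_succ, mul_apply_eq_comp, h, map_smul, ih, smul_smul, pow_succ']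
    rw [aeval_monomial_apply, this, eval_monomial, smul_smul]

/-- If `T` has dense range and `T e_k = ρ_k e_k` for `k ≥ M`, then `T` modulo the closed span of
`e_k`, `k ≥ N`, is annihilated by a polynomial without small roots besides `ρ_k`, `M ≤ k < N`. -/
theorem exists_annihilating_polynomial (e : HilbertBasis ℕ ℂ E) {T : E →L[ℂ] E}
    (hT : DenseRange T) {M : ℕ} {ρ : ℕ → ℂ} (hρ : ∀ k ≥ M, T (e k) = ρ k • e k) :
    ∃ η > 0, ∀ N ≥ M, ∃ q : ℂ[X], (∀ f, ∀ k < N, inner ℂ (e k) (aeval T q f) = 0) ∧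
      ∀ z : ℂ, ‖z‖ < η → (∀ k, M ≤ k → k < N → z ≠ ρ k) → q.eval z ≠ 0 := by
  let π : E →L[ℂ] (Fin M → ℂ) := ContinuousLinearMap.pi fun i => innerSL ℂ (e i)
  have hπ : ∀ f i, π f i = inner ℂ (e i) f := fun f i => rfl
  let ι : (Fin M → ℂ) →ₗ[ℂ] E := Fintype.linearCombination ℂ fun i : Fin M => e i
  have hι : ∀ v, ι v = ∑ i, v i • e i := fun v => rfl
  have hπι : ∀ v, π (ι v) = v := by
    intro v
    funext i
    rw [hπ, hι, inner_sum]
    simp [inner_smul_right, inner_basis_basis, Fin.val_inj]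
  -- The closed span of `e k`, `k ≥ M`, is invariant under `T`; `a` is the map that `T` induces on
  -- the quotient.
  let a : Module.End ℂ (Fin M → ℂ) := (π : E →ₗ[ℂ] _) ∘ₗ (T : E →ₗ[ℂ] E) ∘ₗ ι
  have haπ : ∀ f, a (π f) = π (T f) := by
    intro f
    have h : π (T f) - a (π f) = π (T (f - ι (π f))) := by simp [a]
    suffices π (T (f - ι (π f))) = 0 by rw [this, sub_eq_zero] at h; exact h.symm
    have h0 : ∀ k < M, inner ℂ (e k) (f - ι (π f)) = 0 := by
      intro k hk
      have := congrFun (hπι (π f)) ⟨k, hk⟩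
      rw [hπ, hπ] at this
      rw [inner_sub_right, this, sub_self]
    set f' := f - ι (π f)
    funext i
    rw [hπ]
    have h1 := (innerSL ℂ (e i)).hasSum (hasSum_clm_apply e T f')
    refine h1.unique ?_
    convert! hasSum_zero using 1
    funext k
    rw [innerSL_apply_apply, inner_smul_right]
    by_cases hk : k < M
    · rw [h0 k hk, zero_mul]
    · rw [hρ k (not_lt.1 hk), inner_smul_right, inner_basis_basis, if_neg, mul_zero, mul_zero]
      have := i.2
      omega
  -- The range of `a` is dense because that of `T` is, and closed by finite dimension. Hence `0` is
  -- not a root of the minimal polynomial.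
  have hsurj : Function.Surjective a := by
    rw [← LinearMap.range_eq_top, Submodule.eq_top_iff']
    intro v
    have hcl : IsClosed ((LinearMap.range a : Submodule ℂ (Fin M → ℂ)) : Set (Fin M → ℂ)) :=
      Submodule.closed_of_finiteDimensional _
    have h1 : ι v ∈ closure (Set.range T) := hT (ι v)
    have h2 : π (ι v) ∈ closure (π '' Set.range T) :=
      image_closure_subset_closure_image π.continuous ⟨_, h1, rfl⟩
    rw [hπι] at h2
    refine hcl.closure_subset_iff.2 ?_ h2
    rintro _ ⟨_, ⟨f, rfl⟩, rfl⟩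
    exact ⟨π f, haπ f⟩
  have hp0 : (minpoly ℂ a).eval 0 ≠ 0 := by
    intro h0
    have h1 : a.HasEigenvalue 0 := Module.End.hasEigenvalue_iff_isRoot.2 h0
    obtain ⟨v, hv⟩ := h1.exists_hasEigenvector
    have h2 : a v = 0 := by simpa using hv.apply_eq_smul
    exact hv.2 ((LinearMap.injective_iff_surjective.2 hsurj) (by rw [h2, map_zero]))
  have hpπ : ∀ (p : ℂ[X]) f, π (aeval T p f) = aeval a p (π f) := by
    intro p
    induction p using Polynomial.induction_on' with
    | add p q hp hq => intro f; simp [hp, hq]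
    | monomial n c =>
      intro f
      have : π ((T ^ n) f) = (a ^ n) (π f) := by
        induction n with
        | zero => simp
        | succ n ih =>
          rw [pow_succ', pow_succ', mul_apply_eq_comp, Module.End.mul_apply, ← haπ, ih]
      rw [aeval_monomial_apply, map_smul, this]
      simp [aeval_monomial, Algebra.algebraMap_eq_smul_one]
  have hcont : ∀ᶠ z in 𝓝 (0 : ℂ), (minpoly ℂ a).eval z ≠ 0 :=
    (minpoly ℂ a).continuous.continuousAt.eventually_ne hp0
  obtain ⟨η, hη, hball⟩ := Metric.eventually_nhds_iff.1 hcont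
  -- The radius `η` depends only on the quotient by the tail `k ≥ M`, so `N` may be chosen after it.
  refine ⟨η, hη, fun N hN => ?_⟩
  refine ⟨(∏ k ∈ Finset.Ico M N, (X - C (ρ k))) * minpoly ℂ a, fun f k hk => ?_, fun z hz hne => ?_⟩
  · rw [map_mul, mul_apply_eq_comp]
    have h0 : ∀ k < M, inner ℂ (e k) (aeval T (minpoly ℂ a) f) = 0 := by
      intro k hk
      have := hpπ (minpoly ℂ a) f
      rw [minpoly.aeval, LinearMap.zero_apply] at this
      exact congrFun this ⟨k, hk⟩
    set f' := aeval T (minpoly ℂ a) f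
    have hterm : ∀ j ≥ M, aeval T (∏ k ∈ Finset.Ico M N, (X - C (ρ k))) (e j)
        = (∏ k ∈ Finset.Ico M N, (ρ j - ρ k)) • e j := by
      intro j hj
      rw [aeval_apply_of_eq_smul (hρ j hj), eval_prod]
      simp
    set Q := aeval T (∏ k ∈ Finset.Ico M N, (X - C (ρ k)))
    have h1 := (innerSL ℂ (e k)).hasSum (hasSum_clm_apply e Q f')
    refine h1.unique ?_
    convert! hasSum_zero using 1
    funext j
    rw [innerSL_apply_apply, inner_smul_right]
    by_cases hj : j < M
    · rw [h0 j hj, zero_mul]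
    · rw [hterm j (not_lt.1 hj), inner_smul_right, inner_basis_basis]
      by_cases hkj : k = j
      · subst hkj
        rw [Finset.prod_eq_zero (Finset.mem_Ico.2 ⟨not_lt.1 hj, hk⟩) (sub_self _)]
        simp
      · simp [hkj]
  · rw [eval_mul, eval_prod]
    refine mul_ne_zero (Finset.prod_ne_zero_iff.2 fun k hk => ?_) (hball (by simpa using hz))
    rw [Finset.mem_Ico] at hk
    simpa [sub_eq_zero] using hne k hk.1 hk.2

end Completion

end

/-! ### A complement of the tail spanned by root vectors. -/

section

section Completion

variable {E : Type*} [NormedAddCommGroup E] [InnerProductSpace ℂ E]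

open Polynomial

/-- The first `N` coordinates can be moved to any vectors that are independent modulo the closed
span of the other basis vectors. -/
theorem exists_equiv_of_independent_mod [CompleteSpace E] (e : HilbertBasis ℕ ℂ E) {N : ℕ}
    (b : Fin N → E)
    (hb : ∀ c : Fin N → ℂ, (∀ k < N, inner ℂ (e k) (∑ i, c i • b i) = 0) → c = 0) :
    ∃ W : E ≃L[ℂ] E, (∀ i : Fin N, W (e (i : ℕ)) = b i) ∧ ∀ k ≥ N, W (e k) = e k := by
  let W₀ : E →L[ℂ] E := 1 + ∑ i : Fin N, (innerSL ℂ (e (i : ℕ))).smulRight (b i - e (i : ℕ))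
  have hW₀ : ∀ f, W₀ f = f + ∑ i : Fin N, (inner ℂ (e i) f : ℂ) • (b i - e i) := by
    intro f
    simp [W₀, _root_.sum_apply]
  have hlt : ∀ i : Fin N, W₀ (e i) = b i := by
    intro i
    rw [hW₀]
    simp [inner_basis_basis, Fin.val_inj]
  have hge : ∀ k ≥ N, W₀ (e k) = e k := by
    intro k hk
    rw [hW₀, add_eq_left]
    refine Finset.sum_eq_zero fun i _ => ?_
    rw [inner_basis_basis, if_neg (by have := i.2; omega), zero_smul]
  have hfix : ∀ f, (∀ k < N, inner ℂ (e k) f = 0) → W₀ f = f := by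
    intro f hf
    rw [hW₀, add_eq_left]
    exact Finset.sum_eq_zero fun i _ => by rw [hf i i.2, zero_smul]
  let π : E →ₗ[ℂ] (Fin N → ℂ) := LinearMap.pi fun i : Fin N => (innerSL ℂ (e i) : E →ₗ[ℂ] ℂ)
  have hπ : ∀ f i, π f i = inner ℂ (e i) f := fun f i => rfl
  have hπ0 : ∀ f, π f = 0 → ∀ k < N, inner ℂ (e k) f = 0 :=
    fun f hf k hk => congrFun hf ⟨k, hk⟩
  let β : (Fin N → ℂ) →ₗ[ℂ] E := Fintype.linearCombination ℂ b
  let ε : (Fin N → ℂ) →ₗ[ℂ] E := Fintype.linearCombination ℂ fun i : Fin N => e i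
  have hβ : ∀ c, β c = ∑ i, c i • b i := fun c => rfl
  have hε : ∀ c, ε c = ∑ i, c i • e i := fun c => rfl
  have hWε : ∀ c, W₀ (ε c) = β c := by
    intro c
    rw [hε, map_sum, hβ]
    simp_rw [map_smul, hlt]
  have hπε : ∀ c, π (ε c) = c := by
    intro c
    funext i
    rw [hπ, hε, inner_sum]
    simp [inner_smul_right, inner_basis_basis, Fin.val_inj]
  -- `W₀` is the identity on the tail and induces `π ∘ₗ β` on the quotient. The latter is injective
  -- by `hb`, hence bijective by dimension, which makes `W₀` bijective.
  have hinj0 : Function.Injective (π ∘ₗ β) := by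
    rw [← LinearMap.ker_eq_bot, LinearMap.ker_eq_bot']
    intro c hc
    exact hb c (hπ0 _ hc)
  have hsurj0 : Function.Surjective (π ∘ₗ β) := LinearMap.injective_iff_surjective.1 hinj0
  have hdec : ∀ f, W₀ f = β (π f) + (f - ε (π f)) := by
    intro f
    have h1 : W₀ (f - ε (π f)) = f - ε (π f) := by
      refine hfix _ (hπ0 _ ?_)
      rw [map_sub, hπε, sub_self]
    calc W₀ f = W₀ (ε (π f)) + W₀ (f - ε (π f)) := by rw [← map_add]; congr 1; abel
      _ = _ := by rw [hWε, h1]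
  have hker : LinearMap.ker (W₀ : E →ₗ[ℂ] E) = ⊥ := by
    rw [LinearMap.ker_eq_bot']
    intro f hf
    have h1 : β (π f) + (f - ε (π f)) = 0 := by rw [← hdec]; exact hf
    have h2 := congrArg π h1
    rw [map_add, map_sub, hπε, sub_self, add_zero, map_zero] at h2
    have h3 : π f = 0 := hinj0 (by rw [map_zero]; exact h2)
    rw [h3] at h1
    simpa using h1
  have hran : LinearMap.range (W₀ : E →ₗ[ℂ] E) = ⊤ := by
    rw [LinearMap.range_eq_top]
    intro f
    obtain ⟨c, hc⟩ := hsurj0 (π f)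
    refine ⟨ε c + (f - β c), ?_⟩
    change W₀ (ε c + (f - β c)) = f
    rw [map_add, hWε, hfix _ (hπ0 _ ?_)]
    · abel
    · rw [map_sub, sub_eq_zero]
      exact hc.symm
  exact ⟨ContinuousLinearEquiv.ofBijective W₀ hker hran, hlt, hge⟩

theorem exists_diag [CompleteSpace E] (e : HilbertBasis ℕ ℂ E) {d : ℕ → ℂ} {B : ℝ}
    (hB : 0 ≤ B) (hd : ∀ k, ‖d k‖ ≤ B) : ∃ D : E →L[ℂ] E, ∀ k, D (e k) = d k • e k := by
  have hbd : ∀ f k, ‖(inner ℂ (d k • e k) f : ℂ)‖ ^ 2 ≤ B ^ 2 * ‖(inner ℂ (e k) f : ℂ)‖ ^ 2 := by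
    intro f k
    rw [inner_smul_left, norm_mul, mul_pow, RCLike.norm_conj]
    gcongr
    exact hd k
  have hs : ∀ f, Summable fun k => ‖(inner ℂ (d k • e k) f : ℂ)‖ ^ 2 := fun f =>
    Summable.of_nonneg_of_le (fun k => by positivity) (hbd f)
      ((hasSum_sq_norm_inner e f).summable.mul_left _)
  obtain ⟨D, hD, -⟩ := exists_clm_of_bessel e (fun k => d k • e k) hB hs fun f => by
    rw [← (hasSum_sq_norm_inner e f).tsum_eq, ← tsum_mul_left]
    exact (hs f).tsum_le_tsum (hbd f) ((hasSum_sq_norm_inner e f).summable.mul_left _)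
  exact ⟨D, hD⟩

/-- The projection onto `ker q(T)` along the closed span of `e_k`, `k ≥ N`. -/
theorem exists_projection_ker_aeval [CompleteSpace E] (e : HilbertBasis ℕ ℂ E) {T : E →L[ℂ] E}
    {N : ℕ} {ρ : ℕ → ℂ} (hρ : ∀ k ≥ N, T (e k) = ρ k • e k) (hlim : Tendsto ρ atTop (𝓝 0))
    {q : ℂ[X]} (hq : ∀ f, ∀ k < N, inner ℂ (e k) (aeval T q f) = 0) (hq0 : q.eval 0 ≠ 0)
    (hqρ : ∀ k ≥ N, q.eval (ρ k) ≠ 0) :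
    ∃ Q : E →L[ℂ] E, (∀ f, aeval T q (Q f) = 0) ∧
      (∀ f, ∀ k < N, inner ℂ (e k) (Q f) = inner ℂ (e k) f) ∧
      (∀ f, aeval T q f = 0 → Q f = f) ∧ ∀ k ≥ N, Q (e k) = 0 := by
  -- Convergence, due to `q(0) ≠ 0`, bounds the diagonal entries of the inverse of `q(T)` on the
  -- tail.
  have hlim2 : Tendsto (fun k => (q.eval (ρ k))⁻¹) atTop (𝓝 (q.eval 0)⁻¹) :=
    (((q.continuous.tendsto 0).comp hlim).inv₀ hq0)
  obtain ⟨B, hB⟩ := hlim2.norm.bddAbove_range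
  have hB' : ∀ k, ‖(q.eval (ρ k))⁻¹‖ ≤ B := fun k => hB ⟨k, rfl⟩
  have hB0 : 0 ≤ B := (norm_nonneg _).trans (hB' 0)
  obtain ⟨D, hD⟩ := exists_diag e (d := fun k => if k < N then 0 else (q.eval (ρ k))⁻¹) hB0
    (fun k => by split_ifs; exacts [by simpa using hB0, hB' k])
  set P := aeval T q
  have hP : ∀ k ≥ N, P (e k) = q.eval (ρ k) • e k := fun k hk => aeval_apply_of_eq_smul (hρ k hk) q
  have hPD : ∀ k, (P ∘L D) (e k) = (if k < N then (0 : ℂ) else 1) • e k := by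
    intro k
    rw [ContinuousLinearMap.comp_apply, hD]
    split_ifs with hk
    · simp
    · rw [map_smul, hP k (not_lt.1 hk), smul_smul, inv_mul_cancel₀ (hqρ k (not_lt.1 hk))]
  have hPD' : ∀ h, (∀ k < N, inner ℂ (e k) h = 0) → P (D h) = h := by
    intro h hh
    refine ext_inner_basis e fun k => ?_
    have := inner_diag_apply e hPD h k
    rw [ContinuousLinearMap.comp_apply] at this
    rw [this]
    split_ifs with hk
    · rw [hh k hk, zero_mul]
    · rw [one_mul]
  -- `D` inverts `P = q(T)` on the tail and vanishes on the first `N` basis vectors. As `P` maps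
  -- into the tail, `P D P = P`, so `1 - D P` takes values in `ker P`.
  refine ⟨1 - D ∘L P, fun f => ?_, fun f k hk => ?_, fun f hf => ?_, fun k hk => ?_⟩
  · simp [hPD' (P f) (hq f)]
  · simp only [_root_.sub_apply, one_apply_eq_self, ContinuousLinearMap.comp_apply, inner_sub_right,
      inner_diag_apply e hD, if_pos hk, zero_mul, sub_zero]
  · simp [hf]
  · simp only [_root_.sub_apply, one_apply_eq_self, ContinuousLinearMap.comp_apply, hP k hk, map_smul,
      hD, if_neg (not_lt.2 hk), smul_smul, mul_inv_cancel₀ (hqρ k hk), one_smul, sub_self]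

theorem sub_smul_one_eq_aeval (T : E →L[ℂ] E) (c : ℂ) : T - c • (1 : E →L[ℂ] E) = aeval T (X - C c) := by
  rw [map_sub, aeval_X, aeval_C, Algebra.algebraMap_eq_smul_one]

/-- If `x ∈ ker q(T)` is a nonzero root vector of `T` for `c`, then `q c = 0`. -/
theorem eval_eq_zero_of_root {T : E →L[ℂ] E} {q : ℂ[X]} {x : E} {c : ℂ} {m : ℕ} (hx : x ≠ 0)
    (hq : aeval T q x = 0) (hm : ((T - c • (1 : E →L[ℂ] E)) ^ m) x = 0) : q.eval c = 0 := by
  classical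
  have hex : ∃ m, ((T - c • (1 : E →L[ℂ] E)) ^ m) x = 0 := ⟨m, hm⟩
  have h1 := Nat.find_spec hex
  have h0 : Nat.find hex ≠ 0 := by
    intro h
    rw [h, pow_zero, one_apply_eq_self] at h1
    exact hx h1
  obtain ⟨n, hn⟩ := Nat.exists_eq_succ_of_ne_zero h0
  have h2 := Nat.find_min hex (m := n) (by omega)
  rw [hn, pow_succ', mul_apply_eq_comp] at h1
  -- The last nonzero vector of the chain is an eigenvector for `c` that still lies in `ker q(T)`.
  set y := ((T - c • (1 : E →L[ℂ] E)) ^ n) x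
  have h3 : T y = c • y := by
    simpa [sub_eq_zero] using h1
  have h4 : aeval T q y = 0 := by
    have : aeval T q * (T - c • (1 : E →L[ℂ] E)) ^ n = (T - c • (1 : E →L[ℂ] E)) ^ n * aeval T q := by
      rw [sub_smul_one_eq_aeval, ← map_pow, ← map_mul, ← map_mul, mul_comm]
    have := congrArg (fun S : E →L[ℂ] E => S x) this
    simp only [mul_apply_eq_comp, hq, map_zero] at this
    exact this
  rw [aeval_apply_of_eq_smul h3] at h4
  exact (smul_eq_zero.1 h4).resolve_right h2

/-- A basis of `ker q(T)` consisting of root vectors. -/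
theorem exists_root_basis_ker_aeval (e : HilbertBasis ℕ ℂ E) {T : E →L[ℂ] E}
    {N : ℕ} {q : ℂ[X]} {Q : E →L[ℂ] E} (h1 : ∀ f, aeval T q (Q f) = 0)
    (h2 : ∀ f, ∀ k < N, inner ℂ (e k) (Q f) = inner ℂ (e k) f)
    (h3 : ∀ f, aeval T q f = 0 → Q f = f) (h4 : ∀ k ≥ N, Q (e k) = 0) :
    ∃ (b : Fin N → E) (c : Fin N → ℂ), (∀ i, aeval T q (b i) = 0) ∧ (∀ i, b i ≠ 0) ∧
      (∀ i, ∃ m, ((T - c i • (1 : E →L[ℂ] E)) ^ m) (b i) = 0) ∧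
      ∀ v : Fin N → ℂ, (∀ k < N, inner ℂ (e k) (∑ i, v i • b i) = 0) → v = 0 := by
  let F : Submodule ℂ E := LinearMap.ker (aeval T q : E →ₗ[ℂ] E)
  have hF : ∀ f, f ∈ F ↔ aeval T q f = 0 := fun f => Iff.rfl
  have hker : ∀ f ∈ F, (∀ k < N, inner ℂ (e k) f = 0) → f = 0 := by
    intro f hf hk
    rw [← h3 f hf]
    refine (hasSum_clm_apply e Q f).unique ?_
    convert! hasSum_zero using 1
    funext k
    by_cases hkN : k < N
    · rw [hk k hkN, zero_smul]
    · rw [h4 k (not_lt.1 hkN), smul_zero]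
  let π : F →ₗ[ℂ] (Fin N → ℂ) :=
    LinearMap.pi fun i => (innerSL ℂ (e i) : E →ₗ[ℂ] ℂ) ∘ₗ F.subtype
  have hπ : ∀ f i, π f i = inner ℂ (e i) (f : E) := fun f i => rfl
  have hinj : Function.Injective π := by
    rw [← LinearMap.ker_eq_bot, LinearMap.ker_eq_bot']
    intro f hf
    exact Subtype.ext (hker f f.2 fun k hk => congrFun hf ⟨k, hk⟩)
  have hsurj : Function.Surjective π := by
    intro v
    refine ⟨⟨Q (∑ i, v i • e i), h1 _⟩, ?_⟩
    funext i
    rw [hπ, h2 _ _ i.2, inner_sum]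
    simp [inner_smul_right, inner_basis_basis, Fin.val_inj]
  -- The first `N` coordinates identify `ker q(T)` with `ℂ^N`. This is the source of the rank `N` of
  -- `S_N`.
  let eqv := LinearEquiv.ofBijective π ⟨hinj, hsurj⟩
  have : FiniteDimensional ℂ F := Module.Finite.equiv eqv.symm
  have hrank : Module.finrank ℂ F = N := by rw [eqv.finrank_eq]; simp
  have hTF : ∀ f ∈ F, T f ∈ F := by
    intro f hf
    have : aeval T q * T = T * aeval T q := by
      have h := congrArg (aeval T) (mul_comm q X)
      rwa [map_mul, map_mul, aeval_X] at h
    have := congrArg (fun S : E →L[ℂ] E => S f) this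
    simp only [mul_apply_eq_comp] at this
    rw [hF] at hf ⊢
    rw [this, hf, map_zero]
  let a : Module.End ℂ F := (T : E →ₗ[ℂ] E).restrict hTF
  have ha : ∀ (c : ℂ) (m : ℕ) (x : F), (((a - c • 1) ^ m) x : E) = ((T - c • (1 : E →L[ℂ] E)) ^ m) (x : E) := by
    intro c m
    induction m with
    | zero => simp
    | succ m ih =>
      intro x
      rw [pow_succ, pow_succ, Module.End.mul_apply, ih, mul_apply_eq_comp]
      simp [a]
  have hspan : ⊤ ≤ Submodule.span ℂ (⋃ c : ℂ, (a.maxGenEigenspace c : Set F)) := by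
    rw [← Submodule.iSup_eq_span, Module.End.iSup_maxGenEigenspace_eq_top]
  let b₀ := Module.Basis.ofSpan hspan
  have hb₀ : ∀ i, ∃ c, b₀ i ∈ a.maxGenEigenspace c := by
    intro i
    exact Set.mem_iUnion.1 (Module.Basis.ofSpan_subset hspan ⟨i, rfl⟩)
  let b₁ : Module.Basis (Fin N) ℂ F :=
    b₀.reindex (b₀.indexEquiv (Module.finBasisOfFinrankEq ℂ F hrank))
  have hb₁ : ∀ i, ∃ c, b₁ i ∈ a.maxGenEigenspace c := by
    intro i
    simp only [b₁, Module.Basis.reindex_apply]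
    exact hb₀ _
  choose c hc using hb₁
  refine ⟨fun i => b₁ i, c, fun i => (b₁ i).2, fun i hi => b₁.ne_zero i (Subtype.ext hi),
    fun i => ?_, fun v hv => ?_⟩
  · obtain ⟨m, hm⟩ := (Module.End.mem_maxGenEigenspace _ _ _).1 (hc i)
    exact ⟨m, by rw [← ha, hm]; rfl⟩
  · have h5 : (∑ i, v i • b₁ i) = 0 := by
      refine Subtype.ext (hker _ (∑ i, v i • b₁ i).2 fun k hk => ?_)
      have := hv k hk
      simpa using this
    have := Fintype.linearIndependent_iff.1 b₁.linearIndependent v h5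
    exact funext this

end Completion

end

/-! ### Construction of the root system. -/

section

section

variable {A : H →ₗ.[ℂ] H} {e : HilbertBasis ℕ ℂ H} {w : ℕ → H}

/-- `V e_k` is a Riesz basis of root vectors of `A` for `ev k`, which for `k ≥ N` are eigenvectors
for eigenvalues close to `2k + 1`, while the other `ev k` stay away from these disks. The operator
`R` is the resolvent of `A` at `z₀`. -/
structure IsRootSystem (A : H →ₗ.[ℂ] H) (e : HilbertBasis ℕ ℂ H) (N : ℕ) (V : H ≃L[ℂ] H)
    (ev : ℕ → ℂ) (z₀ : ℂ) (R : H →L[ℂ] H) : Prop where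
  resolvent : IsResolventAt A z₀ R
  ev_ne : ∀ k, ev k ≠ z₀
  root : ∀ k, ∃ m, ((R - (z₀ - ev k)⁻¹ • (1 : H →L[ℂ] H)) ^ m) (V (e k)) = 0
  near : ∀ k ≥ N, ‖ev k - ev0 k‖ < 1 / 16
  eigen : ∀ k ≥ N, R (V (e k)) = (z₀ - ev k)⁻¹ • V (e k)
  far : ∀ k < N, ∀ n ≥ N, 1 / 16 ≤ ‖ev k - ev0 n‖

theorem eq_of_norm_sub_ev0_lt {μ : ℂ} {j k : ℕ} (hj : ‖μ - ev0 j‖ < 1 / 16)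
    (hk : ‖μ - ev0 k‖ < 1 / 16) : j = k := by
  by_contra h
  have h1 := sq_dist_le_sq_norm (j := j) hk.le
  have h2 := one_le_sq_dist h
  nlinarith [norm_nonneg (μ - ev0 j)]

theorem IsResolventAt.apply_eq_smul {z₀ μ : ℂ} {R : H →L[ℂ] H} (hR : IsResolventAt A z₀ R)
    (hμ : μ ≠ z₀) {x : H} (hx : x ∈ A.domain) (h : A ⟨x, hx⟩ = μ • x) :
    R x = (z₀ - μ)⁻¹ • x := by
  have h1 := hR.2 ⟨x, hx⟩
  rw [h, ← sub_smul, map_smul] at h1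
  exact (eq_inv_smul_iff₀ (sub_ne_zero.2 hμ.symm)).2 h1

theorem re_ev0 (k : ℕ) : (ev0 k).re = 2 * k + 1 := by simp [ev0]

theorem im_ev0 (k : ℕ) : (ev0 k).im = 0 := by simp [ev0]

theorem norm_inv_sub_le {z₀ ζ : ℂ} (hz₀ : z₀.re = 0) {n : ℕ} (h : ‖ζ - ev0 n‖ < 1 / 16) :
    ‖(z₀ - ζ)⁻¹‖ ≤ 1 / ((n : ℝ) + 1 / 2) := by
  rw [norm_inv, ← one_div]
  have h1 := Complex.abs_re_le_norm (ζ - ev0 n)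
  rw [Complex.sub_re, re_ev0] at h1
  have h2 := Complex.abs_re_le_norm (z₀ - ζ)
  rw [Complex.sub_re, hz₀, zero_sub, abs_neg] at h2
  have h3 := (abs_le.1 h1).1
  have h4 := le_abs_self ζ.re
  have : (0 : ℝ) ≤ n := Nat.cast_nonneg n
  gcongr
  linarith

theorem tendsto_one_div_add_half : Tendsto (fun n : ℕ => 1 / ((n : ℝ) + 1 / 2)) atTop (𝓝 0) := by
  simp_rw [one_div]
  exact tendsto_inv_atTop_zero.comp
    (tendsto_atTop_add_const_right _ _ tendsto_natCast_atTop_atTop)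

theorem pow_conj_apply (U : H ≃L[ℂ] H) (R : H →L[ℂ] H) (c : ℂ) (m : ℕ) (x : H) :
    ((R - c • (1 : H →L[ℂ] H)) ^ m) (U x) =
      U ((((U.symm : H →L[ℂ] H) ∘L R ∘L (U : H →L[ℂ] H) - c • (1 : H →L[ℂ] H)) ^ m) x) := by
  induction m generalizing x with
  | zero => simp
  | succ m ih =>
    rw [pow_succ, pow_succ, mul_apply_eq_comp, mul_apply_eq_comp, ← ih]
    simp

/-- For nonzero bounds on the perturbation. -/
theorem IsDiagPerturbation.exists_rootSystem (hA : IsDiagPerturbation e w A) {B : ℝ}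
    (hB : 0 < B) (hw : ∀ k, ‖w k‖ ≤ B) (hlim : Tendsto (fun k => ‖w k‖) atTop (𝓝 0)) :
    ∃ (N : ℕ) (V : H ≃L[ℂ] H) (ev : ℕ → ℂ) (z₀ : ℂ) (R : H →L[ℂ] H),
      IsRootSystem A e N V ev z₀ R ∧
      Sp A ⊆ box (2 * N) (8 * (B + 2 * Real.pi * B ^ 2)) ∪
        ⋃ k ∈ Set.Ici N, Metric.ball (ev0 k) (1 / 16) := by
  have hY : 0 < 8 * (B + 2 * Real.pi * B ^ 2) := by positivity
  set y := 8 * (B + 2 * Real.pi * B ^ 2)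
  obtain ⟨n₀, hn₀⟩ := hA.exists_resolvent_of_re hw hlim
  obtain ⟨M, U, μ, hμ⟩ := hA.exists_riesz hw hlim
  -- A point above the strip lies in the resolvent set. Since `Re z₀ = 0`, one has `|z₀ - ζ| ≥ |Re
  -- ζ|`, so `(z₀ - ζ)⁻¹` is small for `ζ` in distant disks.
  set z₀ : ℂ := ((y + 1 : ℝ) : ℂ) * Complex.I with hz₀
  have hre : z₀.re = 0 := by simp [hz₀]
  have him : z₀.im = y + 1 := by simp [hz₀]
  obtain ⟨R, hR⟩ := hA.exists_resolvent_of_im hB.le hw (z := z₀) (by rw [him]; positivity)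
    (by rw [him, abs_of_pos (by positivity)]; linarith)
  have hne : ∀ ζ : ℂ, ∀ n, ‖ζ - ev0 n‖ < 1 / 16 → ζ ≠ z₀ := by
    rintro ζ n h rfl
    have := Complex.abs_im_le_norm (z₀ - ev0 n)
    rw [Complex.sub_im, im_ev0, him, sub_zero, abs_of_pos (by positivity)] at this
    linarith
  set T : H →L[ℂ] H := (U.symm : H →L[ℂ] H) ∘L R ∘L (U : H →L[ℂ] H) with hTdef
  have hTapp : ∀ x, T x = U.symm (R (U x)) := fun x => rfl
  set ρ : ℕ → ℂ := fun k => (z₀ - μ k)⁻¹ with hρdef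
  have hRU : ∀ k ≥ M, R (U (e k)) = ρ k • U (e k) := by
    intro k hk
    obtain ⟨h1, h2, h3⟩ := hμ k hk
    exact hR.apply_eq_smul (hne _ _ h1) h2 h3
  have hρ : ∀ k ≥ M, T (e k) = ρ k • e k := by
    intro k hk
    rw [hTapp, hRU k hk, map_smul, U.symm_apply_apply]
  have hRrange : DenseRange R := by
    have he : ∀ k, e k ∈ Set.range R := by
      intro k
      have hd : e k ∈ A.domain := by
        rw [hA.mem_domain]
        refine ⟨(2 * k + 1 : ℂ) • e k, fun j => ?_⟩
        rw [inner_smul_right, inner_basis_basis]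
        split_ifs with h
        · subst h; ring
        · ring
      exact ⟨_, hR.2 ⟨e k, hd⟩⟩
    have hsub : (Submodule.span ℂ (Set.range e) : Set H) ⊆ Set.range R := by
      have : Submodule.span ℂ (Set.range e) ≤ LinearMap.range (R : H →ₗ[ℂ] H) := by
        rw [Submodule.span_le]
        rintro _ ⟨k, rfl⟩
        exact he k
      exact this
    have hd : Dense (Submodule.span ℂ (Set.range e) : Set H) := by
      rw [Submodule.dense_iff_topologicalClosure_eq_top]
      exact e.dense_span
    exact hd.mono hsub
  have hT : DenseRange T :=
    (U.symm.surjective.denseRange.comp hRrange U.symm.continuous).comp U.surjective.denseRange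
      (U.symm.continuous.comp R.continuous)
  obtain ⟨η, hη, hq⟩ := exists_annihilating_polynomial e hT hρ
  obtain ⟨N₁, hN₁⟩ := eventually_atTop.1 (tendsto_one_div_add_half.eventually_lt_const hη)
  -- Past `N₁` the map `ζ ↦ (z₀ - ζ)⁻¹` sends the disks into the ball of radius `η`, where `q` has
  -- no roots other than `ρ k`, `M ≤ k < N`.
  set N := max M (max n₀ N₁)
  have hNM : M ≤ N := le_max_left _ _
  have hNn : n₀ ≤ N := (le_max_left _ _).trans (le_max_right _ _)
  have hNN : N₁ ≤ N := (le_max_right _ _).trans (le_max_right _ _)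
  have hsmall : ∀ n ≥ N, ∀ ζ : ℂ, ‖ζ - ev0 n‖ < 1 / 16 → ‖(z₀ - ζ)⁻¹‖ < η := fun n hn ζ hζ =>
    (norm_inv_sub_le hre hζ).trans_lt (hN₁ n (hNN.trans hn))
  have hdisj : ∀ n ≥ N, ∀ ζ : ℂ, ‖ζ - ev0 n‖ < 1 / 16 →
      ∀ k, M ≤ k → k < N → (z₀ - ζ)⁻¹ ≠ ρ k := by
    intro n hn ζ hζ k hk hkN h
    have h1 : ζ = μ k := by
      have := inv_injective h
      exact sub_right_injective this
    rw [h1] at hζ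
    have := eq_of_norm_sub_ev0_lt hζ (hμ k hk).1
    omega
  have hlimρ : Tendsto ρ atTop (𝓝 0) := by
    refine squeeze_zero_norm' ?_ tendsto_one_div_add_half
    filter_upwards [eventually_ge_atTop M] with k hk
    exact norm_inv_sub_le hre (hμ k hk).1
  obtain ⟨q, hqann, hqroot⟩ := hq N hNM
  have hq0 : q.eval 0 ≠ 0 := by
    refine hqroot 0 (by simpa using hη) fun k hk _ h => ?_
    exact inv_ne_zero (sub_ne_zero.2 (hne _ _ (hμ k hk).1).symm) h.symm
  have hρN : ∀ k ≥ N, T (e k) = ρ k • e k := fun k hk => hρ k (hNM.trans hk)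
  have hqρ : ∀ k ≥ N, q.eval (ρ k) ≠ 0 := fun k hk =>
    hqroot _ (hsmall k hk _ (hμ k (hNM.trans hk)).1) (hdisj k hk _ (hμ k (hNM.trans hk)).1)
  obtain ⟨Q, hQ1, hQ2, hQ3, hQ4⟩ := exists_projection_ker_aeval e hρN hlimρ hqann hq0 hqρ
  obtain ⟨β, c, hβ1, hβ2, hβ3, hβ4⟩ := exists_root_basis_ker_aeval e hQ1 hQ2 hQ3 hQ4
  obtain ⟨W, hW1, hW2⟩ := exists_equiv_of_independent_mod e β hβ4
  have hqc : ∀ i, q.eval (c i) = 0 := fun i => by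
    obtain ⟨m, hm⟩ := hβ3 i
    exact eval_eq_zero_of_root (hβ2 i) (hβ1 i) hm
  have hc0 : ∀ i, c i ≠ 0 := fun i h => hq0 (h ▸ hqc i)
  have hinv : ∀ d : ℂ, (z₀ - (z₀ - d⁻¹))⁻¹ = d := fun d => by rw [sub_sub_cancel, inv_inv]
  -- The number `c` belongs to the resolvent at `z₀`; the matching `λ` for `A` solves `(z₀ - λ)⁻¹ =
  -- c`.
  set ev : ℕ → ℂ := fun k => if h : k < N then z₀ - (c ⟨k, h⟩)⁻¹ else μ k with hev
  have ev_lt : ∀ k (h : k < N), ev k = z₀ - (c ⟨k, h⟩)⁻¹ := fun k h => dif_pos h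
  have ev_ge : ∀ k, N ≤ k → ev k = μ k := fun k h => dif_neg (not_lt.2 h)
  refine ⟨N, W.trans U, ev, z₀, R, ⟨hR, fun k => ?_, fun k => ?_, fun k hk => ?_, fun k hk => ?_,
    fun k hk n hn => ?_⟩, fun z hz => ?_⟩
  · rcases lt_or_ge k N with h | h
    · rw [ev_lt k h]
      intro h0
      exact inv_ne_zero (hc0 _) (sub_eq_self.1 h0)
    · rw [ev_ge k h]
      exact hne _ _ (hμ k (hNM.trans h)).1
  · rcases lt_or_ge k N with h | h
    · obtain ⟨m, hm⟩ := hβ3 ⟨k, h⟩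
      refine ⟨m, ?_⟩
      rw [ev_lt k h, hinv, ContinuousLinearEquiv.trans_apply, pow_conj_apply, hW1 ⟨k, h⟩, hm,
        map_zero]
    · refine ⟨1, ?_⟩
      rw [ev_ge k h, pow_one, ContinuousLinearEquiv.trans_apply, hW2 k h, _root_.sub_apply,
        hRU k (hNM.trans h), _root_.smul_apply, one_apply_eq_self, sub_self]
  · rw [ev_ge k hk]
    exact (hμ k (hNM.trans hk)).1
  · rw [ev_ge k hk, ContinuousLinearEquiv.trans_apply, hW2 k hk]
    exact hRU k (hNM.trans hk)
  -- A value `ev k`, `k < N`, inside a disk of index `n ≥ N` would make `c` a root of `q` where `q`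
  -- has none.
  · by_contra! hlt
    have h1 := hqroot _ (hsmall n hn _ hlt) (hdisj n hn _ hlt)
    rw [ev_lt k hk, hinv] at h1
    exact h1 (hqc _)
  · by_contra hzS
    rw [Set.mem_union, not_or] at hzS
    obtain ⟨hbox, hdisk⟩ := hzS
    refine hz ?_
    rcases le_or_gt y |z.im| with h | h
    · exact hA.exists_resolvent_of_im hB.le hw (abs_pos.1 (hY.trans_le h)) h
    · refine hn₀ N hNn z (by by_contra! h2; exact hbox ⟨h2, h⟩) fun k hk => ?_
      by_contra! h2
      refine hdisk (Set.mem_biUnion (show k ∈ Set.Ici N from hk) ?_)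
      rwa [Metric.mem_ball, dist_eq_norm]

end

theorem MemV.exists_rootSystem {b : ℝ → ℂ} (hb : MemV b) :
    ∃ (N : ℕ) (V : H ≃L[ℂ] H) (ev : ℕ → ℂ) (z₀ : ℂ) (R : H →L[ℂ] H),
      IsRootSystem (L b) hermiteBasis N V ev z₀ R ∧ Sp (L b) ⊆ S b N := by
  rcases ((norm_nonneg _).trans (hb.norm_image_le 0)).eq_or_lt with h0 | h0
  -- If `normV b = 0` then `Y b = 0` and the box is empty, so `N = 0` has to be taken. All `w k`
  -- vanish and the Hermite functions themselves are the eigenvectors.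
  · have hA := hb.isDiagPerturbation
    have hw : ∀ k, hb.image k = 0 := fun k =>
      norm_le_zero_iff.1 ((hb.norm_image_le k).trans h0.symm.le)
    have hres : ∀ z, (∀ k, z ≠ ev0 k) → ∃ R, IsResolventAt (L b) z R := fun z hz =>
      hA.exists_resolvent hz le_rfl one_pos (by simp [hw, summable_zero]) (by simp [hw])
    obtain ⟨R, hR⟩ := hres Complex.I fun k h => by
      have := congrArg Complex.im h
      simp [im_ev0] at this
    have hne : ∀ k, ev0 k ≠ Complex.I := fun k h => by
      have := congrArg Complex.im h
      simp [im_ev0] at this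
    have hg : ∀ k j : ℕ, inner ℂ (hermiteBasis j) (ev0 k • hermiteBasis k) =
        (2 * j + 1) * inner ℂ (hermiteBasis j) (hermiteBasis k) := by
      intro k j
      rw [inner_smul_right, inner_basis_basis]
      split_ifs with h
      · subst h; simp [ev0]
      · ring
    have heig : ∀ k, R (hermiteBasis k) = (Complex.I - ev0 k)⁻¹ • hermiteBasis k := by
      intro k
      have hd : hermiteBasis k ∈ (L b).domain := (hA.mem_domain _).2 ⟨_, hg k⟩
      refine hR.apply_eq_smul (hne k) hd ?_
      have := hA.hasSum_apply ⟨_, hd⟩ _ (hg k)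
      simp only [hw, smul_zero] at this
      exact sub_eq_zero.1 (this.unique hasSum_zero)
    refine ⟨0, ContinuousLinearEquiv.refl ℂ H, ev0, Complex.I, R,
      ⟨hR, hne, fun k => ⟨1, ?_⟩, fun k _ => by simp, fun k _ => heig k,
        fun k hk => absurd hk (Nat.not_lt_zero k)⟩, fun z hz => ?_⟩
    · simp [heig k]
    · obtain ⟨k, hk⟩ : ∃ k, z = ev0 k := by
        by_contra! h
        exact hz (hres z h)
      refine Or.inr (Set.mem_biUnion (show k ∈ Set.Ici 0 from Nat.zero_le k) ?_)
      rw [hk]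
      exact Metric.mem_ball_self (by norm_num)
  · exact hb.isDiagPerturbation.exists_rootSystem h0 hb.norm_image_le hb.tendsto_norm_image

end

/-! ### Root vectors of an operator with a diagonal tail. -/

section

section

variable {E : Type*} [NormedAddCommGroup E] [InnerProductSpace ℂ E]

open Polynomial in
theorem inner_aeval_of_tail (e : HilbertBasis ℕ ℂ E) {T : E →L[ℂ] E} {N : ℕ} {ρ : ℕ → ℂ}
    (hρ : ∀ k ≥ N, T (e k) = ρ k • e k) (p : ℂ[X]) {f : E} (hf : ∀ k < N, inner ℂ (e k) f = 0)
    (j : ℕ) : inner ℂ (e j) (aeval T p f) = p.eval (ρ j) * inner ℂ (e j) f := by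
  have h := (innerSL ℂ (e j)).hasSum (hasSum_clm_apply e (aeval T p) f)
  refine h.unique ?_
  have : (fun k => innerSL ℂ (e j) (inner ℂ (e k) f • aeval T p (e k))) =
      fun k => if k = j then p.eval (ρ j) * inner ℂ (e j) f else 0 := by
    funext k
    rcases lt_or_ge k N with hk | hk
    · rw [hf k hk, zero_smul, map_zero]
      split_ifs with hkj
      · rw [← hkj, hf k hk, mul_zero]
      · rfl
    · rw [aeval_apply_of_eq_smul (hρ k hk), innerSL_apply_apply, inner_smul_right,
        inner_smul_right, inner_basis_basis]
      split_ifs with h1 h2 h2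
      · subst h1; ring
      · exact absurd h1.symm h2
      · exact absurd h2.symm h1
      · simp
  change HasSum (fun k => innerSL ℂ (e j) (inner ℂ (e k) f • aeval T p (e k))) _
  rw [this]
  exact hasSum_ite_eq j _

theorem pow_apply_eq_zero_of_le {T : E →L[ℂ] E} {x : E} {m n : ℕ} (h : (T ^ m) x = 0)
    (hmn : m ≤ n) : (T ^ n) x = 0 := by
  rw [← Nat.sub_add_cancel hmn, pow_add, mul_apply_eq_comp, h, map_zero]

open Polynomial in
/-- For an operator with a Hilbert basis of root vectors, almost all of which are eigenvectors, the
root subspaces are spanned by basis vectors. -/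
theorem mem_span_of_pow_apply_eq_zero (e : HilbertBasis ℕ ℂ E) {T : E →L[ℂ] E} {N : ℕ}
    {ρ : ℕ → ℂ} (hroot : ∀ k, ∃ m, ((T - ρ k • (1 : E →L[ℂ] E)) ^ m) (e k) = 0)
    (hρ : ∀ k ≥ N, T (e k) = ρ k • e k) {c : ℂ} (hfin : {k | ρ k = c}.Finite) {m : ℕ} {f : E}
    (hf : ((T - c • (1 : E →L[ℂ] E)) ^ m) f = 0) : f ∈ Submodule.span ℂ (e '' {k | ρ k = c}) := by
  classical
  set s := (Finset.range N).filter fun k => ρ k = c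
  set t := (Finset.range N).filter fun k => ρ k ≠ c
  choose n hn using hroot
  set f₁ := ∑ k ∈ s, (inner ℂ (e k) f : ℂ) • e k
  set f₂ := ∑ k ∈ t, (inner ℂ (e k) f : ℂ) • e k
  have hf₁ : f₁ ∈ Submodule.span ℂ (e '' {k | ρ k = c}) :=
    Submodule.sum_mem _ fun k hk => Submodule.smul_mem _ _
      (Submodule.subset_span ⟨k, (Finset.mem_filter.1 hk).2, rfl⟩)
  suffices h : f - f₁ ∈ Submodule.span ℂ (e '' {k | ρ k = c}) by
    simpa using Submodule.add_mem _ h hf₁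
  obtain ⟨M, hM⟩ : ∃ M, ((T - c • (1 : E →L[ℂ] E)) ^ M) (f - f₁) = 0 := by
    refine ⟨m + ∑ k ∈ s, n k, ?_⟩
    rw [map_sub, pow_apply_eq_zero_of_le hf (Nat.le_add_right _ _), map_sum, zero_sub, neg_eq_zero]
    refine Finset.sum_eq_zero fun k hk => ?_
    rw [map_smul, pow_apply_eq_zero_of_le (m := n k), smul_zero]
    · rw [← (Finset.mem_filter.1 hk).2]; exact hn k
    · exact (Finset.single_le_sum (fun _ _ => Nat.zero_le _) hk).trans (Nat.le_add_left _ _)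
  set g := f - f₁ - f₂
  have hg : ∀ k < N, inner ℂ (e k) g = 0 := by
    intro k hk
    have hsum : f₁ + f₂ = ∑ k ∈ Finset.range N, (inner ℂ (e k) f : ℂ) • e k :=
      Finset.sum_filter_add_sum_filter_not _ _ _
    have : g = f - ∑ k ∈ Finset.range N, (inner ℂ (e k) f : ℂ) • e k := by rw [← hsum, ← sub_sub]
    rw [this, inner_sub_right, inner_sum]
    simp_rw [inner_smul_right, inner_basis_basis]
    simp [hk]
  -- `p(T)` kills `f₂`, and `p` is coprime to `(X - c)^M`, whose value at `T` kills `f - f₁`. By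
  -- Bézout, `f - f₁` is the image of `g` under a polynomial in `T`, so it lies in the tail, where
  -- `T` is diagonal.
  set p : ℂ[X] := ∏ k ∈ t, (X - C (ρ k)) ^ n k
  have hp₂ : aeval T p f₂ = 0 := by
    rw [map_sum]
    refine Finset.sum_eq_zero fun k hk => ?_
    have : p = (∏ j ∈ t.erase k, (X - C (ρ j)) ^ n j) * (X - C (ρ k)) ^ n k :=
      (Finset.prod_erase_mul _ _ hk).symm
    rw [map_smul, this, map_mul, mul_apply_eq_comp, map_pow, ← sub_smul_one_eq_aeval, hn k,
      map_zero, smul_zero]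
  have hcop : IsCoprime ((X - C c) ^ M : ℂ[X]) p := by
    refine IsCoprime.prod_right fun k hk => IsCoprime.pow ?_
    exact isCoprime_X_sub_C_of_isUnit_sub
      (sub_ne_zero.2 (Finset.mem_filter.1 hk).2.symm).isUnit
  obtain ⟨u, v, huv⟩ := hcop
  have hX : aeval T ((X - C c) ^ M : ℂ[X]) (f - f₁) = 0 := by
    rw [map_pow, ← sub_smul_one_eq_aeval, hM]
  have hf' : f - f₁ = aeval T (v * p) g := by
    have h1 : aeval T (u * (X - C c) ^ M + v * p) (f - f₁) = f - f₁ := by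
      rw [huv, map_one, one_apply_eq_self]
    have h2 : aeval T p (f - f₁) = aeval T p g := by
      have : f - f₁ = g + f₂ := by simp [g]
      rw [this, map_add, hp₂, add_zero]
    rw [map_add, _root_.add_apply, map_mul, mul_apply_eq_comp, hX, map_zero, zero_add, map_mul,
      mul_apply_eq_comp, h2] at h1
    rw [← h1, map_mul, mul_apply_eq_comp]
  have htail : ∀ k < N, inner ℂ (e k) (f - f₁) = 0 := fun k hk => by
    rw [hf', inner_aeval_of_tail e hρ _ hg, hg k hk, mul_zero]
  have hcoord : ∀ k, ρ k ≠ c → inner ℂ (e k) (f - f₁) = 0 := by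
    intro k hk
    have h1 := inner_aeval_of_tail e hρ ((X - C c) ^ M) htail k
    rw [hX, inner_zero_right] at h1
    refine (mul_eq_zero.1 h1.symm).resolve_left ?_
    rw [eval_pow, eval_sub, eval_X, eval_C]
    exact pow_ne_zero _ (sub_ne_zero.2 hk)
  have hsum := hasSum_clm_apply e (1 : E →L[ℂ] E) (f - f₁)
  have hsum2 : HasSum (fun k => inner ℂ (e k) (f - f₁) • (1 : E →L[ℂ] E) (e k))
      (∑ k ∈ hfin.toFinset, inner ℂ (e k) (f - f₁) • (1 : E →L[ℂ] E) (e k)) := by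
    refine hasSum_sum_of_ne_finset_zero fun k hk => ?_
    rw [hcoord k (by simpa using hk), zero_smul]
  have heq := hsum.unique hsum2
  rw [one_apply_eq_self] at heq
  rw [heq]
  refine Submodule.sum_mem _ fun k hk => Submodule.smul_mem _ _ (Submodule.subset_span ⟨k, ?_, rfl⟩)
  simpa using hk

end

/-! ### Root subspaces through the resolvent, and what a root system determines. -/

section

variable {A : H →ₗ.[ℂ] H}

theorem mem_rootKer_succ {μ : ℂ} {n : ℕ} {x : H} : x ∈ rootKer A μ (n + 1) ↔
    ∃ hx : x ∈ A.domain, A ⟨x, hx⟩ - μ • x ∈ rootKer A μ n := by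
  rw [rootKer, Submodule.mem_map]
  constructor
  · rintro ⟨⟨y, hy⟩, h, rfl⟩
    exact ⟨hy, h⟩
  · rintro ⟨hx, h⟩
    exact ⟨⟨x, hx⟩, h, rfl⟩

theorem IsResolventAt.rootKer_eq_bot {z : ℂ} {R : H →L[ℂ] H} (hR : IsResolventAt A z R) (n : ℕ) :
    rootKer A z n = ⊥ := by
  induction n with
  | zero => rfl
  | succ n ih =>
    rw [eq_bot_iff]
    intro x hx
    obtain ⟨hx, h⟩ := mem_rootKer_succ.1 hx
    rw [ih, Submodule.mem_bot] at h
    have h1 := hR.2 ⟨x, hx⟩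
    rw [← neg_sub, h, neg_zero, map_zero] at h1
    exact h1.symm

theorem IsResolventAt.injective {z : ℂ} {R : H →L[ℂ] H} (hR : IsResolventAt A z R) {f : H}
    (hf : R f = 0) : f = 0 := by
  obtain ⟨h, h1⟩ := hR.1 f
  have h2 : (⟨R f, h⟩ : A.domain) = 0 := Subtype.ext hf
  rw [← h1, h2, hf, smul_zero, LinearPMap.map_zero, sub_zero]

/-- On the domain, `R - ρ = ρ R (A - μ)` with `ρ = (z₀ - μ)⁻¹`, and `R` is injective and commutes
with `S = R - ρ`. The domain condition for a root vector of `R` follows since `x` is a combination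
of `R x` and `S x`, the latter in the domain by induction. -/
theorem IsResolventAt.mem_rootKer_iff {z₀ μ : ℂ} {R : H →L[ℂ] H} (hR : IsResolventAt A z₀ R)
    (hμ : μ ≠ z₀) (n : ℕ) (x : H) :
    x ∈ rootKer A μ n ↔ ((R - (z₀ - μ)⁻¹ • (1 : H →L[ℂ] H)) ^ n) x = 0 := by
  have hne : z₀ - μ ≠ 0 := sub_ne_zero.2 hμ.symm
  set ρ := (z₀ - μ)⁻¹ with hρ
  have hρ0 : ρ ≠ 0 := inv_ne_zero hne
  set S := R - ρ • (1 : H →L[ℂ] H) with hS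
  have hSapp : ∀ y, S y = R y - ρ • y := fun y => rfl
  have hcomm : ∀ n, R * S ^ n = S ^ n * R := fun n => by
    have h1 : Commute R S := (Commute.refl R).sub_right ((Commute.one_right R).smul_right ρ)
    exact h1.pow_right n
  have hcomm' : ∀ n y, R ((S ^ n) y) = (S ^ n) (R y) := fun n y => by
    have := congrArg (fun T : H →L[ℂ] H => T y) (hcomm n)
    simpa only [mul_apply_eq_comp] using this
  have key : ∀ (x : H) (hx : x ∈ A.domain), S x = ρ • R (A ⟨x, hx⟩ - μ • x) := by
    intro x hx
    have h1 := hR.2 ⟨x, hx⟩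
    have h2 : z₀ • x - A ⟨x, hx⟩ = (z₀ - μ) • x - (A ⟨x, hx⟩ - μ • x) := by
      rw [sub_smul]; abel
    change R (z₀ • x - A ⟨x, hx⟩) = x at h1
    rw [h2, map_sub, map_smul] at h1
    set y := A ⟨x, hx⟩ - μ • x
    rw [hSapp]
    nth_rewrite 2 [← h1]
    rw [smul_sub, smul_smul, hρ, inv_mul_cancel₀ hne, one_smul, sub_sub_cancel]
  induction n generalizing x with
  | zero => simp [rootKer]
  | succ n ih =>
    rw [mem_rootKer_succ, pow_succ, mul_apply_eq_comp]
    constructor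
    · rintro ⟨hx, h⟩
      rw [key x hx, map_smul, ← hcomm', (ih _).1 h, map_zero, smul_zero]
    · intro h
      have hSx : S x ∈ A.domain := by
        cases n with
        | zero =>
          rw [pow_zero, one_apply_eq_self] at h
          rw [h]
          exact zero_mem _
        | succ n => exact (mem_rootKer_succ.1 ((ih _).2 h)).1
      have hx : x ∈ A.domain := by
        have : x = ρ⁻¹ • (R x - S x) := by
          rw [hSapp, sub_sub_cancel, smul_smul, inv_mul_cancel₀ hρ0, one_smul]
        rw [this]
        exact Submodule.smul_mem _ _ (Submodule.sub_mem _ (hR.1 x).1 hSx)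
      refine ⟨hx, (ih _).2 (hR.injective ?_)⟩
      rw [key x hx, map_smul, ← hcomm'] at h
      exact (smul_eq_zero.1 h).resolve_left hρ0

theorem rootKer_mono (μ : ℂ) : Monotone (rootKer A μ) := by
  refine monotone_nat_of_le_succ fun n => ?_
  induction n with
  | zero => exact bot_le
  | succ n ih =>
    intro x hx
    obtain ⟨h1, h2⟩ := mem_rootKer_succ.1 hx
    exact mem_rootKer_succ.2 ⟨h1, ih h2⟩

theorem mem_rootSpace {μ : ℂ} {x : H} : x ∈ rootSpace A μ ↔ ∃ n, x ∈ rootKer A μ n :=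
  Submodule.mem_iSup_of_directed _ (rootKer_mono μ).directed_le

namespace IsRootSystem

variable {e : HilbertBasis ℕ ℂ H} {N : ℕ} {V : H ≃L[ℂ] H} {ev : ℕ → ℂ} {z₀ : ℂ} {R : H →L[ℂ] H}

theorem ev_eq_iff (h : IsRootSystem A e N V ev z₀ R) {k j : ℕ} (hk : N ≤ k) :
    ev j = ev k ↔ j = k := by
  refine ⟨fun hjk => ?_, fun hjk => hjk ▸ rfl⟩
  rcases lt_or_ge j N with hj | hj
  · have := h.far j hj k hk
    rw [hjk] at this
    exact absurd (h.near k hk) (not_lt.2 this)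
  · have h1 := h.near j hj
    rw [hjk] at h1
    exact eq_of_norm_sub_ev0_lt h1 (h.near k hk)

theorem finite_fiber (h : IsRootSystem A e N V ev z₀ R) (μ : ℂ) : {k | ev k = μ}.Finite := by
  by_cases hex : ∃ k ≥ N, ev k = μ
  · obtain ⟨k, hk, rfl⟩ := hex
    refine (Set.finite_singleton k).subset fun j hj => (h.ev_eq_iff hk).1 hj
  · push Not at hex
    refine (Set.finite_lt_nat N).subset fun j hj => ?_
    by_contra hjN
    exact hex j (not_lt.1 hjN) hj

theorem mem_rootSpace (h : IsRootSystem A e N V ev z₀ R) (k : ℕ) :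
    V (e k) ∈ rootSpace A (ev k) := by
  obtain ⟨m, hm⟩ := h.root k
  exact HermitePerturbation.mem_rootSpace.2 ⟨m, (h.resolvent.mem_rootKer_iff (h.ev_ne k) m _).2 hm⟩

/-- Conjugation by `V` turns `R` into an operator whose root vectors form the Hilbert basis `e`, so
`mem_span_of_pow_apply_eq_zero` applies. The point `z₀` has no root vectors and is treated apart. -/
theorem span_eq_rootSpace (h : IsRootSystem A e N V ev z₀ R) (μ : ℂ) :
    Submodule.span ℂ ((fun k => V (e k)) '' {k | ev k = μ}) = rootSpace A μ := by
  refine le_antisymm ?_ fun x hx => ?_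
  · rw [Submodule.span_le]
    rintro _ ⟨k, rfl, rfl⟩
    exact h.mem_rootSpace k
  · obtain ⟨n, hn⟩ := HermitePerturbation.mem_rootSpace.1 hx
    by_cases hμ : μ = z₀
    · rw [hμ, h.resolvent.rootKer_eq_bot, Submodule.mem_bot] at hn
      rw [hn]
      exact zero_mem _
    · rw [h.resolvent.mem_rootKer_iff hμ] at hn
      set T : H →L[ℂ] H := (V.symm : H →L[ℂ] H) ∘L R ∘L (V : H →L[ℂ] H) with hT
      have hρ : ∀ k, (z₀ - ev k)⁻¹ = (z₀ - μ)⁻¹ ↔ ev k = μ := fun k => by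
        rw [inv_inj, sub_right_inj]
      have hmem := mem_span_of_pow_apply_eq_zero e (T := T) (N := N)
        (ρ := fun k => (z₀ - ev k)⁻¹) (c := (z₀ - μ)⁻¹) (m := n) (f := V.symm x)
        (fun k => by
          obtain ⟨m, hm⟩ := h.root k
          refine ⟨m, ?_⟩
          rw [pow_conj_apply] at hm
          exact V.map_eq_zero_iff.1 hm)
        (fun k hk => by
          change V.symm (R (V (e k))) = _
          rw [h.eigen k hk, map_smul, V.symm_apply_apply])
        (by simpa only [hρ] using h.finite_fiber μ)
        (by
          have := pow_conj_apply V R (z₀ - μ)⁻¹ n (V.symm x)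
          rw [V.apply_symm_apply, hn] at this
          exact V.map_eq_zero_iff.1 this.symm)
      simp only [hρ] at hmem
      have h2 := Submodule.mem_map_of_mem (f := (V : H →L[ℂ] H).toLinearMap) hmem
      rw [Submodule.map_span, Set.image_image] at h2
      simpa using h2

theorem linearIndependent (_h : IsRootSystem A e N V ev z₀ R) :
    LinearIndependent ℂ fun k => V (e k) :=
  e.orthonormal.linearIndependent.map' (V : H →L[ℂ] H).toLinearMap
    (LinearMap.ker_eq_bot.2 V.injective)

theorem isSEAF (h : IsRootSystem A e N V ev z₀ R) : IsSEAF A fun k => V (e k) :=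
  ⟨ev, fun μ => ⟨h.linearIndependent.linearIndepOn _, h.span_eq_rootSpace μ⟩⟩

theorem exists_of_isEigenvalue (h : IsRootSystem A e N V ev z₀ R) {μ : ℂ}
    (hμ : IsEigenvalue A μ) : ∃ k, ev k = μ := by
  obtain ⟨⟨u, hu⟩, hu0, hAu⟩ := hμ
  by_contra! hne
  have h1 : u ∈ rootSpace A μ := HermitePerturbation.mem_rootSpace.2
    ⟨1, mem_rootKer_succ.2 ⟨hu, by rw [hAu, sub_self]; exact zero_mem _⟩⟩
  rw [← h.span_eq_rootSpace, (Set.eq_empty_iff_forall_notMem.2 hne : {k | ev k = μ} = ∅),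
    Set.image_empty, Submodule.span_empty, Submodule.mem_bot] at h1
  exact hu0 h1

theorem basis_ne_zero (h : IsRootSystem A e N V ev z₀ R) (k : ℕ) : V (e k) ≠ 0 :=
  h.linearIndependent.ne_zero k

theorem isEigenvalue (h : IsRootSystem A e N V ev z₀ R) {k : ℕ} (hk : N ≤ k) :
    IsEigenvalue A (ev k) := by
  have : V (e k) ∈ rootKer A (ev k) 1 := by
    rw [h.resolvent.mem_rootKer_iff (h.ev_ne k), pow_one, _root_.sub_apply, h.eigen k hk]
    simp
  obtain ⟨h1, h2⟩ := mem_rootKer_succ.1 this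
  exact ⟨⟨_, h1⟩, h.basis_ne_zero k, sub_eq_zero.1 h2⟩

theorem mem_Sp (h : IsRootSystem A e N V ev z₀ R) (k : ℕ) : ev k ∈ Sp A := by
  rintro ⟨R', hR'⟩
  obtain ⟨n, hn⟩ := HermitePerturbation.mem_rootSpace.1 (h.mem_rootSpace k)
  rw [hR'.rootKer_eq_bot] at hn
  exact h.basis_ne_zero k hn

theorem localizes {b : ℝ → ℂ} (h : IsRootSystem (L b) e N V ev z₀ R) (hS : Sp (L b) ⊆ S b N) :
    Localizes b N := by
  refine ⟨hS, fun n hn => ⟨ev n, ⟨?_, h.isEigenvalue hn⟩, fun μ ⟨hμ, hμ'⟩ => ?_⟩⟩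
  · rw [Metric.mem_ball, dist_eq_norm]
    exact h.near n hn
  · rw [Metric.mem_ball, dist_eq_norm] at hμ
    obtain ⟨k, rfl⟩ := h.exists_of_isEigenvalue hμ'
    rcases lt_or_ge k N with hk | hk
    · exact absurd hμ (not_lt.2 (h.far k hk n hn))
    · rw [eq_of_norm_sub_ev0_lt (h.near k hk) hμ]

end IsRootSystem

end

end

/-! ### Arbitrary systems of eigen- and associated functions. -/

section

/-- The scalars need no bounds: the dual functionals carry `(a k)⁻¹`, so every term of the expansion
is a term of the Riesz basis expansion. This matters because a system need not be normalized. -/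
theorem exists_unconditionalSchauderBasis (V : H ≃L[ℂ] H) (e : HilbertBasis ℕ ℂ H) (σ : ℕ ≃ ℕ)
    {a : ℕ → ℂ} (ha : ∀ k, a k ≠ 0) {φ : ℕ → H} (hφ : ∀ k, φ k = a k • V (e (σ k))) :
    ∃ β : UnconditionalSchauderBasis ℕ ℂ H, β.basis = φ := by
  classical
  refine ⟨⟨φ, fun k => (a k)⁻¹ • (innerSL ℂ (e (σ k))) ∘L (V.symm : H →L[ℂ] H), fun i j => ?_,
    fun x => ?_⟩, rfl⟩
  · rw [hφ j, map_smul]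
    simp only [_root_.smul_apply, ContinuousLinearMap.comp_apply, ContinuousLinearEquiv.coe_coe,
      V.symm_apply_apply, innerSL_apply_apply, inner_basis_basis, Pi.single_apply,
      σ.injective.eq_iff]
    split_ifs with h
    · subst h
      simp [ha]
    · simp
  · have h := hasSum_clm_apply e (V : H →L[ℂ] H) (V.symm x)
    rw [← σ.hasSum_iff] at h
    have h2 : (V : H →L[ℂ] H) (V.symm x) = x := V.apply_symm_apply x
    rw [h2] at h
    convert! h using 1
    funext k
    simp only [_root_.smul_apply, ContinuousLinearMap.comp_apply, ContinuousLinearEquiv.coe_coe,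
      innerSL_apply_apply, Function.comp_apply]
    rw [hφ k, smul_eq_mul, smul_smul, mul_comm (a k)⁻¹, mul_assoc, inv_mul_cancel₀ (ha k), mul_one]

theorem exists_equiv_comp_eq {α ι κ : Type*} {f : ι → α} {g : κ → α}
    (h : ∀ y, Nonempty ({x // g x = y} ≃ {x // f x = y})) : ∃ σ : κ ≃ ι, ∀ k, f (σ k) = g k := by
  let F := fun y => Classical.choice (h y)
  refine ⟨(Equiv.sigmaFiberEquiv g).symm.trans
    ((Equiv.sigmaCongrRight F).trans (Equiv.sigmaFiberEquiv f)), fun k => ?_⟩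
  exact (F (g k) ⟨k, rfl⟩).2

theorem nonempty_equiv_of_span_eq {E ι κ : Type*} [AddCommGroup E] [Module ℂ E] {φ : ι → E}
    {ψ : κ → E} {s : Set ι} {t : Set κ} (hs : LinearIndepOn ℂ φ s) (ht : LinearIndepOn ℂ ψ t)
    (h : Submodule.span ℂ (φ '' s) = Submodule.span ℂ (ψ '' t)) : Nonempty (s ≃ t) := by
  let b₁ := Module.Basis.span (v := fun x : s => φ x) hs
  let b₂ := Module.Basis.span (v := fun x : t => ψ x) ht
  rw [Set.image_eq_range, Set.image_eq_range] at h
  exact ⟨(b₁.map (LinearEquiv.ofEq _ _ h)).indexEquiv b₂⟩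

/-- Every system of eigen- and associated functions is an unconditional basis, if one of them is a
Riesz basis as in `IsRootSystem`. -/
theorem IsRootSystem.exists_basis_of_isSEAF {A : H →ₗ.[ℂ] H} {e : HilbertBasis ℕ ℂ H} {N : ℕ}
    {V : H ≃L[ℂ] H} {ev : ℕ → ℂ} {z₀ : ℂ} {R : H →L[ℂ] H} (h : IsRootSystem A e N V ev z₀ R)
    {φ : ℕ → H} (hφ : IsSEAF A φ) :
    ∃ β : UnconditionalSchauderBasis ℕ ℂ H, β.basis = φ := by
  obtain ⟨ev', hev'⟩ := hφ
  -- Over each `μ` both fibres index bases of the same root space; the bijections of fibres are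
  -- glued.
  obtain ⟨σ, hσ⟩ : ∃ σ : ℕ ≃ ℕ, ∀ k, ev (σ k) = ev' k := exists_equiv_comp_eq fun μ =>
    nonempty_equiv_of_span_eq (s := {k | ev' k = μ}) (t := {k | ev k = μ}) (hev' μ).1
      (h.linearIndependent.linearIndepOn _)
      ((hev' μ).2.trans (h.span_eq_rootSpace μ).symm)
  set ψ : ℕ → H := fun j => φ (σ.symm j) with hψ
  have hspan : ∀ μ, Submodule.span ℂ (ψ '' {j | ev j = μ}) =
      Submodule.span ℂ ((fun k => V (e k)) '' {j | ev j = μ}) := by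
    intro μ
    rw [h.span_eq_rootSpace, ← (hev' μ).2]
    congr 1
    ext x
    constructor
    · rintro ⟨j, hj, rfl⟩
      exact ⟨σ.symm j, by rw [Set.mem_ofPred_eq, ← hσ, σ.apply_symm_apply]; exact hj, rfl⟩
    · rintro ⟨k, hk, rfl⟩
      exact ⟨σ k, by rw [Set.mem_ofPred_eq, hσ]; exact hk, by simp [hψ]⟩
  have hψ0 : ∀ j, ψ j ≠ 0 := fun j =>
    (hev' (ev' (σ.symm j))).1.ne_zero (i := σ.symm j) rfl
  have hmem : ∀ j, ψ j ∈ Submodule.span ℂ ((fun k => V (e k)) '' {i | ev i = ev j}) := fun j => by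
    rw [← hspan]
    exact Submodule.subset_span ⟨j, rfl, rfl⟩
  have hlt : ∀ j < N, ∀ i, ev i = ev j → i < N := fun j hj i hij => by
    by_contra hi
    have := (h.ev_eq_iff (not_lt.1 hi)).1 hij.symm
    omega
  have hsingle : ∀ j ≥ N, ∃ a : ℂ, a • V (e j) = ψ j := fun j hj => by
    have h1 := hmem j
    have h2 : {i | ev i = ev j} = {j} := by
      ext i; exact h.ev_eq_iff hj
    rwa [h2, Set.image_singleton, Submodule.mem_span_singleton] at h1
  choose! a ha using hsingle
  let v₁ : Fin N → H := fun i => V (e i)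
  let v₂ : Fin N → H := fun i => ψ i
  have hspan2 : Submodule.span ℂ (Set.range v₂) = Submodule.span ℂ (Set.range v₁) := by
    refine le_antisymm ?_ ?_
    · rw [Submodule.span_le]
      rintro _ ⟨j, rfl⟩
      refine Submodule.span_mono ?_ (hmem j)
      rintro _ ⟨i, hi, rfl⟩
      exact ⟨⟨i, hlt j j.2 i hi⟩, rfl⟩
    · rw [Submodule.span_le]
      rintro _ ⟨j, rfl⟩
      have h1 : V (e j) ∈ Submodule.span ℂ (ψ '' {i | ev i = ev j}) := by
        rw [hspan]
        exact Submodule.subset_span ⟨j, rfl, rfl⟩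
      refine Submodule.span_mono ?_ h1
      rintro _ ⟨i, hi, rfl⟩
      exact ⟨⟨i, hlt j j.2 i hi⟩, rfl⟩
  have hli₁ : LinearIndependent ℂ v₁ :=
    h.linearIndependent.comp (fun i : Fin N => (i : ℕ)) Fin.val_injective
  have hli₂ : LinearIndependent ℂ v₂ := by
    rw [linearIndependent_iff_card_eq_finrank_span] at hli₁ ⊢
    rw [hli₁, Set.finrank, Set.finrank, hspan2]
  -- Fibres that meet the indices below `N` stay below `N`. So the vectors `V⁻¹ ψ i`, `i < N`, are
  -- independent in the span of the first `N` basis vectors, and only a finite block changes.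
  obtain ⟨W, hW1, hW2⟩ := exists_equiv_of_independent_mod e (N := N) (fun i => V.symm (ψ i))
    (fun c hc => by
      have hx : ∀ k ≥ N, inner ℂ (e k) (∑ i, c i • V.symm (ψ i)) = 0 := by
        intro k hk
        rw [inner_sum]
        refine Finset.sum_eq_zero fun i _ => ?_
        rw [inner_smul_right]
        have h1 := Submodule.mem_map_of_mem (f := (V.symm : H →L[ℂ] H).toLinearMap) (hmem i)
        rw [Submodule.map_span, Set.image_image] at h1
        have h2 : Submodule.span ℂ ((fun k => V.symm (V (e k))) '' {j | ev j = ev i}) ≤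
            LinearMap.ker (innerSL ℂ (e k)).toLinearMap := by
          rw [Submodule.span_le]
          rintro _ ⟨j, hj, rfl⟩
          have : k ≠ j := fun hkj => by
            have := hlt i i.2 j hj
            omega
          simp [inner_basis_basis, this]
        have h3 : inner ℂ (e k) (V.symm (ψ i)) = 0 := h2 h1
        rw [h3, mul_zero]
      have h0 : ∑ i, c i • V.symm (ψ i) = 0 := ext_inner_basis e fun k => by
        rw [inner_zero_right]
        rcases lt_or_ge k N with hk | hk
        exacts [hc k hk, hx k hk]
      have h4 : ∑ i, c i • v₂ i = 0 := by
        have := congrArg V h0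
        simpa [map_sum] using this
      funext i
      exact Fintype.linearIndependent_iff.1 hli₂ c h4 i)
  refine exists_unconditionalSchauderBasis (W.trans V) e σ
    (a := fun k => if σ k < N then 1 else a (σ k)) (fun k => ?_) fun k => ?_
  · split_ifs with hk
    · exact one_ne_zero
    · intro h0
      have := ha (σ k) (not_lt.1 hk)
      rw [h0, zero_smul] at this
      exact hψ0 _ this.symm
  · have hk' : φ k = ψ (σ k) := by simp [hψ]
    rw [ContinuousLinearEquiv.trans_apply, hk']
    split_ifs with hk
    · rw [one_smul, hW1 ⟨σ k, hk⟩, V.apply_symm_apply]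
    · rw [hW2 _ (not_lt.1 hk), ha _ (not_lt.1 hk)]

end

/-! ### Contour integrals of the resolvent on root vectors. -/

section

section

variable {A : H →ₗ.[ℂ] H}

theorem isResolventAt_resolv {z : ℂ} (hz : z ∉ Sp A) : IsResolventAt A z (resolv A z) := by
  have h : ∃ R, IsResolventAt A z R := not_not.1 hz
  rw [resolv, dif_pos h]
  exact h.choose_spec

theorem resolv_mul {z w : ℂ} (hz : z ∉ Sp A) (hw : w ∉ Sp A) :
    resolv A z * (1 + (z - w) • resolv A w) = resolv A w := by
  ext1 f
  obtain ⟨h1, h2⟩ := (isResolventAt_resolv hw).1 f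
  have h3 := (isResolventAt_resolv hz).2 ⟨_, h1⟩
  simp only [mul_apply_eq_comp, _root_.add_apply, one_apply_eq_self, _root_.smul_apply]
  refine Eq.trans (congrArg _ ?_) h3
  change f + (z - w) • resolv A w f = z • resolv A w f - A ⟨resolv A w f, h1⟩
  rw [sub_smul]
  nth_rewrite 1 [← h2]
  abel

/-- The resolvent identity gives `R(z) = R(w) (1 + (z - w) R(w))⁻¹` near `w`. Continuity suffices
for the integrals, since explicit primitives are available on root vectors. -/
theorem continuousOn_resolv : ContinuousOn (resolv A) (Sp A)ᶜ := by
  intro w hw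
  have h1 : Tendsto (fun z : ℂ => 1 + (z - w) • resolv A w) (𝓝 w) (𝓝 1) := by
    have : Continuous fun z : ℂ => 1 + (z - w) • resolv A w := by fun_prop
    simpa using this.tendsto w
  have h2 : ∀ᶠ z in 𝓝 w, IsUnit (1 + (z - w) • resolv A w) :=
    h1.eventually (Units.isOpen.mem_nhds isUnit_one)
  have h3 : Tendsto (fun z : ℂ => resolv A w * Ring.inverse (1 + (z - w) • resolv A w)) (𝓝 w)
      (𝓝 (resolv A w)) := by
    have := ((NormedRing.inverse_continuousAt (1 : (H →L[ℂ] H)ˣ)).tendsto.comp h1).const_mul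
      (resolv A w)
    simpa [Function.comp_def] using this
  refine (h3.mono_left nhdsWithin_le_nhds).congr' ?_
  filter_upwards [h2.filter_mono nhdsWithin_le_nhds, self_mem_nhdsWithin] with z hz hzS
  nth_rewrite 1 [← resolv_mul hzS hw]
  rw [mul_assoc, Ring.mul_inverse_cancel _ hz, mul_one]

theorem resolv_apply_of_mem_domain {z μ : ℂ} (hz : z ∉ Sp A) (hzμ : z ≠ μ) {f : H}
    (hf : f ∈ A.domain) : resolv A z f = (z - μ)⁻¹ • (f + resolv A z (A ⟨f, hf⟩ - μ • f)) := by
  have h1 := (isResolventAt_resolv hz).2 ⟨f, hf⟩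
  change resolv A z (z • f - A ⟨f, hf⟩) = f at h1
  have h2 : z • f - A ⟨f, hf⟩ = (z - μ) • f - (A ⟨f, hf⟩ - μ • f) := by rw [sub_smul]; abel
  rw [h2, map_sub, map_smul, sub_eq_iff_eq_add] at h1
  exact (eq_inv_smul_iff₀ (sub_ne_zero.2 hzμ)).2 h1

/-- Iterating `R(z) f = (z - μ)⁻¹ (f + R(z) (A - μ) f)` along the chain ends after `n` steps. Only
the simple pole needs its coefficient identified; the higher ones have primitives. -/
theorem exists_resolv_apply_eq {μ : ℂ} (n : ℕ) {f : H} (hf : f ∈ rootKer A μ n) :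
    ∃ g : ℕ → H, ∀ z ∉ Sp A, z ≠ μ → resolv A z f =
      (z - μ)⁻¹ • f + ∑ j ∈ Finset.range n, ((z - μ)⁻¹) ^ (j + 2) • g j := by
  induction n generalizing f with
  | zero =>
    have : f = 0 := hf
    exact ⟨0, fun z _ _ => by simp [this]⟩
  | succ n ih =>
    obtain ⟨hd, h1⟩ := mem_rootKer_succ.1 hf
    obtain ⟨g, hg⟩ := ih h1
    refine ⟨fun j => Nat.casesOn j (A ⟨f, hd⟩ - μ • f) g, fun z hz hzμ => ?_⟩
    rw [resolv_apply_of_mem_domain hz hzμ hd, hg z hz hzμ, Finset.sum_range_succ', smul_add,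
      smul_add, Finset.smul_sum]
    simp only [smul_smul]
    rw [add_comm (∑ j ∈ Finset.range n, _)]
    congr 2
    · rw [zero_add, pow_two]
      rfl
    · refine Finset.sum_congr rfl fun j _ => ?_
      rw [← pow_succ']

theorem hasDerivAt_inv_sub_pow {z μ : ℂ} (hz : z ≠ μ) (j : ℕ) :
    HasDerivAt (fun z => -((j : ℂ) + 1)⁻¹ * ((z - μ)⁻¹) ^ (j + 1)) (((z - μ)⁻¹) ^ (j + 2)) z := by
  have hne : z - μ ≠ 0 := sub_ne_zero.2 hz
  have hj : (j : ℂ) + 1 ≠ 0 := Nat.cast_add_one_ne_zero j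
  have h1 : HasDerivAt (fun z : ℂ => z - μ) 1 z := (hasDerivAt_id z).sub_const μ
  have h2 := ((h1.fun_inv hne).fun_pow (j + 1)).const_mul (-((j : ℂ) + 1)⁻¹)
  convert! h2 using 1
  have h3 : (-1 : ℂ) / (z - μ) ^ 2 = -((z - μ)⁻¹) ^ 2 := by rw [inv_pow, neg_div, one_div]
  have h4 : ((j : ℂ) + 1)⁻¹ * ((j : ℂ) + 1) = 1 := inv_mul_cancel₀ hj
  rw [h3]
  push_cast
  generalize (z - μ)⁻¹ = w
  generalize ((j : ℂ) + 1)⁻¹ = c at h4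
  linear_combination (-w ^ (j + 2)) * h4

theorem exists_primitive_resolv_apply {μ : ℂ} {f : H} (hf : f ∈ rootSpace A μ) :
    ∃ G : ℂ → H, ∀ z ∉ Sp A, z ≠ μ → HasDerivAt G (resolv A z f - (z - μ)⁻¹ • f) z := by
  obtain ⟨n, hn⟩ := mem_rootSpace.1 hf
  obtain ⟨g, hg⟩ := exists_resolv_apply_eq n hn
  refine ⟨fun z => ∑ j ∈ Finset.range n, (-((j : ℂ) + 1)⁻¹ * ((z - μ)⁻¹) ^ (j + 1)) • g j,
    fun z hz hzμ => ?_⟩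
  rw [hg z hz hzμ, add_sub_cancel_left]
  exact HasDerivAt.fun_sum fun j _ => (hasDerivAt_inv_sub_pow hzμ j).smul_const (g j)

theorem continuousOn_resolv_apply (f : H) : ContinuousOn (fun z => resolv A z f) (Sp A)ᶜ :=
  continuousOn_resolv.clm_apply continuousOn_const

/-- The contour integral of the resolvent over a circle, on root vectors. -/
theorem circleIntegral_resolv_apply {c μ : ℂ} {r : ℝ} (hr : 0 ≤ r)
    (hS : ∀ z ∈ Metric.sphere c r, z ∉ Sp A) (hμ : μ ∈ Sp A) {f : H} (hf : f ∈ rootSpace A μ) :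
    (∮ z in C(c, r), resolv A z) f =
      (∮ z in C(c, r), (z - μ)⁻¹) • f := by
  obtain ⟨G, hG⟩ := exists_primitive_resolv_apply hf
  have hne : ∀ z ∈ Metric.sphere c r, z ≠ μ := fun z hz h => hS z hz (h ▸ hμ)
  have hci : CircleIntegrable (resolv A) c r :=
    (continuousOn_resolv.mono fun z hz => hS z hz).circleIntegrable hr
  have h1 : (∮ z in C(c, r), resolv A z) f = ∮ z in C(c, r), resolv A z f := by
    simp only [circleIntegral]
    exact ContinuousLinearMap.intervalIntegral_apply hci.out f
  have h2 : ∮ z in C(c, r), (resolv A z f - (z - μ)⁻¹ • f) = 0 :=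
    circleIntegral.integral_eq_zero_of_hasDerivWithinAt hr fun z hz =>
      (hG z (hS z hz) (hne z hz)).hasDerivWithinAt
  rw [circleIntegral.integral_sub, circleIntegral.integral_smul_const, sub_eq_zero] at h2
  · rw [h1, h2]
  · exact ((continuousOn_resolv_apply f).mono fun z hz => hS z hz).circleIntegrable hr
  · refine ContinuousOn.circleIntegrable hr (ContinuousOn.smul (ContinuousOn.inv₀ (by fun_prop)
      fun z hz => sub_ne_zero.2 (hne z hz)) continuousOn_const)

theorem circleIntegral_inv_sub_eq_zero {c μ : ℂ} {r : ℝ} (hr : 0 ≤ r)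
    (hμ : μ ∉ Metric.closedBall c r) : (∮ z in C(c, r), (z - μ)⁻¹) = 0 := by
  have hne : ∀ z ∈ Metric.closedBall c r, z - μ ≠ 0 := fun z hz h =>
    hμ (sub_eq_zero.1 h ▸ hz)
  refine Complex.circleIntegral_eq_zero_of_differentiable_on_off_countable hr
    Set.countable_empty (ContinuousOn.inv₀ (by fun_prop) hne) fun z hz => ?_
  exact (differentiableAt_id.sub_const μ).inv (hne z (Metric.ball_subset_closedBall hz.1))

end

section

variable {E : Type*} [NormedAddCommGroup E] [NormedSpace ℂ E] [CompleteSpace E]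

theorem integral_horizontal {F P : ℂ → E} {α β y : ℝ}
    (hd : ∀ s ∈ Set.uIcc α β, HasDerivAt P (F (s + y * Complex.I)) (s + y * Complex.I))
    (hF : ContinuousOn (fun s : ℝ => F (s + y * Complex.I)) (Set.uIcc α β)) :
    ∫ s in α..β, F (s + y * Complex.I) = P (β + y * Complex.I) - P (α + y * Complex.I) := by
  refine intervalIntegral.integral_eq_sub_of_hasDerivAt
    (f := fun s : ℝ => P (s + y * Complex.I)) (fun s hs => ?_) hF.intervalIntegrable
  have h1 : HasDerivAt (fun s : ℝ => (s : ℂ) + y * Complex.I) 1 s :=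
    (Complex.ofRealCLM.hasDerivAt (x := s)).add_const _
  simpa [Function.comp_def] using (hd s hs).scomp s h1

theorem integral_vertical {F P : ℂ → E} {α β x : ℝ}
    (hd : ∀ t ∈ Set.uIcc α β, HasDerivAt P (F (x + t * Complex.I)) (x + t * Complex.I))
    (hF : ContinuousOn (fun t : ℝ => F (x + t * Complex.I)) (Set.uIcc α β)) :
    Complex.I • ∫ t in α..β, F (x + t * Complex.I) =
      P (x + β * Complex.I) - P (x + α * Complex.I) := by
  rw [← intervalIntegral.integral_smul]
  refine intervalIntegral.integral_eq_sub_of_hasDerivAt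
    (f := fun t : ℝ => P (x + t * Complex.I)) (fun t ht => ?_)
    (hF.const_smul Complex.I).intervalIntegrable
  have h1 : HasDerivAt (fun t : ℝ => (x : ℂ) + t * Complex.I) Complex.I t := by
    simpa using ((Complex.ofRealCLM.hasDerivAt (x := t)).mul_const Complex.I).const_add (x : ℂ)
  exact (hd t ht).scomp t h1

end

section

variable {A : H →ₗ.[ℂ] H}

theorem log_sub_log_neg_of_im_pos {w : ℂ} (hw : 0 < w.im) :
    Complex.log w - Complex.log (-w) = Real.pi * Complex.I := by
  apply Complex.ext
  · simp [Complex.log_re]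
  · simp [Complex.log_im, Complex.arg_neg_eq_arg_sub_pi_of_im_pos hw]

theorem log_sub_log_neg_of_im_neg {w : ℂ} (hw : w.im < 0) :
    Complex.log w - Complex.log (-w) = -(Real.pi * Complex.I) := by
  apply Complex.ext
  · simp [Complex.log_re]
  · simp [Complex.log_im, Complex.arg_neg_eq_arg_add_pi_of_im_neg hw]

variable {a y : ℝ}

/-- A contour integral over the boundary of `box a y`, with possibly different primitives on the
left side and on the other three. -/
theorem boxIntegral_resolv_apply (ha : 0 ≤ a) (hy : 0 ≤ y)
    (hS : ∀ z : ℂ, |z.re| ≤ a → |z.im| ≤ y → |z.re| = a ∨ |z.im| = y → z ∉ Sp A) {f : H}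
    {P Q : ℂ → H}
    (hP : ∀ z : ℂ, |z.re| ≤ a → |z.im| ≤ y → z.re = a ∨ |z.im| = y →
      HasDerivAt P (resolv A z f) z)
    (hQ : ∀ z : ℂ, z.re = -a → |z.im| ≤ y → HasDerivAt Q (resolv A z f) z) :
    boxIntegral (resolv A) a y f =
      (P (-a + y * Complex.I) - Q (-a + y * Complex.I)) -
        (P (-a - y * Complex.I) - Q (-a - y * Complex.I)) := by
  have hre : ∀ s t : ℝ, ((s : ℂ) + t * Complex.I).re = s := fun s t => by simp
  have him : ∀ s t : ℝ, ((s : ℂ) + t * Complex.I).im = t := fun s t => by simp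
  have hcast : ((-y : ℝ) : ℂ) = -(y : ℂ) := Complex.ofReal_neg y
  have hcast' : ((-a : ℝ) : ℂ) = -(a : ℂ) := Complex.ofReal_neg a
  have hIa : ∀ s ∈ Set.uIcc (-a) a, |s| ≤ a := fun s hs => by
    rw [Set.uIcc_of_le (by linarith)] at hs
    exact abs_le.2 hs
  have hIy : ∀ s ∈ Set.uIcc (-y) y, |s| ≤ y := fun s hs => by
    rw [Set.uIcc_of_le (by linarith)] at hs
    exact abs_le.2 hs
  have chor : ∀ t : ℝ, |t| = y →
      ContinuousOn (fun s : ℝ => resolv A (s + t * Complex.I)) (Set.uIcc (-a) a) := fun t ht => by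
    refine continuousOn_resolv.comp (by fun_prop) fun s hs => hS _ ?_ ?_ ?_
    · rw [hre]; exact hIa s hs
    · rw [him]; exact ht.le
    · rw [him]; exact Or.inr ht
  have cver : ∀ x : ℝ, |x| = a →
      ContinuousOn (fun t : ℝ => resolv A (x + t * Complex.I)) (Set.uIcc (-y) y) := fun x hx => by
    refine continuousOn_resolv.comp (by fun_prop) fun s hs => hS _ ?_ ?_ ?_
    · rw [hre]; exact hx.le
    · rw [him]; exact hIy s hs
    · rw [hre]; exact Or.inl hx
  have hhor : ∀ t : ℝ, |t| = y → (∫ s in (-a)..a, resolv A (s + t * Complex.I)) f =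
      P (a + t * Complex.I) - P (-a + t * Complex.I) := fun t ht => by
    rw [ContinuousLinearMap.intervalIntegral_apply (chor t ht).intervalIntegrable, ← hcast']
    refine integral_horizontal (F := fun z => resolv A z f) (P := P) ?_ ?_
    · intro s hs
      refine hP _ ?_ ?_ ?_
      · rw [hre]; exact hIa s hs
      · rw [him]; exact ht.le
      · rw [him]; exact Or.inr ht
    · exact (chor t ht).clm_apply continuousOn_const
  have hright : Complex.I • (∫ t in (-y)..y, resolv A (a + t * Complex.I)) f =
      P (a + y * Complex.I) - P (a + (-y : ℝ) * Complex.I) := by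
    rw [ContinuousLinearMap.intervalIntegral_apply (cver a (abs_of_nonneg ha)).intervalIntegrable]
    refine integral_vertical (F := fun z => resolv A z f) (P := P) ?_ ?_
    · intro s hs
      refine hP _ ?_ ?_ ?_
      · rw [hre]; exact (abs_of_nonneg ha).le
      · rw [him]; exact hIy s hs
      · rw [hre]; exact Or.inl rfl
    · exact (cver a (abs_of_nonneg ha)).clm_apply continuousOn_const
  have hleft : Complex.I • (∫ t in (-y)..y, resolv A ((-a : ℝ) + t * Complex.I)) f =
      Q ((-a : ℝ) + y * Complex.I) - Q ((-a : ℝ) + (-y : ℝ) * Complex.I) := by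
    have habs : |-a| = a := by rw [abs_neg, abs_of_nonneg ha]
    rw [ContinuousLinearMap.intervalIntegral_apply (cver (-a) habs).intervalIntegrable]
    refine integral_vertical (F := fun z => resolv A z f) (P := Q) ?_ ?_
    · intro s hs
      refine hQ _ ?_ ?_
      · rw [hre]
      · rw [him]; exact hIy s hs
    · exact (cver (-a) habs).clm_apply continuousOn_const
  have hbot := hhor (-y) (by rw [abs_neg, abs_of_nonneg hy])
  have htop := hhor y (abs_of_nonneg hy)
  simp only [hcast, hcast', neg_mul, ← sub_eq_add_neg] at hbot htop hright hleft
  simp only [boxIntegral, _root_.sub_apply, _root_.add_apply, _root_.smul_apply, hbot, htop, hright,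
    hleft]
  abel

/-- The cut of `log (z - μ)` crosses only the left side, where `log (-(z - μ))` replaces it. The two
branches differ by `πi` at the upper left corner and by `-πi` at the lower one, which makes `2πi` in
total. -/
theorem boxIntegral_resolv_apply_of_mem {μ : ℂ}
    (hS : ∀ z : ℂ, |z.re| ≤ a → |z.im| ≤ y → |z.re| = a ∨ |z.im| = y → z ∉ Sp A)
    {f : H} (hf : f ∈ rootSpace A μ) (hμ : μ ∈ box a y) :
    boxIntegral (resolv A) a y f = (2 * Real.pi * Complex.I : ℂ) • f := by
  obtain ⟨h1, h2⟩ := hμ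
  obtain ⟨h3, h4⟩ := abs_lt.1 h1
  obtain ⟨h5, h6⟩ := abs_lt.1 h2
  have ha : 0 < a := (abs_nonneg _).trans_lt h1
  have hy : 0 < y := (abs_nonneg _).trans_lt h2
  obtain ⟨G, hG⟩ := exists_primitive_resolv_apply hf
  rw [boxIntegral_resolv_apply ha.le hy.le hS (P := fun z => Complex.log (z - μ) • f + G z)
    (Q := fun z => Complex.log (-(z - μ)) • f + G z)]
  · have e1 := log_sub_log_neg_of_im_pos (w := -a + y * Complex.I - μ) (by simp; linarith)
    have e2 := log_sub_log_neg_of_im_neg (w := -a - y * Complex.I - μ) (by simp; linarith)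
    rw [add_sub_add_right_eq_sub, add_sub_add_right_eq_sub, ← sub_smul, ← sub_smul, ← sub_smul,
      e1, e2]
    congr 1
    ring
  · intro z hz1 hz2 hz3
    have hslit : z - μ ∈ Complex.slitPlane := by
      rcases hz3 with h | h
      · left; rw [Complex.sub_re]; linarith
      · right
        rw [Complex.sub_im, sub_ne_zero]
        intro h0; rw [h0] at h; linarith
    have hz : z ∉ Sp A := hS z hz1 hz2 (hz3.imp (fun h => by rw [h, abs_of_pos ha]) id)
    have h7 := hG z hz (sub_ne_zero.1 (Complex.slitPlane_ne_zero hslit))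
    have h8 : HasDerivAt (fun z => Complex.log (z - μ)) (z - μ)⁻¹ z := by
      simpa using ((hasDerivAt_id z).sub_const μ).clog hslit
    have h9 := (h8.smul_const f).add h7
    rw [add_sub_cancel] at h9
    exact h9
  · intro z hz1 hz2
    have hslit : -(z - μ) ∈ Complex.slitPlane := by
      left; simp; linarith
    have hz : z ∉ Sp A := hS z (by rw [hz1, abs_neg, abs_of_pos ha]) hz2
      (Or.inl (by rw [hz1, abs_neg, abs_of_pos ha]))
    have h7 := hG z hz (fun h => by rw [h, sub_self, neg_zero] at hslit; simp at hslit)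
    have h8 : HasDerivAt (fun z => Complex.log (-(z - μ))) (z - μ)⁻¹ z := by
      convert! ((hasDerivAt_id z).sub_const μ).neg.clog hslit using 1
      change _ = -1 / -(z - μ)
      rw [neg_div_neg_eq, one_div]
    have h9 := (h8.smul_const f).add h7
    rw [add_sub_cancel] at h9
    exact h9

/-- A single branch `log (-(z - μ))` serves the whole boundary. Treating `μ` to the right is enough,
because spectrum outside the box lies in disks to its right. -/
theorem boxIntegral_resolv_apply_of_lt {μ : ℂ} (ha : 0 ≤ a) (hy : 0 ≤ y)
    (hS : ∀ z : ℂ, |z.re| ≤ a → |z.im| ≤ y → |z.re| = a ∨ |z.im| = y → z ∉ Sp A)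
    {f : H} (hf : f ∈ rootSpace A μ) (hμ : a < μ.re) :
    boxIntegral (resolv A) a y f = 0 := by
  obtain ⟨G, hG⟩ := exists_primitive_resolv_apply hf
  have key : ∀ z : ℂ, |z.re| ≤ a → z ∉ Sp A →
      HasDerivAt (fun z => Complex.log (-(z - μ)) • f + G z) (resolv A z f) z := by
    intro z hz1 hz
    have hslit : -(z - μ) ∈ Complex.slitPlane := by
      left; simp; linarith [(abs_le.1 hz1).2]
    have h7 := hG z hz (fun h => by rw [h, sub_self, neg_zero] at hslit; simp at hslit)
    have h8 : HasDerivAt (fun z => Complex.log (-(z - μ))) (z - μ)⁻¹ z := by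
      convert! ((hasDerivAt_id z).sub_const μ).neg.clog hslit using 1
      change _ = -1 / -(z - μ)
      rw [neg_div_neg_eq, one_div]
    have h9 := (h8.smul_const f).add h7
    rw [add_sub_cancel] at h9
    exact h9
  rw [boxIntegral_resolv_apply ha hy hS (P := fun z => Complex.log (-(z - μ)) • f + G z)
    (Q := fun z => Complex.log (-(z - μ)) • f + G z), sub_self, sub_self, sub_self]
  · intro z hz1 hz2 hz3
    exact key z hz1 (hS z hz1 hz2 (hz3.imp (fun h => by rw [h, abs_of_nonneg ha]) id))
  · intro z hz1 hz2
    have : |z.re| = a := by rw [hz1, abs_neg, abs_of_nonneg ha]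
    exact key z this.le (hS z this.le hz2 (Or.inl this))

end

end

/-! ### The projections evaluated on the Riesz basis. -/

section

variable {b : ℝ → ℂ} {e : HilbertBasis ℕ ℂ H} {N n : ℕ}

theorem normV_nonneg (b : ℝ → ℂ) : 0 ≤ normV b := Real.iSup_nonneg fun _ => ENNReal.toReal_nonneg

theorem Y_nonneg (b : ℝ → ℂ) : 0 ≤ Y b := by
  have := normV_nonneg b
  unfold Y
  positivity

theorem mem_S_iff {z : ℂ} :
    z ∈ S b n ↔ z ∈ box (2 * n) (Y b) ∨ ∃ k ≥ n, z ∈ Metric.ball (ev0 k) (1 / 16) := by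
  simp [S]

theorem lt_re_of_mem_ball {z : ℂ} {k : ℕ} (hz : z ∈ Metric.ball (ev0 k) (1 / 16)) :
    2 * (k : ℝ) < z.re := by
  rw [Metric.mem_ball, dist_eq_norm] at hz
  have h1 := Complex.abs_re_le_norm (z - ev0 k)
  rw [Complex.sub_re, re_ev0] at h1
  linarith [(abs_le.1 h1).1]

theorem notMem_box_of_mem_ball {z : ℂ} {k : ℕ} (hk : n ≤ k)
    (hz : z ∈ Metric.ball (ev0 k) (1 / 16)) : z ∉ box (2 * n) (Y b) := by
  rintro ⟨h1, _⟩
  have h2 := lt_re_of_mem_ball hz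
  have h3 : (n : ℝ) ≤ k := Nat.cast_le.2 hk
  linarith [(abs_lt.1 h1).2]

theorem eq_of_mem_ball {z : ℂ} {j k : ℕ} (hj : z ∈ Metric.ball (ev0 j) (1 / 16))
    (hk : z ∈ Metric.ball (ev0 k) (1 / 16)) : j = k :=
  eq_of_norm_sub_ev0_lt (by rwa [Metric.mem_ball, dist_eq_norm] at hj)
    (by rwa [Metric.mem_ball, dist_eq_norm] at hk)

/-- The unit circle about `2k+1` spans `[2k, 2k+2]` in real part; the box ends at `2n ≤ 2k` and the
other disks have centres at distance at least `2`. So the circle misses the spectrum and encloses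
only what lies in the small disk. -/
theorem one_lt_dist_ev0 {z : ℂ} {k : ℕ} (hk : n ≤ k) (hz : z ∈ S b n)
    (hzk : z ∉ Metric.ball (ev0 k) (1 / 16)) : 1 < dist z (ev0 k) := by
  rw [dist_eq_norm]
  have h1 := Complex.abs_re_le_norm (z - ev0 k)
  rw [Complex.sub_re, re_ev0] at h1
  rcases mem_S_iff.1 hz with h | ⟨j, hj, h⟩
  · have h3 : (n : ℝ) ≤ k := Nat.cast_le.2 hk
    have h4 := (abs_lt.1 h.1).2
    have h5 := neg_abs_le (z.re - (2 * k + 1))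
    have h6 : z.re - (2 * k + 1) < -1 := by linarith
    have h7 : |z.re - (2 * k + 1)| = -(z.re - (2 * k + 1)) := abs_of_neg (by linarith)
    linarith
  · have hjk : j ≠ k := fun hjk => hzk (hjk ▸ h)
    have h2 := one_le_sq_dist hjk
    have h3 : 1 ≤ |(j : ℝ) - k| := by rwa [← one_le_sq_iff_one_le_abs]
    rw [Metric.mem_ball, dist_eq_norm] at h
    have h4 := Complex.abs_re_le_norm (z - ev0 j)
    rw [Complex.sub_re, re_ev0] at h4
    have h5 := abs_sub_abs_le_abs_sub (2 * ((j : ℝ) - k)) (-(z.re - (2 * j + 1)))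
    rw [abs_neg, abs_mul, abs_two] at h5
    have h6 : 2 * ((j : ℝ) - k) - -(z.re - (2 * j + 1)) = z.re - (2 * k + 1) := by ring
    rw [h6] at h5
    linarith

theorem two_pi_I_inv_smul (x : H) :
    (2 * Real.pi * Complex.I : ℂ)⁻¹ • (2 * Real.pi * Complex.I : ℂ) • x = x :=
  inv_smul_smul₀ Complex.two_pi_I_ne_zero x

open Classical in
theorem projS_apply (hn : Sp (L b) ⊆ S b n) {μ : ℂ} (hμ : μ ∈ Sp (L b)) {f : H}
    (hf : f ∈ rootSpace (L b) μ) : projS b n f = if μ ∈ box (2 * n) (Y b) then f else 0 := by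
  have hS : ∀ z : ℂ, |z.re| ≤ 2 * n → |z.im| ≤ Y b → |z.re| = 2 * n ∨ |z.im| = Y b →
      z ∉ Sp (L b) := by
    intro z h1 h2 h3 hz
    rcases mem_S_iff.1 (hn hz) with h | ⟨k, hk, h⟩
    · rcases h3 with h3 | h3
      · exact h.1.ne h3
      · exact h.2.ne h3
    · have h4 := lt_re_of_mem_ball h
      have h5 : (n : ℝ) ≤ k := Nat.cast_le.2 hk
      linarith [(abs_le.1 h1).2]
  rw [projS, _root_.smul_apply]
  split_ifs with hbox
  · rw [boxIntegral_resolv_apply_of_mem hS hf hbox, two_pi_I_inv_smul]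
  · obtain ⟨k, hk, h⟩ := (mem_S_iff.1 (hn hμ)).resolve_left hbox
    have h4 := lt_re_of_mem_ball h
    have h5 : (n : ℝ) ≤ k := Nat.cast_le.2 hk
    rw [boxIntegral_resolv_apply_of_lt (by positivity) (Y_nonneg b) hS hf (by linarith), smul_zero]

open Classical in
theorem projP_apply (hn : Sp (L b) ⊆ S b n) {k : ℕ} (hk : n ≤ k) {μ : ℂ} (hμ : μ ∈ Sp (L b))
    {f : H} (hf : f ∈ rootSpace (L b) μ) :
    projP b k f = if μ ∈ Metric.ball (ev0 k) (1 / 16) then f else 0 := by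
  have hS : ∀ z ∈ Metric.sphere (ev0 k) 1, z ∉ Sp (L b) := by
    intro z hz hzS
    rw [Metric.mem_sphere] at hz
    by_cases h : z ∈ Metric.ball (ev0 k) (1 / 16)
    · rw [Metric.mem_ball] at h
      linarith
    · exact (one_lt_dist_ev0 hk (hn hzS) h).ne' hz
  rw [projP, _root_.smul_apply, circleIntegral_resolv_apply zero_le_one hS hμ hf]
  split_ifs with h
  · rw [circleIntegral.integral_sub_inv_of_mem_ball
      (Metric.ball_subset_ball (by norm_num) h), two_pi_I_inv_smul]
  · rw [circleIntegral_inv_sub_eq_zero zero_le_one, zero_smul, smul_zero]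
    rw [Metric.mem_closedBall]
    exact (one_lt_dist_ev0 hk (hn hμ) h).not_ge

theorem clm_ext_of_equiv (e : HilbertBasis ℕ ℂ H) (V : H ≃L[ℂ] H) {S T : H →L[ℂ] H}
    (h : ∀ k, S (V (e k)) = T (V (e k))) : S = T := by
  have h1 : S ∘L (V : H →L[ℂ] H) = T ∘L (V : H →L[ℂ] H) := clm_ext_basis e h
  ext1 f
  have := congrArg (fun X : H →L[ℂ] H => X (V.symm f)) h1
  simpa using this

theorem hasSum_apply_of_equiv (e : HilbertBasis ℕ ℂ H) (V : H ≃L[ℂ] H) (T : H →L[ℂ] H) (f : H) :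
    HasSum (fun k => inner ℂ (e k) (V.symm f) • T (V (e k))) (T f) := by
  have := hasSum_clm_apply e (T ∘L (V : H →L[ℂ] H)) (V.symm f)
  simpa using this

/-- The rank of an operator which is the projection onto the span of finitely many members of a
Riesz basis. -/
theorem dimRange_eq_card (e : HilbertBasis ℕ ℂ H) (V : H ≃L[ℂ] H) {T : H →L[ℂ] H} (s : Finset ℕ)
    (hT : ∀ k, T (V (e k)) = if k ∈ s then V (e k) else 0) : dimRange T = s.card := by
  let v : s → H := fun k => V (e k)
  have hv : LinearIndependent ℂ v :=
    (e.orthonormal.linearIndependent.map' (V : H →L[ℂ] H).toLinearMap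
      (LinearMap.ker_eq_bot.2 V.injective)).comp _ Subtype.val_injective
  have hrange : LinearMap.range (T : H →ₗ[ℂ] H) = Submodule.span ℂ (Set.range v) := by
    refine le_antisymm ?_ ?_
    · rintro _ ⟨f, rfl⟩
      have h1 := hasSum_apply_of_equiv e V T f
      have h2 : HasSum (fun k => inner ℂ (e k) (V.symm f) • T (V (e k)))
          (∑ k ∈ s, inner ℂ (e k) (V.symm f) • T (V (e k))) :=
        hasSum_sum_of_ne_finset_zero fun k hk => by rw [hT, if_neg hk, smul_zero]
      change T f ∈ _
      rw [h1.unique h2]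
      refine Submodule.sum_mem _ fun k hk => Submodule.smul_mem _ _ ?_
      rw [hT, if_pos hk]
      exact Submodule.subset_span ⟨⟨k, hk⟩, rfl⟩
    · rw [Submodule.span_le]
      rintro _ ⟨k, rfl⟩
      exact ⟨V (e k), (hT k).trans (if_pos k.2)⟩
  rw [dimRange, LinearMap.rank, hrange, rank_span hv, Cardinal.mk_range_eq v hv.injective,
    Cardinal.mk_coe_finset]

namespace IsRootSystem

variable {V : H ≃L[ℂ] H} {ev : ℕ → ℂ} {z₀ : ℂ} {R : H →L[ℂ] H}

theorem dimRange_projS (h : IsRootSystem (L b) e N V ev z₀ R) (hS : Sp (L b) ⊆ S b N) :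
    dimRange (projS b N) = N := by
  classical
  rw [dimRange_eq_card e V (Finset.range N), Finset.card_range]
  intro k
  rw [projS_apply hS (h.mem_Sp k) (h.mem_rootSpace k)]
  refine if_congr (Iff.trans ⟨fun hbox => ?_, fun hk => ?_⟩ Finset.mem_range.symm) rfl rfl
  · by_contra hk
    refine notMem_box_of_mem_ball (not_lt.1 hk) ?_ hbox
    rw [Metric.mem_ball, dist_eq_norm]
    exact h.near k (not_lt.1 hk)
  · refine (mem_S_iff.1 (hS (h.mem_Sp k))).resolve_right ?_
    rintro ⟨j, hj, hjk⟩
    rw [Metric.mem_ball, dist_eq_norm] at hjk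
    exact (h.far k hk j hj).not_gt hjk

theorem dimRange_projP (h : IsRootSystem (L b) e N V ev z₀ R) (hS : Sp (L b) ⊆ S b N) {j : ℕ}
    (hj : N ≤ j) : dimRange (projP b j) = 1 := by
  classical
  rw [dimRange_eq_card e V {j}, Finset.card_singleton, Nat.cast_one]
  intro k
  rw [projP_apply hS hj (h.mem_Sp k) (h.mem_rootSpace k)]
  refine if_congr (Iff.trans ⟨fun hball => ?_, fun hk => ?_⟩ Finset.mem_singleton.symm) rfl rfl
  · rcases lt_or_ge k N with hk | hk
    · rw [Metric.mem_ball, dist_eq_norm] at hball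
      exact absurd hball (h.far k hk j hj).not_gt
    · refine eq_of_mem_ball ?_ hball
      rw [Metric.mem_ball, dist_eq_norm]
      exact h.near k hk
  · rw [Metric.mem_ball, dist_eq_norm, hk]
    exact h.near j hj

theorem projS_mul_self (h : IsRootSystem (L b) e N V ev z₀ R) (hn : Sp (L b) ⊆ S b n) :
    projS b n * projS b n = projS b n := by
  classical
  refine clm_ext_of_equiv e V fun k => ?_
  rw [mul_apply_eq_comp, projS_apply hn (h.mem_Sp k) (h.mem_rootSpace k)]
  split_ifs with h1
  · rw [projS_apply hn (h.mem_Sp k) (h.mem_rootSpace k), if_pos h1]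
  · rw [map_zero]

theorem projS_mul_projP (h : IsRootSystem (L b) e N V ev z₀ R) (hn : Sp (L b) ⊆ S b n) {j : ℕ}
    (hj : n ≤ j) : projS b n * projP b j = 0 := by
  classical
  refine clm_ext_of_equiv e V fun k => ?_
  rw [mul_apply_eq_comp, projP_apply hn hj (h.mem_Sp k) (h.mem_rootSpace k), _root_.zero_apply]
  split_ifs with h1
  · rw [projS_apply hn (h.mem_Sp k) (h.mem_rootSpace k), if_neg (notMem_box_of_mem_ball hj h1)]
  · rw [map_zero]

theorem projP_mul_projS (h : IsRootSystem (L b) e N V ev z₀ R) (hn : Sp (L b) ⊆ S b n) {j : ℕ}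
    (hj : n ≤ j) : projP b j * projS b n = 0 := by
  classical
  refine clm_ext_of_equiv e V fun k => ?_
  rw [mul_apply_eq_comp, projS_apply hn (h.mem_Sp k) (h.mem_rootSpace k), _root_.zero_apply]
  split_ifs with h1
  · rw [projP_apply hn hj (h.mem_Sp k) (h.mem_rootSpace k),
      if_neg fun h2 => notMem_box_of_mem_ball hj h2 h1]
  · rw [map_zero]

theorem projP_mul_projP (h : IsRootSystem (L b) e N V ev z₀ R) (hn : Sp (L b) ⊆ S b n) {i j : ℕ}
    (hi : n ≤ i) (hj : n ≤ j) : projP b i * projP b j = if i = j then projP b j else 0 := by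
  classical
  refine clm_ext_of_equiv e V fun k => ?_
  have hj' := projP_apply hn hj (h.mem_Sp k) (h.mem_rootSpace k)
  have hi' := projP_apply hn hi (h.mem_Sp k) (h.mem_rootSpace k)
  rw [mul_apply_eq_comp, hj']
  by_cases hij : i = j
  · subst hij
    rw [if_pos rfl, hj']
    split_ifs with h1
    · rw [hj', if_pos h1]
    · rw [map_zero]
  · rw [if_neg hij, _root_.zero_apply]
    split_ifs with h1
    · rw [hi', if_neg fun h2 => hij (eq_of_mem_ball h2 h1)]
    · rw [map_zero]

/-- The basis expansion of `(1 - S_n) f` is regrouped by the disk that contains the eigenvalue;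
unconditional summability permits this. The index `n` is unrelated to the `N` of the root system:
only the inclusion of the spectrum is used. -/
theorem hasSum_projP (h : IsRootSystem (L b) e N V ev z₀ R) (hn : Sp (L b) ⊆ S b n) (f : H) :
    HasSum (fun k : Set.Ici n => projP b k f) (f - projS b n f) := by
  classical
  set u : ℕ → H := fun k =>
    inner ℂ (e k) (V.symm f) • (1 - projS b n : H →L[ℂ] H) (V (e k)) with hu
  have hu' : ∀ k, u k = if ev k ∈ box (2 * n) (Y b) then 0
      else inner ℂ (e k) (V.symm f) • V (e k) := by
    intro k
    simp only [hu, _root_.sub_apply, one_apply_eq_self,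
      projS_apply hn (h.mem_Sp k) (h.mem_rootSpace k)]
    split_ifs <;> simp
  have hsum : HasSum u (f - projS b n f) := hasSum_apply_of_equiv e V (1 - projS b n) f
  -- Indices with eigenvalue in the box have zero term and may be assigned to any disk; `n` is the
  -- default.
  have hex : ∀ k, ∃ j : Set.Ici n, ev k ∉ box (2 * n) (Y b) →
      ev k ∈ Metric.ball (ev0 j) (1 / 16) := by
    intro k
    rcases mem_S_iff.1 (hn (h.mem_Sp k)) with h1 | ⟨j, hj, h1⟩
    · exact ⟨⟨n, Set.self_mem_Ici⟩, fun h2 => absurd h1 h2⟩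
    · exact ⟨⟨j, hj⟩, fun _ => h1⟩
  choose cl hcl using hex
  rw [← (Equiv.sigmaFiberEquiv cl).hasSum_iff] at hsum
  refine hsum.sigma fun j => ?_
  change HasSum (u ∘ ((↑) : {k | cl k = j} → ℕ)) _
  rw [hasSum_subtype_iff_indicator]
  refine (hasSum_apply_of_equiv e V (projP b j) f).congr_fun fun k => ?_
  rw [projP_apply hn j.2 (h.mem_Sp k) (h.mem_rootSpace k), Set.indicator_apply, hu']
  by_cases hbox : ev k ∈ box (2 * n) (Y b)
  · rw [if_pos hbox, if_neg fun h2 => notMem_box_of_mem_ball j.2 h2 hbox]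
    simp
  · rw [if_neg hbox]
    by_cases hj : cl k = j
    · rw [if_pos (show k ∈ {k | cl k = j} from hj), if_pos (hj ▸ hcl k hbox)]
    · rw [if_neg (show k ∉ {k | cl k = j} from hj), if_neg, smul_zero]
      exact fun h2 => hj (Subtype.ext (eq_of_mem_ball (hcl k hbox) h2))

end IsRootSystem

end

end HermitePerturbation

end

open HermitePerturbation
theorem theorem1 (b : ℝ → ℂ) (hb : MemV b) :
    (∃ N : ℕ, Localizes b N ∧ dimRange (projS b N) = N ∧ ∀ k ≥ N, dimRange (projP b k) = 1) ∧
    (∀ N : ℕ, Localizes b N →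
      projS b N * projS b N = projS b N ∧
      (∀ k ≥ N, projS b N * projP b k = 0 ∧ projP b k * projS b N = 0) ∧
      (∀ j ≥ N, ∀ k ≥ N, projP b j * projP b k = if j = k then projP b k else 0) ∧
      ∀ f : H, HasSum (fun k : Set.Ici N => projP b k f) (f - projS b N f)) ∧
    (∃ φ : ℕ → H, IsSEAF (L b) φ) ∧
    (∀ φ : ℕ → H, IsSEAF (L b) φ → ∃ β : UnconditionalSchauderBasis ℕ ℂ H, β.basis = φ) := by
  obtain ⟨N, V, ev, z₀, R, h, hS⟩ := hb.exists_rootSystem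
  refine ⟨⟨N, h.localizes hS, h.dimRange_projS hS, fun k hk => h.dimRange_projP hS hk⟩,
    fun n hn => ⟨h.projS_mul_self hn.1, fun k hk => ⟨h.projS_mul_projP hn.1 hk,
      h.projP_mul_projS hn.1 hk⟩, fun j hj k hk => h.projP_mul_projP hn.1 hj hk,
      h.hasSum_projP hn.1⟩, ⟨_, h.isSEAF⟩, fun φ hφ => h.exists_basis_of_isSEAF hφ⟩
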